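/- **Skew big $q$-Jacobi polynomials and the ordered $q$-integral.** Let $0<q<1$, $0<aq^{1/2}<1$, $0\le bq^{1/2}<1$ and $c<0$. Write $(x;q)_n=\prod_{i=0}^{n-1}(1-xq^i)$, $(x;q)_\infty=\prod_{i\ge 0}(1-xq^i)$, $(x_1,\dots,x_r;q)_n=\prod_j (x_j;q)_n$ (also for $n=\infty$), and use Jackson integrals $$\int_0^\beta f(x)\,d_qx=(1-q)\sum_{k\ge0}\beta q^kf(\beta q^k),\qquad \int_\alpha^\beta=\int_0^\beta-\int_0^\alpha .$$ Let $$\rho^{(a,b,c)}(x;q)=\frac{(a^{-1}x,c^{-1}x;q)_\infty}{(x,bc^{-1}x;q)_\infty},\qquad \omega(x)=\rho^{(aq^{-1/2},bq^{-1/2},cq^{-1/2})}(x;q)=\frac{(a^{-1}q^{1/2}x,c^{-1}q^{1/2}x;q)_\infty}{(x,bc^{-1}x;q)_\infty},$$ let $$\langle\phi,\psi\rangle=\int_{y=cq^{1/2}}^{aq^{1/2}}\int_{x=cq^{1/2}}^{q^{1/2}y}\bigl(\phi(x)\psi(y)-\phi(y)\psi(x)\bigr)\omega(x)\omega(y)\,d_qx\,d_qy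 ,$$ and let $J_n(x;q)=J_n^{(a,b,c)}(x;q)$ be the monic big $q$-Jacobi polynomials, i.e. the monic multiples of ${}_3\phi_2(q^{-n},abq^{n+1},x;aq,cq;q,q)$. (1) The form $\langle\cdot,\cdot\rangle$ converges on real polynomials. A sequence $(Q_n)_{n\ge0}$ of real polynomials, with $Q_n$ monic of degree $n$, satisfies $$\langle Q_{2m},Q_{2n}\rangle=\langle Q_{2m+1},Q_{2n+1}\rangle=0,\qquad \langle Q_{2m},Q_{2n+1}\rangle=u_m\delta_{m,n}\quad (u_m\ne0)$$ if and only if, up to replacing $Q_{2n+1}$ by $Q_{2n+1}+\alpha_nQ_{2n}$ with real constants $\alpha_n$, for all $n\ge0$ $$Q_{2n}(x)=J_{2n}(x;q^{1/2}),$$ $$Q_{2n+1}(x)=J_{2n+1}(x;q^{1/2})+\frac{acq^{n+1}(1-q^n)(1-aq^n)(1-bq^n)(1-cq^n)(1-abc^{-1}q^n)(1-abq^n)}{(abq^{2n-1/2};q^{1/2})_4}\,J_{2n-1}(x;q^{1/2}),$$ where the last term is absent for $n=0$. (2) For all $n\ge0$ the following ordered $q$-integral converges and $$\int_{z_1=cq^{1/2}}^{aq^{1/2}}\int_{z_2=cq^{1/2}}^{q^{1/2}z_1}\cdots\int_{z_{2n}=cq^{1/2}}^{q^{1/2}z_{2n-1}}\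 \prod_{1\le j<k\le 2n}(z_j-z_k)\prod_{i=1}^{2n}\frac{(a^{-1}q^{1/2}z_i,c^{-1}q^{1/2}z_i;q)_\infty}{(z_i,bc^{-1}z_i;q)_\infty}\,d_qz_i$$ $$=(-1)^n(1-q)^{2n}a^{n^2+n}c^{n^2}q^{\frac{n}{12}(4n+5)(n+1)}\frac{(q^{1/2},a^{-1}c,ac^{-1}q^{1/2};q^{1/2})_\infty^n}{(aq^{1/2},bq^{1/2},cq^{1/2},abc^{-1}q^{1/2};q^{1/2})_\infty^n}\prod_{i=0}^{n-1}\frac{(abq^{2i+3/2};q^{1/2})_\infty\,(q^{1/2},aq^{1/2},bq^{1/2},cq^{1/2},abc^{-1}q^{1/2};q^{1/2})_{2i}}{(abq^{i+1/2};q^{1/2})_{2i}} .$$ -/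

import Mathlib

open Polynomial

noncomputable section

/-- The finite `q`-shifted factorial `(x; q)_n`. -/
def qPoch (x q : ℝ) (n : ℕ) : ℝ := ∏ i ∈ Finset.range n, (1 - x * q ^ i)

/-- The infinite `q`-shifted factorial `(x; q)_∞` (convergent for `|q| < 1`). -/
def qPochInf (x q : ℝ) : ℝ := ∏' i : ℕ, (1 - x * q ^ i)

/-- `(x₁, …, x_r; q)_n = (x₁; q)_n ⋯ (x_r; q)_n`. -/
def qPochs (xs : List ℝ) (q : ℝ) (n : ℕ) : ℝ := (xs.map fun x => qPoch x q n).prod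

/-- `(x₁, …, x_r; q)_∞ = (x₁; q)_∞ ⋯ (x_r; q)_∞`. -/
def qPochsInf (xs : List ℝ) (q : ℝ) : ℝ := (xs.map fun x => qPochInf x q).prod

/-- The Jackson integral `∫_0^b f(x) d_q x = (1 - q) ∑_k b q^k f(b q^k)`. -/
def jacksonZero (q b : ℝ) (f : ℝ → ℝ) : ℝ := (1 - q) * ∑' k : ℕ, b * q ^ k * f (b * q ^ k)

/-- The Jackson integral `∫_a^b f(x) d_q x = ∫_0^b f(x) d_q x - ∫_0^a f(x) d_q x`. -/
def jackson (q a b : ℝ) (f : ℝ → ℝ) : ℝ := jacksonZero q b f - jacksonZero q a f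

/-- Absolute convergence of the two series defining `∫_a^b f(x) d_q x`. -/
def JacksonIntegrable (q a b : ℝ) (f : ℝ → ℝ) : Prop :=
  Summable (fun k : ℕ => b * q ^ k * f (b * q ^ k)) ∧
    Summable (fun k : ℕ => a * q ^ k * f (a * q ^ k))

/-- The ordered `q`-integral
`∫_{z_1=lo}^{hi} ∫_{z_2=lo}^{q^{1/2} z_1} ⋯ ∫_{z_n=lo}^{q^{1/2} z_{n-1}} f(z_1,…,z_n) d_q z_n ⋯ d_q z_1`. -/
def orderedJackson (q lo : ℝ) : (n : ℕ) → (hi : ℝ) → ((Fin n → ℝ) → ℝ) → ℝ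
  | 0, _, f => f Fin.elim0
  | n + 1, hi, f =>
      jackson q lo hi fun z => orderedJackson q lo n (√q * z) fun t => f (Fin.cons z t)

/-- Convergence of all the `q`-integrals occurring in `orderedJackson q lo n hi f`. -/
def OrderedJacksonConverges (q lo : ℝ) : (n : ℕ) → (hi : ℝ) → ((Fin n → ℝ) → ℝ) → Prop
  | 0, _, _ => True
  | n + 1, hi, f =>
      JacksonIntegrable q lo hi
          (fun z => orderedJackson q lo n (√q * z) fun t => f (Fin.cons z t)) ∧
        ∀ z : ℝ, (∃ k : ℕ, z = hi * q ^ k ∨ z = lo * q ^ k) →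
          OrderedJacksonConverges q lo n (√q * z) fun t => f (Fin.cons z t)

/-- The integrand `(φ(x) ψ(y) - φ(y) ψ(x)) w(x) w(y)` of the skew inner product. -/
def skewIntegrand (w φ ψ : ℝ → ℝ) (x y : ℝ) : ℝ := (φ x * ψ y - φ y * ψ x) * w x * w y

/-- The skew inner product
`∫_{y=lo}^{hi} ∫_{x=lo}^{q^{1/2} y} (φ(x) ψ(y) - φ(y) ψ(x)) w(x) w(y) d_q x d_q y`. -/
def skewInner (q lo hi : ℝ) (w φ ψ : ℝ → ℝ) : ℝ :=
  jackson q lo hi fun y => jackson q lo (√q * y) fun x => skewIntegrand w φ ψ x y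

/-- Convergence of all the `q`-integrals occurring in `skewInner q lo hi w φ ψ`. -/
def SkewInnerConverges (q lo hi : ℝ) (w φ ψ : ℝ → ℝ) : Prop :=
  JacksonIntegrable q lo hi
      (fun y => jackson q lo (√q * y) fun x => skewIntegrand w φ ψ x y) ∧
    ∀ y : ℝ, (∃ k : ℕ, y = hi * q ^ k ∨ y = lo * q ^ k) →
      JacksonIntegrable q lo (√q * y) fun x => skewIntegrand w φ ψ x y

/-- `Q_0, Q_1, …` are monic skew orthogonal polynomials for the form `B`: `Q_n` is monic of degree
`n`, `B(Q_{2m}, Q_{2n}) = B(Q_{2m+1}, Q_{2n+1}) = 0` and `B(Q_{2m}, Q_{2n+1}) = u_m δ_{m,n}` with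
nonzero `u_m`. -/
def IsMonicSkewOrthogonal (B : (ℝ → ℝ) → (ℝ → ℝ) → ℝ) (Q : ℕ → ℝ[X]) : Prop :=
  (∀ n, (Q n).Monic ∧ (Q n).natDegree = n) ∧
  (∀ m n, B (fun x => (Q (2 * m)).eval x) (fun x => (Q (2 * n)).eval x) = 0) ∧
  (∀ m n, B (fun x => (Q (2 * m + 1)).eval x) (fun x => (Q (2 * n + 1)).eval x) = 0) ∧
  ∃ u : ℕ → ℝ, (∀ m, u m ≠ 0) ∧
    ∀ m n, B (fun x => (Q (2 * m)).eval x) (fun x => (Q (2 * n + 1)).eval x) =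
      if m = n then u m else 0

/-- The big `q`-Jacobi weight `ρ^{(a,b,c)}(x; q)`. -/
def bigQJacobiWeight (a b c q x : ℝ) : ℝ :=
  qPochsInf [a⁻¹ * x, c⁻¹ * x] q / qPochsInf [x, b * c⁻¹ * x] q

/-- The monic big `q`-Jacobi polynomial `J_n(x; a, b, c; q)`, that is
`₃φ₂(q^{-n}, a b q^{n+1}, x; a q, c q; q, q)` divided by its leading coefficient. -/
def bigQJacobi (a b c q : ℝ) (n : ℕ) : ℝ[X] :=
  C (qPochs [a * q, c * q] q n / qPoch (a * b * q ^ (n + 1)) q n) *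
    ∑ k ∈ Finset.range (n + 1),
      C (qPochs [(q ^ n)⁻¹, a * b * q ^ (n + 1)] q k / qPochs [a * q, c * q, q] q k * q ^ k) *
        ∏ i ∈ Finset.range k, (1 - C (q ^ i) * X)

/-- The coefficient of `J_{2n-1}` in `Q_{2n+1}`. It vanishes for `n = 0`. -/
def skewBigQJacobiCoeff (a b c q : ℝ) (n : ℕ) : ℝ :=
  a * c * q ^ (n + 1) *
      ((1 - q ^ n) * (1 - a * q ^ n) * (1 - b * q ^ n) * (1 - c * q ^ n) *
        (1 - a * b * c⁻¹ * q ^ n)) * (1 - a * b * q ^ n) /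
    qPoch (a * b * q ^ (2 * (n : ℝ) - 1 / 2)) (√q) 4

/-- The integrand `∏_{j<k} (z_j - z_k) ∏_i w(z_i)` in `2n` variables, with
`w(z) = (a⁻¹q^{1/2}z, c⁻¹q^{1/2}z; q)_∞ / (z, bc⁻¹z; q)_∞` the skew weight written out. -/
def bigQJacobiOrderedIntegrand (a b c q : ℝ) (n : ℕ) (z : Fin (2 * n) → ℝ) : ℝ :=
  (∏ j, ∏ k ∈ Finset.Ioi j, (z j - z k)) *
    ∏ i, (qPochsInf [a⁻¹ * √q * z i, c⁻¹ * √q * z i] q /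
      qPochsInf [z i, b * c⁻¹ * z i] q)

end

section

open Filter Topology

/-! Put `p = √q` and let `L` be the big `q`-Jacobi functional in base `p`. The Pearson equation says
that `L` annihilates the range of `pearsonOp`. That range and the constants span all polynomials, so
every moment, the orthogonality and the norms of the `J_n` follow from the Pearson equation up to
the factor `L 1`.

The skew form is tied to `L` by the operator `D = skewOp`, `(D h)(x) = (num(x) h(x/p) - den(x)
h(px)) / x`. The product `ω · D f` is an exact `p²`-difference, so a double integral containing it
collapses to a single one. The weight that remains is `ω(x)` times a Pearson multiple of `ω` at
`px`, and since `(x;p)_∞ = (x;p²)_∞ (px;p²)_∞` this is the base `p` weight. The two halves of the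
skew form supply the even and odd points of the `p`-lattice, so `⟨D f, g⟩ = (1-p²)(1+p) L(fg)`
(`skewForm_skewOp`).

Moreover `D` is skew-adjoint for `L` and raises the degree by one, so `D J_n` is a combination of
`J_{n+1}` and `J_{n-1}` only. Hence `Q_{2n+1}` is a multiple of `D J_{2n}`, and its pairing with any
`P` is a multiple of `L(J_{2n} P)`, which settles the odd-odd and even-odd pairings. Applying `D` to
`J_{2n+1}` gives a two-term recursion that settles the even-even ones. Nondegeneracy gives
uniqueness up to `α_n`.

For the ordered integral, the Vandermonde product is a determinant in the `Q_k`. De Bruijn's formula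
is proved in an exterior algebra: the ordered integral of `m(z_1) ∧ ⋯ ∧ m(z_{2n})` is `I₂^n / n!`
for the two-fold primitive `I₂` (`SkewPrimitives.orderedJackson_eq`). In skew orthogonal position
`I₂` is a sum of commuting square-zero terms, and its power is the product of the values `⟨Q_{2i},
Q_{2i+1}⟩`.

These values need `L 1`. The moments of `(x;p)_k (bx/c;p)_k` tend, as `k → ∞`, to the integral of
`(x/a, x/c; p)_∞`. Both that integral and a theta product acquire the same factor under `c ↦ cp`,
and their ratio is found by letting `c → 0` along `c p^k`. -/

/-! ### Finite and infinite `q`-shifted factorials. -/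

theorem qPoch_zero (x q : ℝ) : qPoch x q 0 = 1 := by simp [qPoch]

theorem qPoch_succ (x q : ℝ) (n : ℕ) : qPoch x q (n + 1) = qPoch x q n * (1 - x * q ^ n) := by
  simp [qPoch, Finset.prod_range_succ]

theorem qPoch_succ' (x q : ℝ) (n : ℕ) : qPoch x q (n + 1) = (1 - x) * qPoch (x * q) q n := by
  simp only [qPoch, Finset.prod_range_succ', pow_zero, mul_one, pow_succ']
  rw [mul_comm]
  simp only [mul_assoc]

theorem qPoch_add (x q : ℝ) (m n : ℕ) :
    qPoch x q (m + n) = qPoch x q m * qPoch (x * q ^ m) q n := by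
  simp only [qPoch, Finset.prod_range_add, pow_add, mul_assoc]

theorem qPoch_ne_zero {x q : ℝ} (h : ∀ i : ℕ, x * q ^ i ≠ 1) (n : ℕ) : qPoch x q n ≠ 0 :=
  Finset.prod_ne_zero_iff.mpr fun i _ => sub_ne_zero.mpr (h i).symm

theorem mul_pow_ne_one {x q : ℝ} (hq0 : 0 ≤ q) (hq1 : q ≤ 1) (hx : x < 1) (i : ℕ) :
    x * q ^ i ≠ 1 := by
  rcases le_or_gt x 0 with h | h
  · have := mul_nonpos_of_nonpos_of_nonneg h (pow_nonneg hq0 i)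
    linarith
  · have := mul_le_of_le_one_right h.le (pow_le_one₀ hq0 hq1 (n := i))
    linarith

theorem summable_mul_pow {q : ℝ} (hq0 : 0 ≤ q) (hq1 : q < 1) (x : ℝ) :
    Summable fun i : ℕ => x * q ^ i :=
  (summable_geometric_of_lt_one hq0 hq1).mul_left x

theorem multipliable_one_sub_mul_pow {q : ℝ} (hq0 : 0 ≤ q) (hq1 : q < 1) (x : ℝ) :
    Multipliable fun i : ℕ => 1 - x * q ^ i := by
  simp only [sub_eq_add_neg]
  exact multipliable_one_add_of_summable (summable_mul_pow hq0 hq1 x).neg.norm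

theorem tendsto_qPoch {q : ℝ} (hq0 : 0 ≤ q) (hq1 : q < 1) (x : ℝ) :
    Filter.Tendsto (qPoch x q) Filter.atTop (nhds (qPochInf x q)) :=
  (multipliable_one_sub_mul_pow hq0 hq1 x).hasProd.tendsto_prod_nat

theorem qPochInf_zero (q : ℝ) : qPochInf 0 q = 1 := by simp [qPochInf]

theorem qPochInf_eq_mul {q : ℝ} (hq0 : 0 ≤ q) (hq1 : q < 1) (x : ℝ) (n : ℕ) :
    qPochInf x q = qPoch x q n * qPochInf (x * q ^ n) q := by
  refine tendsto_nhds_unique ((Filter.tendsto_add_atTop_iff_nat n).mpr (tendsto_qPoch hq0 hq1 x)) ?_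
  simp only [add_comm _ n, qPoch_add]
  exact (tendsto_qPoch hq0 hq1 _).const_mul _

theorem qPochInf_eq_one_sub_mul {q : ℝ} (hq0 : 0 ≤ q) (hq1 : q < 1) (x : ℝ) :
    qPochInf x q = (1 - x) * qPochInf (x * q) q := by
  simpa [qPoch] using qPochInf_eq_mul hq0 hq1 x 1

theorem abs_qPoch_sub_one_le {q : ℝ} (hq0 : 0 ≤ q) (hq1 : q < 1) (x : ℝ) (n : ℕ) :
    |qPoch x q n - 1| ≤ Real.exp (|x| * (1 - q)⁻¹) - 1 := by
  have h := Finset.norm_prod_one_add_sub_one_le (Finset.range n) fun i => -(x * q ^ i)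
  simp only [← sub_eq_add_neg, Real.norm_eq_abs, abs_neg] at h
  refine h.trans (sub_le_sub_right (Real.exp_le_exp.mpr ?_) 1)
  simp only [abs_mul, abs_of_nonneg (pow_nonneg hq0 _), ← Finset.mul_sum]
  gcongr
  rw [← tsum_geometric_of_lt_one hq0 hq1]
  exact (summable_geometric_of_lt_one hq0 hq1).sum_le_tsum _ fun i _ => pow_nonneg hq0 i

theorem abs_qPoch_le {q : ℝ} (hq0 : 0 ≤ q) (hq1 : q < 1) (x : ℝ) (n : ℕ) :
    |qPoch x q n| ≤ Real.exp (|x| * (1 - q)⁻¹) := by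
  have h1 := abs_qPoch_sub_one_le hq0 hq1 x n
  have h2 := abs_sub_abs_le_abs_sub (qPoch x q n) 1
  simp only [abs_one] at h2
  linarith

/-- The bound `exp(|x|/(1-q)) - 1` on `|(x;q)_n - 1|` is uniform in `n`, so it survives the limit `n
→ ∞`. -/
theorem tendsto_qPochInf_nhds_zero {q : ℝ} (hq0 : 0 ≤ q) (hq1 : q < 1) :
    Filter.Tendsto (fun x => qPochInf x q) (nhds 0) (nhds 1) := by
  rw [tendsto_iff_norm_sub_tendsto_zero]
  have hc : Continuous fun x : ℝ => Real.exp (|x| * (1 - q)⁻¹) - 1 := by fun_prop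
  have h0 := hc.tendsto 0
  simp only [abs_zero, zero_mul, Real.exp_zero, sub_self] at h0
  refine squeeze_zero (fun _ => norm_nonneg _) (fun x => ?_) h0
  exact le_of_tendsto ((tendsto_qPoch hq0 hq1 x).sub_const 1).norm
    (Filter.Eventually.of_forall fun n => abs_qPoch_sub_one_le hq0 hq1 x n)

theorem tendsto_mul_pow_atTop {q : ℝ} (hq0 : 0 ≤ q) (hq1 : q < 1) (x : ℝ) :
    Filter.Tendsto (fun k : ℕ => x * q ^ k) Filter.atTop (nhds 0) := by
  simpa using (tendsto_pow_atTop_nhds_zero_of_lt_one hq0 hq1).const_mul x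

/-- After finitely many factors are split off, the tail is an infinite product at an argument near
`0`, hence near `1`. -/
theorem qPochInf_ne_zero {q : ℝ} (hq0 : 0 ≤ q) (hq1 : q < 1) {x : ℝ}
    (h : ∀ i : ℕ, x * q ^ i ≠ 1) : qPochInf x q ≠ 0 := by
  obtain ⟨n, hn⟩ := (((tendsto_qPochInf_nhds_zero hq0 hq1).comp
    (tendsto_mul_pow_atTop hq0 hq1 x)).eventually_ne one_ne_zero).exists
  rw [qPochInf_eq_mul hq0 hq1 x n]
  exact mul_ne_zero (qPoch_ne_zero h n) hn

theorem qPochInf_eq_zero {q : ℝ} (hq0 : 0 ≤ q) (hq1 : q < 1) {x : ℝ} {i : ℕ}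
    (h : x * q ^ i = 1) : qPochInf x q = 0 := by
  rw [qPochInf_eq_mul hq0 hq1 x (i + 1), qPoch_succ, h]
  simp

/-- The even and odd factors separate. This is the source of the passage between the base `q = p²`
of the skew form and the base `p` of the polynomials. -/
theorem qPochInf_sq {p : ℝ} (hp0 : 0 ≤ p) (hp1 : p < 1) (x : ℝ) :
    qPochInf x p = qPochInf x (p ^ 2) * qPochInf (x * p) (p ^ 2) := by
  have hq0 : 0 ≤ p ^ 2 := sq_nonneg p
  have hq1 : p ^ 2 < 1 := by nlinarith
  have h1 := multipliable_one_sub_mul_pow hq0 hq1 x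
  have h2 := multipliable_one_sub_mul_pow hq0 hq1 (x * p)
  unfold qPochInf
  rw [← tprod_even_mul_odd (f := fun i : ℕ => 1 - x * p ^ i)]
  · simp only [pow_mul, pow_succ, mul_assoc, mul_comm p]
  · simpa only [pow_mul] using h1
  · refine h2.congr fun i => ?_
    rw [← pow_mul, pow_succ]; ring

/-! ### Admissible parameters and nonvanishing of denominators. -/

/-- The parameter range of the big `q`-Jacobi polynomials in base `p`. -/
structure BigQJacobiParams (a b c p : ℝ) : Prop where
  p_pos : 0 < p
  p_lt : p < 1
  a_pos : 0 < a
  a_lt : a * p < 1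
  b_nonneg : 0 ≤ b
  b_lt : b * p < 1
  c_neg : c < 0

namespace BigQJacobiParams

variable {a b c p : ℝ}

/-- The inductions on the degree pass to these contiguous parameters, so the range must be stable
under the shift. -/
theorem shift (h : BigQJacobiParams a b c p) : BigQJacobiParams (a * p) (b * p) (c * p) p where
  p_pos := h.p_pos
  p_lt := h.p_lt
  a_pos := mul_pos h.a_pos h.p_pos
  a_lt := by nlinarith [h.p_pos, h.p_lt, h.a_lt, mul_pos h.a_pos h.p_pos]
  b_nonneg := mul_nonneg h.b_nonneg h.p_pos.le
  b_lt := by nlinarith [h.p_pos, h.p_lt, h.b_lt, mul_nonneg h.b_nonneg h.p_pos.le]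
  c_neg := mul_neg_of_neg_of_pos h.c_neg h.p_pos

theorem ab_lt (h : BigQJacobiParams a b c p) : a * b * p ^ 2 < 1 := by
  nlinarith [h.a_lt, h.b_lt, mul_pos h.a_pos h.p_pos, mul_nonneg h.b_nonneg h.p_pos.le]

theorem c_lt (h : BigQJacobiParams a b c p) : c * p < 1 := by
  nlinarith [mul_pos (neg_pos.mpr h.c_neg) h.p_pos]

theorem abc_nonpos (h : BigQJacobiParams a b c p) : a * b * c⁻¹ ≤ 0 :=
  mul_nonpos_of_nonneg_of_nonpos (mul_nonneg h.a_pos.le h.b_nonneg) (inv_neg''.mpr h.c_neg).le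

theorem abc_lt (h : BigQJacobiParams a b c p) : a * b * c⁻¹ * p < 1 := by
  nlinarith [mul_nonneg (neg_nonneg.mpr h.abc_nonpos) h.p_pos.le]

theorem mul_pow_lt (h : BigQJacobiParams a b c p) {x : ℝ} {m n : ℕ} (hx : x * p ^ m < 1)
    (hmn : m ≤ n) : x * p ^ n < 1 := by
  obtain ⟨k, rfl⟩ := Nat.exists_eq_add_of_le hmn
  rw [pow_add, ← mul_assoc]
  rcases le_or_gt (x * p ^ m) 0 with h0 | h0
  · have := mul_nonpos_of_nonpos_of_nonneg h0 (pow_nonneg h.p_pos.le k)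
    linarith
  · have := mul_le_of_le_one_right h0.le (pow_le_one₀ h.p_pos.le h.p_lt.le (n := k))
    linarith

theorem ab_pow_lt (h : BigQJacobiParams a b c p) {n : ℕ} (hn : 2 ≤ n) : a * b * p ^ n < 1 :=
  h.mul_pow_lt h.ab_lt hn

theorem one_sub_ab_ne (h : BigQJacobiParams a b c p) {n : ℕ} (hn : 2 ≤ n) :
    1 - a * b * p ^ n ≠ 0 := by linarith [h.ab_pow_lt hn]

theorem qPoch_ne (h : BigQJacobiParams a b c p) {x : ℝ} (hx : x < 1) (n : ℕ) :
    qPoch x p n ≠ 0 :=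
  qPoch_ne_zero (fun i => mul_pow_ne_one h.p_pos.le h.p_lt.le hx i) n

theorem qPochInf_ne (h : BigQJacobiParams a b c p) {x : ℝ} (hx : x < 1) : qPochInf x p ≠ 0 :=
  qPochInf_ne_zero h.p_pos.le h.p_lt fun i => mul_pow_ne_one h.p_pos.le h.p_lt.le hx i

end BigQJacobiParams

/-! ### The `q`-difference operators on polynomials. -/

/-- The polynomial `(d x; p)_n` in the variable `x`. -/
noncomputable def qPochPoly (d p : ℝ) (n : ℕ) : ℝ[X] := ∏ i ∈ Finset.range n, (1 - C (d * p ^ i) * X)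

theorem qPochPoly_succ (d p : ℝ) (n : ℕ) :
    qPochPoly d p (n + 1) = qPochPoly d p n * (1 - C (d * p ^ n) * X) :=
  Finset.prod_range_succ _ n

theorem qPochPoly_zero (d p : ℝ) : qPochPoly d p 0 = 1 := rfl

theorem eval_qPochPoly (d p x : ℝ) (n : ℕ) : (qPochPoly d p n).eval x = qPoch (d * x) p n := by
  simp only [qPochPoly, eval_prod, qPoch]
  refine Finset.prod_congr rfl fun i _ => ?_
  simp; ring

theorem qPochPoly_comp_mul (d p : ℝ) (n : ℕ) :
    (qPochPoly d p n).comp (C p * X) * (1 - C d * X) = qPochPoly d p (n + 1) := by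
  rw [qPochPoly, qPochPoly, Finset.prod_range_succ', Polynomial.prod_comp]
  simp only [pow_zero, mul_one]
  congr 1
  refine Finset.prod_congr rfl fun i _ => ?_
  simp [pow_succ]; ring

/-- The numerator of the Pearson equation of the big `q`-Jacobi weight. -/
noncomputable def pearsonNum (a c p : ℝ) : ℝ[X] := (1 - C (a * p)⁻¹ * X) * (1 - C (c * p)⁻¹ * X)

/-- The denominator of the Pearson equation of the big `q`-Jacobi weight. -/
noncomputable def pearsonDen (b c : ℝ) : ℝ[X] := (1 - X) * (1 - C (b * c⁻¹) * X)

/-- The operator `f ↦ (num(x) f(x) - den(x) f(p x)) / x`, whose range the big `q`-Jacobi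
functional annihilates. -/
noncomputable def pearsonOp (a b c p : ℝ) (f : ℝ[X]) : ℝ[X] :=
  divX (pearsonNum a c p * f - pearsonDen b c * f.comp (C p * X))

/-- The operator `h ↦ (num(x) h(x/p) - den(x) h(p x)) / x`, which is skew-adjoint for the
big `q`-Jacobi functional. -/
noncomputable def skewOp (a b c p : ℝ) (h : ℝ[X]) : ℝ[X] :=
  divX (pearsonNum a c p * h.comp (C p⁻¹ * X) - pearsonDen b c * h.comp (C p * X))

/-- The `q`-difference operator `g ↦ (g(x/p) - g(x)) / x`. -/
noncomputable def qDiff (p : ℝ) (g : ℝ[X]) : ℝ[X] := divX (g.comp (C p⁻¹ * X) - g)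

/-- `divX` silently discards the constant term; it is exact division by `X` only when that term is
zero. For the three operators above this holds because `num` and `den` both equal `1` at `0`. -/
theorem X_mul_divX_of_coeff_zero {f : ℝ[X]} (h : f.coeff 0 = 0) : X * divX f = f := by
  have := divX_mul_X_add f
  rwa [h, C_0, add_zero, mul_comm] at this

theorem X_mul_pearsonOp (a b c p : ℝ) (f : ℝ[X]) :
    X * pearsonOp a b c p f = pearsonNum a c p * f - pearsonDen b c * f.comp (C p * X) :=
  X_mul_divX_of_coeff_zero (by simp [pearsonNum, pearsonDen])

theorem X_mul_skewOp (a b c p : ℝ) (h : ℝ[X]) :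
    X * skewOp a b c p h =
      pearsonNum a c p * h.comp (C p⁻¹ * X) - pearsonDen b c * h.comp (C p * X) :=
  X_mul_divX_of_coeff_zero (by simp [pearsonNum, pearsonDen])

theorem X_mul_qDiff (p : ℝ) (g : ℝ[X]) : X * qDiff p g = g.comp (C p⁻¹ * X) - g :=
  X_mul_divX_of_coeff_zero (by simp)

theorem comp_inv_comp {p : ℝ} (hp : p ≠ 0) (f : ℝ[X]) :
    (f.comp (C p⁻¹ * X)).comp (C p * X) = f := by
  rw [comp_assoc]
  simp [← mul_assoc, ← C_mul, hp]

theorem coeff_qDiff (p : ℝ) (g : ℝ[X]) (k : ℕ) :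
    (qDiff p g).coeff k = ((p ^ (k + 1))⁻¹ - 1) * g.coeff (k + 1) := by
  simp only [qDiff, coeff_divX, coeff_sub, comp_C_mul_X_coeff, inv_pow]
  ring

theorem qDiff_C_mul (p r : ℝ) (f : ℝ[X]) : qDiff p (C r * f) = C r * qDiff p f := by
  ext k; simp only [coeff_C_mul, coeff_qDiff]; ring

theorem qDiff_sum {ι : Type*} (p : ℝ) (s : Finset ι) (f : ι → ℝ[X]) :
    qDiff p (∑ i ∈ s, f i) = ∑ i ∈ s, qDiff p (f i) := by
  ext k; simp only [coeff_qDiff, finsetSum_coeff, Finset.mul_sum]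

theorem qDiff_one (p : ℝ) : qDiff p 1 = 0 := by
  ext k; simp [coeff_qDiff, coeff_one]

/-- The products `(x;p)_k` play the role of monomials for `qDiff`, which is why the `₃φ₂` expansion
in this basis behaves well under it. -/
theorem qDiff_qPochPoly_succ {p : ℝ} (hp : p ≠ 0) (n : ℕ) :
    qDiff p (qPochPoly 1 p (n + 1)) = C (-p⁻¹ * (1 - p ^ (n + 1))) * qPochPoly 1 p n := by
  refine mul_left_cancel₀ X_ne_zero ?_
  rw [X_mul_qDiff]
  have h : (qPochPoly 1 p (n + 1)).comp (C p⁻¹ * X) = (1 - C p⁻¹ * X) * qPochPoly 1 p n := by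
    rw [qPochPoly, qPochPoly, Finset.prod_range_succ', mul_comp,
      Polynomial.prod_comp, mul_comm]
    congr 1
    · simp
    · refine Finset.prod_congr rfl fun i _ => ?_
      simp only [sub_comp, one_comp, mul_comp, C_comp, X_comp, ← mul_assoc, ← C_mul, one_mul]
      rw [pow_succ, mul_assoc, mul_inv_cancel₀ hp, mul_one]
  rw [h, qPochPoly_succ]
  have h2 : (C (-p⁻¹ * (1 - p ^ (n + 1))) : ℝ[X]) = -C p⁻¹ + C (1 * p ^ n) := by
    rw [← C_neg, ← C_add]; congr 1; field_simp; ring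
  rw [h2]; ring

section Degree

theorem natDegree_one_sub_C_mul_X_le (r : ℝ) : (1 - C r * X : ℝ[X]).natDegree ≤ 1 := by
  compute_degree

theorem coeff_one_sub_C_mul_X (r : ℝ) : (1 - C r * X : ℝ[X]).coeff 1 = -r := by
  simp [coeff_one]

theorem natDegree_pearsonNum_le (a c p : ℝ) : (pearsonNum a c p).natDegree ≤ 2 :=
  natDegree_mul_le_of_le (natDegree_one_sub_C_mul_X_le _) (natDegree_one_sub_C_mul_X_le _)

theorem coeff_pearsonNum (a c p : ℝ) : (pearsonNum a c p).coeff 2 = (a * c * p ^ 2)⁻¹ := by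
  rw [pearsonNum, show 2 = 1 + 1 from rfl, coeff_mul_add_eq_of_natDegree_le
    (natDegree_one_sub_C_mul_X_le _) (natDegree_one_sub_C_mul_X_le _), coeff_one_sub_C_mul_X,
    coeff_one_sub_C_mul_X, neg_mul_neg, ← mul_inv]
  congr 1; ring

theorem pearsonDen_eq (b c : ℝ) : pearsonDen b c = (1 - C 1 * X) * (1 - C (b * c⁻¹) * X) := by
  simp [pearsonDen]

theorem natDegree_pearsonDen_le (b c : ℝ) : (pearsonDen b c).natDegree ≤ 2 := by
  rw [pearsonDen_eq]
  exact natDegree_mul_le_of_le (natDegree_one_sub_C_mul_X_le _) (natDegree_one_sub_C_mul_X_le _)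

theorem coeff_pearsonDen (b c : ℝ) : (pearsonDen b c).coeff 2 = b * c⁻¹ := by
  rw [pearsonDen_eq, show 2 = 1 + 1 from rfl, coeff_mul_add_eq_of_natDegree_le
    (natDegree_one_sub_C_mul_X_le _) (natDegree_one_sub_C_mul_X_le _), coeff_one_sub_C_mul_X,
    coeff_one_sub_C_mul_X]
  ring

theorem natDegree_comp_C_mul_X_le {f : ℝ[X]} {n : ℕ} (hf : f.natDegree ≤ n) (r : ℝ) :
    (f.comp (C r * X)).natDegree ≤ n := by
  rw [natDegree_le_iff_coeff_eq_zero] at hf ⊢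
  intro k hk
  rw [comp_C_mul_X_coeff, hf k hk, zero_mul]

theorem natDegree_divX_le {f : ℝ[X]} {n : ℕ} (hf : f.natDegree ≤ n + 1) :
    (divX f).natDegree ≤ n := by
  rw [natDegree_divX_eq_natDegree_tsub_one]; omega

variable (a b c p : ℝ) {f : ℝ[X]} {n : ℕ}

theorem natDegree_pearsonOp_le (hf : f.natDegree ≤ n) :
    (pearsonOp a b c p f).natDegree ≤ n + 1 := by
  refine natDegree_divX_le ((natDegree_sub_le _ _).trans (max_le ?_ ?_))
  · exact (natDegree_mul_le_of_le (natDegree_pearsonNum_le a c p) hf).trans (by omega)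
  · exact (natDegree_mul_le_of_le (natDegree_pearsonDen_le b c)
      (natDegree_comp_C_mul_X_le hf p)).trans (by omega)

theorem coeff_pearsonOp (hf : f.natDegree ≤ n) :
    (pearsonOp a b c p f).coeff (n + 1) =
      ((a * c * p ^ 2)⁻¹ - b * c⁻¹ * p ^ n) * f.coeff n := by
  rw [pearsonOp, coeff_divX, coeff_sub, show n + 1 + 1 = 2 + n by omega,
    coeff_mul_add_eq_of_natDegree_le (natDegree_pearsonNum_le a c p) hf,
    coeff_mul_add_eq_of_natDegree_le (natDegree_pearsonDen_le b c) (natDegree_comp_C_mul_X_le hf p),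
    coeff_pearsonNum, coeff_pearsonDen, comp_C_mul_X_coeff]
  ring

theorem natDegree_skewOp_le (hf : f.natDegree ≤ n) :
    (skewOp a b c p f).natDegree ≤ n + 1 := by
  refine natDegree_divX_le ((natDegree_sub_le _ _).trans (max_le ?_ ?_))
  · exact (natDegree_mul_le_of_le (natDegree_pearsonNum_le a c p)
      (natDegree_comp_C_mul_X_le hf _)).trans (by omega)
  · exact (natDegree_mul_le_of_le (natDegree_pearsonDen_le b c)
      (natDegree_comp_C_mul_X_le hf p)).trans (by omega)

theorem coeff_skewOp (hf : f.natDegree ≤ n) :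
    (skewOp a b c p f).coeff (n + 1) =
      ((a * c * p ^ 2)⁻¹ * (p ^ n)⁻¹ - b * c⁻¹ * p ^ n) * f.coeff n := by
  rw [skewOp, coeff_divX, coeff_sub, show n + 1 + 1 = 2 + n by omega,
    coeff_mul_add_eq_of_natDegree_le (natDegree_pearsonNum_le a c p) (natDegree_comp_C_mul_X_le hf _),
    coeff_mul_add_eq_of_natDegree_le (natDegree_pearsonDen_le b c) (natDegree_comp_C_mul_X_le hf p),
    coeff_pearsonNum, coeff_pearsonDen, comp_C_mul_X_coeff, comp_C_mul_X_coeff, inv_pow]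
  ring

end Degree

/-- The leading coefficient of `skewOp` in degree `n`. -/
noncomputable def skewLead (a b c p : ℝ) (n : ℕ) : ℝ := (1 - a * b * p ^ (2 * n + 2)) / (a * c * p ^ (n + 2))

theorem BigQJacobiParams.coeff_skewOp {a b c p : ℝ} (h : BigQJacobiParams a b c p) {f : ℝ[X]}
    {n : ℕ} (hf : f.natDegree ≤ n) :
    (skewOp a b c p f).coeff (n + 1) = skewLead a b c p n * f.coeff n := by
  have := h.a_pos.ne'; have := h.c_neg.ne; have := h.p_pos.ne'
  rw [_root_.coeff_skewOp a b c p hf, skewLead]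
  congr 1
  field_simp
  ring

theorem BigQJacobiParams.skewLead_ne {a b c p : ℝ} (h : BigQJacobiParams a b c p) (n : ℕ) :
    skewLead a b c p n ≠ 0 :=
  div_ne_zero (h.one_sub_ab_ne (by omega)) (mul_ne_zero (mul_ne_zero h.a_pos.ne' h.c_neg.ne)
    (pow_ne_zero _ h.p_pos.ne'))

theorem BigQJacobiParams.coeff_pearsonOp {a b c p : ℝ} (h : BigQJacobiParams a b c p) {f : ℝ[X]}
    {n : ℕ} (hf : f.natDegree ≤ n) :
    (pearsonOp a b c p f).coeff (n + 1) =
      (1 - a * b * p ^ (n + 2)) / (a * c * p ^ 2) * f.coeff n := by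
  have := h.a_pos.ne'; have := h.c_neg.ne; have := h.p_pos.ne'
  rw [_root_.coeff_pearsonOp a b c p hf]
  congr 1
  field_simp
  ring

theorem pearsonOp_add (a b c p : ℝ) (f g : ℝ[X]) :
    pearsonOp a b c p (f + g) = pearsonOp a b c p f + pearsonOp a b c p g := by
  refine mul_left_cancel₀ X_ne_zero ?_
  rw [mul_add, X_mul_pearsonOp, X_mul_pearsonOp, X_mul_pearsonOp, add_comp]
  ring

theorem BigQJacobiParams.exists_natDegree_sub_pearsonOp_le {a b c p : ℝ}
    (h : BigQJacobiParams a b c p) {n : ℕ} {g : ℝ[X]} (hg : g.natDegree ≤ n + 1) :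
    ∃ s : ℝ, (1 - a * b * p ^ (n + 2)) / (a * c * p ^ 2) * s = g.coeff (n + 1) ∧
      (g - pearsonOp a b c p (C s * X ^ n)).natDegree ≤ n := by
  have hne : (1 - a * b * p ^ (n + 2)) / (a * c * p ^ 2) ≠ 0 :=
    div_ne_zero (h.one_sub_ab_ne (by omega)) (mul_ne_zero (mul_ne_zero h.a_pos.ne' h.c_neg.ne)
      (pow_ne_zero _ h.p_pos.ne'))
  refine ⟨_, mul_div_cancel₀ _ hne, ?_⟩
  have hm := natDegree_C_mul_X_pow_le
    (g.coeff (n + 1) / ((1 - a * b * p ^ (n + 2)) / (a * c * p ^ 2))) n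
  rw [natDegree_le_iff_coeff_eq_zero]
  intro k hk
  rcases (Nat.succ_le_of_lt hk).eq_or_lt with rfl | hk'
  · rw [coeff_sub, Nat.succ_eq_add_one, h.coeff_pearsonOp hm, coeff_C_mul, coeff_X_pow_self,
      mul_one, mul_div_cancel₀ _ hne, sub_self]
  · rw [coeff_sub, coeff_eq_zero_of_natDegree_lt (hg.trans_lt hk'),
      coeff_eq_zero_of_natDegree_lt ((natDegree_pearsonOp_le a b c p hm).trans_lt hk'), sub_zero]

/-- The leading factor of `pearsonOp` never vanishes because `a b p^(n+2) < 1`, so the degree can be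
lowered step by step down to a constant. A functional killing the range is thus determined by its
value at `1`. The last clause records the top coefficient of `f`, which drives the recursion for the
norms. -/
theorem BigQJacobiParams.exists_pearsonOp_add_C {a b c p : ℝ} (h : BigQJacobiParams a b c p)
    (n : ℕ) (g : ℝ[X]) (hg : g.natDegree ≤ n + 1) :
    ∃ f : ℝ[X], f.natDegree ≤ n ∧ (∃ r : ℝ, g = pearsonOp a b c p f + C r) ∧
      (1 - a * b * p ^ (n + 2)) / (a * c * p ^ 2) * f.coeff n = g.coeff (n + 1) := by
  obtain ⟨s, hs, hdeg⟩ := h.exists_natDegree_sub_pearsonOp_le hg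
  have hm : (C s * X ^ n : ℝ[X]).natDegree ≤ n := natDegree_C_mul_X_pow_le s n
  induction n generalizing g s with
  | zero =>
    obtain ⟨r, hr⟩ := natDegree_eq_zero.mp (Nat.le_zero.mp hdeg)
    exact ⟨C s * X ^ 0, hm, ⟨r, by rw [hr]; ring⟩, by simpa using hs⟩
  | succ n ih =>
    obtain ⟨t, ht, hdeg'⟩ := h.exists_natDegree_sub_pearsonOp_le hdeg
    obtain ⟨f, hf, ⟨r, hr⟩, -⟩ := ih _ hdeg t ht hdeg' (natDegree_C_mul_X_pow_le t n)
    refine ⟨C s * X ^ (n + 1) + f, natDegree_add_le_of_degree_le hm (hf.trans (by omega)),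
      ⟨r, ?_⟩, ?_⟩
    · rw [pearsonOp_add, add_assoc, ← hr]; ring
    · rw [coeff_add, coeff_C_mul, coeff_X_pow_self, coeff_eq_zero_of_natDegree_lt
        (Nat.lt_succ_of_le hf), ← hs]
      ring

/-! ### Pearson functionals and their moments. -/

/-- A functional on polynomials satisfying the Pearson equation of the big `q`-Jacobi weight. -/
def IsPearson (a b c p : ℝ) (L : ℝ[X] →ₗ[ℝ] ℝ) : Prop := ∀ f, L (pearsonOp a b c p f) = 0

/-- The `q`-analogue of integration by parts, before any functional is applied. -/
theorem mul_pearsonOp {a b c p : ℝ} (hp : p ≠ 0) (f g : ℝ[X]) :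
    g * pearsonOp a b c p f =
      pearsonOp a b c p (g.comp (C p⁻¹ * X) * f) - pearsonNum a c p * (f * qDiff p g) := by
  refine mul_left_cancel₀ X_ne_zero ?_
  have h1 := X_mul_pearsonOp a b c p f
  have h2 := X_mul_pearsonOp a b c p (g.comp (C p⁻¹ * X) * f)
  rw [mul_comp, comp_inv_comp hp] at h2
  have h3 := X_mul_qDiff p g
  linear_combination g * h1 - h2 + pearsonNum a c p * f * h3

/-- The symmetrized product is an exact Pearson term, so a Pearson functional kills it; this is the
skew-adjointness of `skewOp`. -/
theorem mul_skewOp_add_mul_skewOp {a b c p : ℝ} (hp : p ≠ 0) (h k : ℝ[X]) :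
    h * skewOp a b c p k + k * skewOp a b c p h =
      pearsonOp a b c p (h * k.comp (C p⁻¹ * X) + k * h.comp (C p⁻¹ * X)) := by
  refine mul_left_cancel₀ X_ne_zero ?_
  have h1 := X_mul_pearsonOp a b c p (h * k.comp (C p⁻¹ * X) + k * h.comp (C p⁻¹ * X))
  rw [add_comp, mul_comp, mul_comp, comp_inv_comp hp, comp_inv_comp hp] at h1
  linear_combination h * X_mul_skewOp a b c p k + k * X_mul_skewOp a b c p h - h1

/-- The numerator for `(ap, cp)` evaluated at `px` is the numerator for `(a, c)`, while the
denominator depends on `b/c` only. Consequently `f ↦ L (num * f)` is a Pearson functional for the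
shifted parameters. -/
theorem pearsonNum_mul_pearsonOp {a b c p : ℝ} (hp : p ≠ 0) (f : ℝ[X]) :
    pearsonNum a c p * pearsonOp (a * p) (b * p) (c * p) p f =
      pearsonOp a b c p (pearsonNum (a * p) (c * p) p * f) := by
  refine mul_left_cancel₀ X_ne_zero ?_
  have h1 := X_mul_pearsonOp a b c p (pearsonNum (a * p) (c * p) p * f)
  have h2 := X_mul_pearsonOp (a * p) (b * p) (c * p) p f
  have h3 : (pearsonNum (a * p) (c * p) p).comp (C p * X) = pearsonNum a c p := by
    simp only [pearsonNum, mul_comp, sub_comp, one_comp, C_comp, X_comp, ← mul_assoc, ← C_mul]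
    congr <;> field_simp
  have h4 : pearsonDen (b * p) (c * p) = pearsonDen b c := by
    simp only [pearsonDen]; congr 4; field_simp
  rw [mul_comp, h3] at h1
  rw [h4] at h2
  linear_combination pearsonNum a c p * h2 - h1

namespace IsPearson

variable {a b c p : ℝ} {L : ℝ[X] →ₗ[ℝ] ℝ}

/-- The functional for the parameters shifted by a factor `p`. -/
theorem shift (hL : IsPearson a b c p L) (hp : p ≠ 0) :
    IsPearson (a * p) (b * p) (c * p) p (L ∘ₗ LinearMap.mulLeft ℝ (pearsonNum a c p)) := fun f => by
  simp only [LinearMap.comp_apply, LinearMap.mulLeft_apply, pearsonNum_mul_pearsonOp hp]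
  exact hL _

theorem map_mul_pearsonOp (hL : IsPearson a b c p L) (hp : p ≠ 0) (f g : ℝ[X]) :
    L (g * pearsonOp a b c p f) = -L (pearsonNum a c p * (f * qDiff p g)) := by
  rw [mul_pearsonOp hp, map_sub, hL, zero_sub]

theorem map_mul_skewOp (hL : IsPearson a b c p L) (hp : p ≠ 0) (h k : ℝ[X]) :
    L (h * skewOp a b c p k) = -L (k * skewOp a b c p h) := by
  rw [eq_neg_iff_add_eq_zero, ← map_add, mul_skewOp_add_mul_skewOp hp, hL]

theorem map_C_mul (L : ℝ[X] →ₗ[ℝ] ℝ) (r : ℝ) (f : ℝ[X]) : L (C r * f) = r * L f := by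
  rw [← smul_eq_C_mul, map_smul, smul_eq_mul]

/-- For `f = (x;p)_k (bx/c;p)_j` the factor `den(x)` extends both products in `f(px)` by one step,
so `den(x) f(px) = f(x) (1 - p^k x)(1 - (b/c) p^j x)`. Only `f` and `x f` remain, which yields
first-order recurrences for the moments in `k` and in `j`. -/
theorem pearsonOp_qPochPoly_mul (a b c p : ℝ) (k j : ℕ) :
    pearsonOp a b c p (qPochPoly 1 p k * qPochPoly (b * c⁻¹) p j) =
      C (-(a * p)⁻¹ - (c * p)⁻¹ + p ^ k + b * c⁻¹ * p ^ j) *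
          (qPochPoly 1 p k * qPochPoly (b * c⁻¹) p j) +
        C ((a * p)⁻¹ * (c * p)⁻¹ - b * c⁻¹ * p ^ (k + j)) *
          (X * (qPochPoly 1 p k * qPochPoly (b * c⁻¹) p j)) := by
  refine mul_left_cancel₀ X_ne_zero ?_
  have h1 := qPochPoly_comp_mul 1 p k
  have h2 := qPochPoly_comp_mul (b * c⁻¹) p j
  rw [qPochPoly_succ] at h1 h2
  rw [X_mul_pearsonOp, mul_comp, pearsonNum, pearsonDen_eq]
  simp only [pow_add, C_add, C_sub, C_neg, C_mul, one_mul] at h1 h2 ⊢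
  linear_combination (-(qPochPoly (b * c⁻¹) p j).comp (C p * X) * (1 - C b * C c⁻¹ * X)) * h1
    - qPochPoly 1 p k * (1 - C (p ^ k) * X) * h2

theorem map_qPochPoly_mul_succ_left (hL : IsPearson a b c p L) (ha : a ≠ 0) (hc : c ≠ 0)
    (hp : p ≠ 0) (k j : ℕ) :
    (1 - a * b * p ^ 2 * p ^ (k + j)) *
        L (qPochPoly 1 p (k + 1) * qPochPoly (b * c⁻¹) p j) =
      (1 - a * p * p ^ k) * (1 - c * p * p ^ k) *
        L (qPochPoly 1 p k * qPochPoly (b * c⁻¹) p j) := by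
  have h := hL (qPochPoly 1 p k * qPochPoly (b * c⁻¹) p j)
  rw [pearsonOp_qPochPoly_mul, map_add, map_C_mul, map_C_mul] at h
  have e : qPochPoly 1 p (k + 1) * qPochPoly (b * c⁻¹) p j =
      qPochPoly 1 p k * qPochPoly (b * c⁻¹) p j -
        C (p ^ k) * (X * (qPochPoly 1 p k * qPochPoly (b * c⁻¹) p j)) := by
    rw [qPochPoly_succ, one_mul]; ring
  rw [e, map_sub, map_C_mul]
  generalize L (qPochPoly 1 p k * qPochPoly (b * c⁻¹) p j) = u at *
  generalize L (X * (qPochPoly 1 p k * qPochPoly (b * c⁻¹) p j)) = v at *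
  rw [pow_add] at h ⊢
  field_simp at h
  linear_combination (-p ^ k) * h

theorem map_qPochPoly_mul_succ_right (hL : IsPearson a b c p L) (ha : a ≠ 0) (hc : c ≠ 0)
    (hp : p ≠ 0) (k j : ℕ) :
    (1 - a * b * p ^ 2 * p ^ (k + j)) *
        L (qPochPoly 1 p k * qPochPoly (b * c⁻¹) p (j + 1)) =
      (1 - a * b * c⁻¹ * p * p ^ j) * (1 - b * p * p ^ j) *
        L (qPochPoly 1 p k * qPochPoly (b * c⁻¹) p j) := by
  have h := hL (qPochPoly 1 p k * qPochPoly (b * c⁻¹) p j)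
  rw [pearsonOp_qPochPoly_mul, map_add, map_C_mul, map_C_mul] at h
  have e : qPochPoly 1 p k * qPochPoly (b * c⁻¹) p (j + 1) =
      qPochPoly 1 p k * qPochPoly (b * c⁻¹) p j -
        C (b * c⁻¹ * p ^ j) * (X * (qPochPoly 1 p k * qPochPoly (b * c⁻¹) p j)) := by
    rw [qPochPoly_succ]; ring
  rw [e, map_sub, map_C_mul]
  generalize L (qPochPoly 1 p k * qPochPoly (b * c⁻¹) p j) = u at *
  generalize L (X * (qPochPoly 1 p k * qPochPoly (b * c⁻¹) p j)) = v at *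
  rw [pow_add] at h ⊢
  field_simp at h ⊢
  linear_combination (-b * p ^ j) * h

/-- The case `j = 0` gives orthogonality to constants; the diagonal `j = k → ∞` gives the total
mass. -/
theorem map_qPochPoly_mul (hL : IsPearson a b c p L) (ha : a ≠ 0) (hc : c ≠ 0)
    (hp : p ≠ 0) (k j : ℕ) :
    qPoch (a * b * p ^ 2) p (k + j) * L (qPochPoly 1 p k * qPochPoly (b * c⁻¹) p j) =
      qPoch (a * p) p k * qPoch (c * p) p k * (qPoch (a * b * c⁻¹ * p) p j * qPoch (b * p) p j) *
        L 1 := by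
  induction k with
  | zero =>
    induction j with
    | zero => simp [qPoch_zero, qPochPoly_zero]
    | succ j ih =>
      have h := hL.map_qPochPoly_mul_succ_right ha hc hp 0 j
      simp only [zero_add] at h ih ⊢
      simp only [qPoch_succ, qPoch_zero] at ih ⊢
      linear_combination qPoch (a * b * p ^ 2) p j * h +
        (1 - a * b * c⁻¹ * p * p ^ j) * (1 - b * p * p ^ j) * ih
  | succ k ih =>
    have h := hL.map_qPochPoly_mul_succ_left ha hc hp k j
    rw [show k + 1 + j = k + j + 1 by omega]
    simp only [qPoch_succ] at ih ⊢
    linear_combination qPoch (a * b * p ^ 2) p (k + j) * h +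
      (1 - a * p * p ^ k) * (1 - c * p * p ^ k) * ih

theorem map_qPochPoly (hL : IsPearson a b c p L) (h : BigQJacobiParams a b c p) (k : ℕ) :
    L (qPochPoly 1 p k) =
      qPoch (a * p) p k * qPoch (c * p) p k / qPoch (a * b * p ^ 2) p k * L 1 := by
  have h1 := hL.map_qPochPoly_mul h.a_pos.ne' h.c_neg.ne h.p_pos.ne' k 0
  simp only [qPochPoly_zero, qPoch_zero, mul_one, add_zero] at h1
  rw [div_mul_eq_mul_div, eq_div_iff (h.qPoch_ne h.ab_lt k), ← h1, mul_comm]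

/-- This is the total mass of the shifted functional in terms of the original one. The numerator has
degree two, so the moments of `(x;p)_1` and `(x;p)_2` suffice. -/
theorem map_pearsonNum (hL : IsPearson a b c p L) (h : BigQJacobiParams a b c p) :
    L (pearsonNum a c p) = p * ((1 - a * p) * (1 - b * p) * (1 - c * p) * (1 - a * b * c⁻¹ * p)) /
      ((1 - a * b * p ^ 2) * (1 - a * b * p ^ 3)) * L 1 := by
  have ha := h.a_pos.ne'
  have hc := h.c_neg.ne
  have hp := h.p_pos.ne'
  have n2 := h.one_sub_ab_ne le_rfl
  have n3 := h.one_sub_ab_ne (n := 3) (by omega)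
  have h1 := hL.map_qPochPoly_mul_succ_left ha hc hp 0 0
  have h2 := hL.map_qPochPoly_mul_succ_left ha hc hp 1 0
  simp only [qPochPoly_zero, mul_one, zero_add, pow_zero, add_zero, pow_one] at h1 h2
  have e1 : qPochPoly 1 p 1 = 1 - X := by simp [qPochPoly]
  have e2 : qPochPoly 1 p 2 = 1 - X - C p * (X - X * X) := by
    simp [qPochPoly, Finset.prod_range_succ]; ring
  have e3 : pearsonNum a c p = 1 - C ((a * p)⁻¹ + (c * p)⁻¹) * X +
      C ((a * p)⁻¹ * (c * p)⁻¹) * (X * X) := by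
    simp [pearsonNum]; ring
  rw [show 1 + 1 = 2 from rfl, e1, e2, map_sub, map_sub, map_C_mul, map_sub] at h2
  rw [e1, map_sub] at h1
  rw [e3, map_add, map_sub, map_C_mul, map_C_mul]
  generalize L 1 = m0 at *
  generalize L X = m1 at *
  generalize L (X * X) = m2 at *
  have key : (a * c * p ^ 3) * ((m0 - ((a * p)⁻¹ + (c * p)⁻¹) * m1 + (a * p)⁻¹ * (c * p)⁻¹ * m2) *
      ((1 - a * b * p ^ 2) * (1 - a * b * p ^ 3))) = (a * c * p ^ 3) *
      (p * ((1 - a * p) * (1 - b * p) * (1 - c * p) * (1 - a * b * c⁻¹ * p)) * m0) := by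
    field_simp
    refine mul_left_cancel₀ hp ?_
    linear_combination (1 - a * b * p ^ 2) * h2 + ((1 - a * b * p ^ 3) * p ^ 2 * (a + c) -
      (1 - a * b * p ^ 3) * (1 + p) + (1 - a * p * p) * (1 - c * p * p)) * h1
  rw [div_mul_eq_mul_div, eq_div_iff (mul_ne_zero n2 n3)]
  exact mul_left_cancel₀ (mul_ne_zero (mul_ne_zero ha hc) (pow_ne_zero 3 hp)) key

end IsPearson

/-! ### Big `q`-Jacobi polynomials: lowering, orthogonality and norms. -/

/-- Partial sums of a balanced `₂φ₁` series telescope. -/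
theorem sum_qPoch_telescope {A B p : ℝ} {m : ℕ} (hp : qPoch p p m ≠ 0)
    (hC : qPoch (A * B * p) p m ≠ 0) :
    ∑ k ∈ Finset.range (m + 1), qPoch A p k * qPoch B p k / (qPoch p p k * qPoch (A * B * p) p k) *
      p ^ k = qPoch (A * p) p m * qPoch (B * p) p m / (qPoch p p m * qPoch (A * B * p) p m) := by
  induction m with
  | zero => simp [qPoch_zero]
  | succ m ih =>
    rw [qPoch_succ] at hp hC
    rw [Finset.sum_range_succ, ih (left_ne_zero_of_mul hp) (left_ne_zero_of_mul hC)]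
    rw [qPoch_succ' A, qPoch_succ' B, qPoch_succ p, qPoch_succ (A * B * p), qPoch_succ (A * p),
      qPoch_succ (B * p)]
    have h1 := left_ne_zero_of_mul hp
    have h2 := right_ne_zero_of_mul hp
    have h3 := left_ne_zero_of_mul hC
    have h4 := right_ne_zero_of_mul hC
    generalize qPoch (A * B * p) p m = u at *
    generalize qPoch (A * p) p m = v at *
    generalize qPoch (B * p) p m = w at *
    generalize qPoch p p m = x at *
    rw [eq_div_iff (mul_ne_zero hp hC), add_mul, div_mul_eq_mul_div, div_mul_eq_mul_div,
      div_mul_eq_mul_div,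
      mul_div_mul_comm, ← mul_div_mul_comm, div_add_div _ _ (mul_ne_zero h1 h3)
      (mul_ne_zero (mul_ne_zero h1 h2) (mul_ne_zero h3 h4)), div_eq_iff (by positivity)]
    rw [pow_succ]
    ring

/-- The coefficients of a monic big `q`-Jacobi polynomial in the basis `(x; p)_k`. -/
noncomputable def bigQJacobiCoeff (a b c p : ℝ) (n k : ℕ) : ℝ :=
  qPochs [a * p, c * p] p n / qPoch (a * b * p ^ (n + 1)) p n *
    (qPochs [(p ^ n)⁻¹, a * b * p ^ (n + 1)] p k / qPochs [a * p, c * p, p] p k * p ^ k)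

theorem bigQJacobi_eq (a b c p : ℝ) (n : ℕ) :
    bigQJacobi a b c p n =
      ∑ k ∈ Finset.range (n + 1), C (bigQJacobiCoeff a b c p n k) * qPochPoly 1 p k := by
  simp only [bigQJacobi, bigQJacobiCoeff, qPochPoly, one_mul, Finset.mul_sum, C_mul, mul_assoc]

theorem bigQJacobi_zero (a b c p : ℝ) : bigQJacobi a b c p 0 = 1 := by
  simp [bigQJacobi, qPochs, qPoch_zero]

namespace BigQJacobiParams

variable {a b c p : ℝ}

theorem coeff_succ (h : BigQJacobiParams a b c p) (n k : ℕ) :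
    bigQJacobiCoeff a b c p (n + 1) (k + 1) * (-p⁻¹ * (1 - p ^ (k + 1))) =
      ((p ^ (n + 1))⁻¹ - 1) * bigQJacobiCoeff (a * p) (b * p) (c * p) p n k := by
  have hp := h.p_pos.ne'
  have n1 : 1 - a * b * p ^ (n + 2) ≠ 0 := h.one_sub_ab_ne (by omega)
  have n2 : 1 - a * p ≠ 0 := by linarith [h.a_lt]
  have n3 : 1 - c * p ≠ 0 := by linarith [h.c_lt]
  have n4 : 1 - p ^ (k + 1) ≠ 0 := by
    have : p ^ (k + 1) < 1 := pow_lt_one₀ h.p_pos.le h.p_lt (Nat.succ_ne_zero k)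
    linarith
  have m1 := h.qPoch_ne (x := a * b * p ^ (n + 3)) (h.ab_pow_lt (by omega)) n
  have m2 := h.qPoch_ne h.shift.a_lt k
  have m3 := h.qPoch_ne h.shift.c_lt k
  have m4 := h.qPoch_ne h.p_lt k
  simp only [bigQJacobiCoeff, qPochs, List.map_cons, List.map_nil, List.prod_cons, List.prod_nil,
    mul_one]
  rw [qPoch_succ' (a * p), qPoch_succ' (c * p), qPoch_succ' (a * p), qPoch_succ' (c * p),
    qPoch_succ p, qPoch_succ' (p ^ (n + 1))⁻¹, qPoch_succ' (a * b * p ^ (n + 1 + 1)),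
    qPoch_succ' (a * b * p ^ (n + 1 + 1))]
  rw [show (p ^ (n + 1))⁻¹ * p = (p ^ n)⁻¹ by rw [pow_succ]; field_simp,
    show a * b * p ^ (n + 1 + 1) * p = a * b * p ^ (n + 3) by ring,
    show a * p * (b * p) * p ^ (n + 1) = a * b * p ^ (n + 3) by ring,
    show n + 1 + 1 = n + 2 by rfl, ← pow_succ']
  generalize qPoch (a * b * p ^ (n + 3)) p n = x1 at *
  generalize qPoch (a * b * p ^ (n + 3)) p k = x2 at *
  generalize qPoch (a * p * p) p n = x3 at *
  generalize qPoch (a * p * p) p k = x4 at *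
  generalize qPoch (c * p * p) p n = x5 at *
  generalize qPoch (c * p * p) p k = x6 at *
  generalize qPoch p p k = x7 at *
  generalize qPoch (p ^ n)⁻¹ p k = x8 at *
  generalize 1 - a * b * p ^ (n + 2) = y1 at *
  generalize 1 - a * p = y2 at *
  generalize 1 - c * p = y3 at *
  generalize 1 - p ^ (k + 1) = y4 at *
  rw [pow_succ p k]
  generalize (p ^ (n + 1))⁻¹ = z at *
  generalize p ^ k = w at *
  field_simp
  ring

/-- The lowering relation, read off coefficientwise in the basis `(x;p)_k`; degree and monicity also
follow from it by induction. -/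
theorem qDiff_bigQJacobi_succ (h : BigQJacobiParams a b c p) (n : ℕ) :
    qDiff p (bigQJacobi a b c p (n + 1)) =
      C ((p ^ (n + 1))⁻¹ - 1) * bigQJacobi (a * p) (b * p) (c * p) p n := by
  rw [bigQJacobi_eq, bigQJacobi_eq, qDiff_sum, Finset.sum_range_succ', Finset.mul_sum]
  simp only [qDiff_C_mul, qPochPoly_zero, qDiff_one, mul_zero, add_zero]
  refine Finset.sum_congr rfl fun k _ => ?_
  rw [qDiff_qPochPoly_succ h.p_pos.ne', ← mul_assoc, ← C_mul, h.coeff_succ, C_mul, mul_assoc]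

theorem inv_pow_sub_one_ne (h : BigQJacobiParams a b c p) (n : ℕ) : (p ^ (n + 1))⁻¹ - 1 ≠ 0 := by
  have h1 := pow_lt_one₀ h.p_pos.le h.p_lt (Nat.succ_ne_zero n)
  have := (one_lt_inv₀ (pow_pos h.p_pos (n + 1))).mpr h1
  linarith

theorem bigQJacobi_coeff (h : BigQJacobiParams a b c p) (n : ℕ) :
    (bigQJacobi a b c p n).natDegree ≤ n ∧ (bigQJacobi a b c p n).coeff n = 1 := by
  induction n generalizing a b c with
  | zero => simp [bigQJacobi_zero]
  | succ n ih =>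
    obtain ⟨ih1, ih2⟩ := ih h.shift
    have e : ∀ k, (bigQJacobi a b c p (n + 1)).coeff (k + 1) * ((p ^ (k + 1))⁻¹ - 1) =
        ((p ^ (n + 1))⁻¹ - 1) * (bigQJacobi (a * p) (b * p) (c * p) p n).coeff k := fun k => by
      rw [mul_comm, ← coeff_qDiff, h.qDiff_bigQJacobi_succ, coeff_C_mul]
    constructor
    · rw [natDegree_le_iff_coeff_eq_zero] at ih1 ⊢
      intro k hk
      obtain ⟨k, rfl⟩ := Nat.exists_eq_add_of_lt hk
      have := e (n + 1 + k)
      rw [ih1 _ (by omega), mul_zero] at this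
      exact (mul_eq_zero.mp this).resolve_right (h.inv_pow_sub_one_ne _)
    · have := e n
      rw [ih2, mul_comm] at this
      exact mul_left_cancel₀ (h.inv_pow_sub_one_ne n) this

theorem natDegree_bigQJacobi (h : BigQJacobiParams a b c p) (n : ℕ) :
    (bigQJacobi a b c p n).natDegree = n :=
  natDegree_eq_of_le_of_coeff_ne_zero (h.bigQJacobi_coeff n).1
    (by rw [(h.bigQJacobi_coeff n).2]; exact one_ne_zero)

/-- Inserting the moments turns the `₃φ₂` into a terminating balanced `₂φ₁` with first parameter
`p^{-(n+1)}`. Its telescoped value contains `(p^{-n};p)_{n+1}`, whose last factor is zero. -/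
theorem map_bigQJacobi_succ (h : BigQJacobiParams a b c p) {L : ℝ[X] →ₗ[ℝ] ℝ}
    (hL : IsPearson a b c p L) (n : ℕ) : L (bigQJacobi a b c p (n + 1)) = 0 := by
  have hp := h.p_pos.ne'
  have e : (p ^ (n + 1))⁻¹ * (a * b * p ^ (n + 2)) * p = a * b * p ^ 2 := by
    rw [pow_succ p n]; field_simp; ring
  have key := sum_qPoch_telescope (A := (p ^ (n + 1))⁻¹) (B := a * b * p ^ (n + 2))
    (h.qPoch_ne h.p_lt (n + 1)) (by rw [e]; exact h.qPoch_ne h.ab_lt (n + 1))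
  rw [e, show qPoch ((p ^ (n + 1))⁻¹ * p) p (n + 1) = 0 by
    rw [qPoch_succ, show (p ^ (n + 1))⁻¹ * p * p ^ n = 1 by rw [pow_succ]; field_simp]; simp,
    zero_mul, zero_div] at key
  rw [bigQJacobi_eq, map_sum]
  have : ∀ k ∈ Finset.range (n + 1 + 1),
      L (C (bigQJacobiCoeff a b c p (n + 1) k) * qPochPoly 1 p k) =
      (qPochs [a * p, c * p] p (n + 1) / qPoch (a * b * p ^ (n + 2)) p (n + 1) * L 1) *
      (qPoch (p ^ (n + 1))⁻¹ p k * qPoch (a * b * p ^ (n + 2)) p k /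
        (qPoch p p k * qPoch (a * b * p ^ 2) p k) * p ^ k) := fun k _ => by
    rw [IsPearson.map_C_mul, hL.map_qPochPoly h, bigQJacobiCoeff]
    have m1 := h.qPoch_ne h.a_lt k
    have m2 := h.qPoch_ne h.c_lt k
    simp only [qPochs, List.map_cons, List.map_nil, List.prod_cons, List.prod_nil, mul_one]
    rw [show n + 1 + 1 = n + 2 by rfl]
    generalize qPoch (a * p) p k = x1 at *
    generalize qPoch (c * p) p k = x2 at *
    field_simp
  rw [Finset.sum_congr rfl this, ← Finset.mul_sum, key, mul_zero]

end BigQJacobiParams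

/-- The squared norm of the monic big `q`-Jacobi polynomial relative to the total mass. -/
noncomputable def bigQJacobiNorm (a b c p : ℝ) (n : ℕ) : ℝ :=
  qPochs [p, a * p, b * p, c * p, a * b * c⁻¹ * p] p n * (-(a * c * p ^ 2)) ^ n *
    p ^ (n.choose 2) / (qPoch (a * b * p ^ 2) p (2 * n) * qPoch (a * b * p ^ (n + 1)) p n)

namespace BigQJacobiParams

variable {a b c p : ℝ}

theorem bigQJacobiNorm_ne (h : BigQJacobiParams a b c p) (n : ℕ) :
    bigQJacobiNorm a b c p n ≠ 0 := by
  have := h.a_pos.ne'; have := h.c_neg.ne; have := h.p_pos.ne'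
  have m1 := h.qPoch_ne h.p_lt n
  have m2 := h.qPoch_ne h.a_lt n
  have m3 := h.qPoch_ne h.b_lt n
  have m4 := h.qPoch_ne h.c_lt n
  have m5 := h.qPoch_ne h.abc_lt n
  have m6 := h.qPoch_ne h.ab_lt (2 * n)
  -- For `n = 0` the argument is `a b p`, which the bound `a b p² < 1` does not keep away from `1`;
  -- there the product is empty.
  have m7 : qPoch (a * b * p ^ (n + 1)) p n ≠ 0 := by
    rcases n with _ | n
    · simp [qPoch_zero]
    · exact h.qPoch_ne (h.ab_pow_lt (by omega)) _
  simp only [bigQJacobiNorm, qPochs, List.map_cons, List.map_nil, List.prod_cons, List.prod_nil,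
    mul_one]
  refine div_ne_zero (mul_ne_zero (mul_ne_zero ?_ (pow_ne_zero _ (neg_ne_zero.mpr ?_)))
    (pow_ne_zero _ this)) (mul_ne_zero m6 m7) <;> positivity

/-- The norm recursion with all factors made independent variables: `z8` stands for `p^n` and `i`
for `p^{-(n+1)}`, and the only relation used is `1 - z8 * p = (i - 1) * (z8 * p)`. -/
theorem norm_succ_identity (p i x1 x2 y1 y2 y3 y4 y5 y6 y7 y8 z1 z2 z3 z4 z5 z6 z7 z8 : ℝ)
    (hi : i * (z8 * p) = 1) :
    z5 * (1 - z8 * p) * (y5 * z1 * (y6 * z2 * (y7 * z3 * (y4 * z4)))) * (z6 * -y8) * (z8 * z7) /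
        (y2 * (y3 * x2) * (y1 * x1)) =
      -(i - 1) * (z5 * (z1 * (z2 * (z3 * z4))) * (z6 * z8 ^ 2) * z7 / (x2 * x1)) *
        (p * (y5 * y6 * y7 * y4) / (y2 * y3)) * (y8 / y1) := by
  linear_combination (z5 * (y5 * z1 * (y6 * z2 * (y7 * z3 * (y4 * z4)))) * z6 * y8 * z8 * z7 /
        (y2 * (y3 * x2) * (y1 * x1))) * hi

theorem bigQJacobiNorm_succ (h : BigQJacobiParams a b c p) (n : ℕ) :
    bigQJacobiNorm a b c p (n + 1) =
      -((p ^ (n + 1))⁻¹ - 1) * bigQJacobiNorm (a * p) (b * p) (c * p) p n *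
        (p * ((1 - a * p) * (1 - b * p) * (1 - c * p) * (1 - a * b * c⁻¹ * p)) /
          ((1 - a * b * p ^ 2) * (1 - a * b * p ^ 3))) *
        ((a * c * p ^ 2) / (1 - a * b * p ^ (n + 2))) := by
  have hp := h.p_pos.ne'
  have hc := h.c_neg.ne
  have n1 : 1 - a * b * p ^ (n + 2) ≠ 0 := h.one_sub_ab_ne (by omega)
  have n2 := h.one_sub_ab_ne (n := 2) le_rfl
  have n3 := h.one_sub_ab_ne (n := 3) (by omega)
  have m1 := h.qPoch_ne (x := a * b * p ^ (n + 3)) (h.ab_pow_lt (by omega)) n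
  have m2 := h.qPoch_ne (x := a * b * p ^ 4) (h.ab_pow_lt (by omega)) (2 * n)
  simp only [bigQJacobiNorm, qPochs, List.map_cons, List.map_nil, List.prod_cons, List.prod_nil,
    mul_one]
  rw [show 2 * (n + 1) = 2 * n + 1 + 1 by ring, qPoch_succ p, qPoch_succ' (a * p),
    qPoch_succ' (b * p), qPoch_succ' (c * p), qPoch_succ' (a * b * c⁻¹ * p),
    qPoch_succ' (a * b * p ^ 2), qPoch_succ' (a * b * p ^ 2 * p),
    qPoch_succ' (a * b * p ^ (n + 1 + 1)),
    show a * b * p ^ 2 * p = a * b * p ^ 3 by ring, show a * b * p ^ 3 * p = a * b * p ^ 4 by ring,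
    show a * b * p ^ (n + 1 + 1) * p = a * b * p ^ (n + 3) by ring,
    show a * p * (b * p) * p ^ (n + 1) = a * b * p ^ (n + 3) by ring,
    show a * p * (b * p) * p ^ 2 = a * b * p ^ 4 by ring,
    show a * p * (b * p) * (c * p)⁻¹ * p = a * b * c⁻¹ * p * p by field_simp,
    show -(a * p * (c * p) * p ^ 2) = -(a * c * p ^ 2) * p ^ 2 by ring, mul_pow,
    Nat.choose_succ_succ' n 1, Nat.choose_one_right, show n + 1 + 1 = n + 2 by rfl, mul_comm p (p ^ n), pow_succ p n,
    show 1 + 1 = 2 from rfl, pow_add p n (n.choose 2), pow_succ (-(a * c * p ^ 2)), ← pow_mul, mul_comm 2 n, pow_mul]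
  have hi : (p ^ n * p)⁻¹ * (p ^ n * p) = 1 :=
    inv_mul_cancel₀ (mul_ne_zero (pow_ne_zero n hp) hp)
  exact norm_succ_identity p _ _ _ _ _ _ _ _ _ _ _ _ _ _ _ _ _ _ _ hi

/-- Write `g = pearsonOp f + r`. The constant pairs to zero with `J_{n+1}`, and integration by parts
moves the operator onto `J_{n+1}`, which becomes `J_n` with shifted parameters. The shifted
functional is again Pearson, so induction on the degree over all parameters applies. -/
theorem map_bigQJacobi_mul (h : BigQJacobiParams a b c p) {L : ℝ[X] →ₗ[ℝ] ℝ}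
    (hL : IsPearson a b c p L) (n : ℕ) (g : ℝ[X]) (hg : g.natDegree ≤ n) :
    L (bigQJacobi a b c p n * g) = bigQJacobiNorm a b c p n * g.coeff n * L 1 := by
  induction n generalizing a b c L g with
  | zero =>
    rw [eq_C_of_natDegree_le_zero hg, bigQJacobi_zero, one_mul, ← mul_one (C (g.coeff 0)),
      IsPearson.map_C_mul]
    simp [bigQJacobiNorm, qPochs, qPoch_zero]
  | succ n ih =>
    have hp := h.p_pos.ne'
    have n1 : 1 - a * b * p ^ (n + 2) ≠ 0 := h.one_sub_ab_ne (by omega)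
    have n2 : a * c * p ^ 2 ≠ 0 := mul_ne_zero (mul_ne_zero h.a_pos.ne' h.c_neg.ne)
      (pow_ne_zero _ hp)
    obtain ⟨f, hf, ⟨r, hr⟩, hfc⟩ := h.exists_pearsonOp_add_C n g hg
    have e1 := ih h.shift (hL.shift hp) f hf
    simp only [LinearMap.comp_apply, LinearMap.mulLeft_apply, mul_one] at e1
    rw [hL.map_pearsonNum h] at e1
    rw [← hfc]
    conv_lhs => rw [hr]
    rw [mul_add, map_add, hL.map_mul_pearsonOp hp, h.qDiff_bigQJacobi_succ, mul_comm _ (C r),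
      IsPearson.map_C_mul, h.map_bigQJacobi_succ hL, mul_zero, add_zero,
      show pearsonNum a c p * (f * (C ((p ^ (n + 1))⁻¹ - 1) *
        bigQJacobi (a * p) (b * p) (c * p) p n)) = C ((p ^ (n + 1))⁻¹ - 1) *
        (pearsonNum a c p * (bigQJacobi (a * p) (b * p) (c * p) p n * f)) by ring,
      IsPearson.map_C_mul, e1, h.bigQJacobiNorm_succ]
    generalize 1 - a * b * p ^ (n + 2) = y1 at *
    generalize a * c * p ^ 2 = y2 at *
    generalize (p * ((1 - a * p) * (1 - b * p) * (1 - c * p) * (1 - a * b * c⁻¹ * p)) /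
          ((1 - a * b * p ^ 2) * (1 - a * b * p ^ 3))) = y3 at *
    field_simp

end BigQJacobiParams

/-! ### Uniqueness of skew orthogonal sequences for an abstract form. -/

/-- `R` is a sequence of monic skew orthogonal polynomials for the bilinear form `B`. -/
def SkewOrthogonalFor (B : ℝ[X] →ₗ[ℝ] ℝ[X] →ₗ[ℝ] ℝ) (R : ℕ → ℝ[X]) : Prop :=
  (∀ n, (R n).Monic ∧ (R n).natDegree = n) ∧
  (∀ m n, B (R (2 * m)) (R (2 * n)) = 0) ∧
  (∀ m n, B (R (2 * m + 1)) (R (2 * n + 1)) = 0) ∧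
  ∃ u : ℕ → ℝ, (∀ m, u m ≠ 0) ∧
    ∀ m n, B (R (2 * m)) (R (2 * n + 1)) = if m = n then u m else 0

theorem natDegree_sub_C_mul_lt {R : ℕ → ℝ[X]} (hR : ∀ n, (R n).Monic ∧ (R n).natDegree = n)
    {P : ℝ[X]} {n : ℕ} (hP : P.natDegree ≤ n) (k : ℕ) (hk : n ≤ k) :
    (P - C (P.coeff n) * R n).coeff k = 0 := by
  have h1 : (R n).coeff n = 1 := by
    have := (hR n).1; rwa [Monic, leadingCoeff, (hR n).2] at this
  rcases hk.eq_or_lt with rfl | hk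
  · simp [h1]
  · rw [coeff_sub, coeff_C_mul, coeff_eq_zero_of_natDegree_lt (hP.trans_lt hk),
      coeff_eq_zero_of_natDegree_lt ((hR n).2.trans_lt hk)]
    simp

/-- A functional killing the first `n` members of a monic family kills all polynomials of degree
less than `n`. -/
theorem map_eq_zero_of_forall_lt {R : ℕ → ℝ[X]}
    (hR : ∀ n, (R n).Monic ∧ (R n).natDegree = n) (l : ℝ[X] →ₗ[ℝ] ℝ) (n : ℕ)
    (hl : ∀ j < n, l (R j) = 0) (P : ℝ[X]) (hP : ∀ k ≥ n, P.coeff k = 0) : l P = 0 := by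
  induction n generalizing P with
  | zero =>
    have : P = 0 := by ext k; simpa using hP k (Nat.zero_le k)
    rw [this, map_zero]
  | succ n ih =>
    have hd : P.natDegree ≤ n := natDegree_le_iff_coeff_eq_zero.mpr fun k hk => hP k hk
    have h1 := ih (fun j hj => hl j (by omega)) _ (natDegree_sub_C_mul_lt hR hd)
    rw [← smul_eq_C_mul, map_sub, map_smul, hl n n.lt_succ_self] at h1
    simpa using h1

namespace SkewOrthogonalFor

variable {B : ℝ[X] →ₗ[ℝ] ℝ[X] →ₗ[ℝ] ℝ} {R Q : ℕ → ℝ[X]}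

theorem map_swap (hB : ∀ P, B P P = 0) (P S : ℝ[X]) : B P S = -B S P := by
  have := hB (P + S)
  simp only [map_add, LinearMap.add_apply, hB] at this
  linarith

theorem even_right (hR : SkewOrthogonalFor B R) (hB : ∀ P, B P P = 0) {n j : ℕ} (hj : j ≤ 2 * n) :
    B (R j) (R (2 * n)) = 0 := by
  obtain ⟨-, h0, -, u, -, hu⟩ := hR
  obtain ⟨k, rfl | rfl⟩ := j.even_or_odd'
  · exact h0 k n
  · rw [map_swap hB, hu, if_neg (by omega), neg_zero]

theorem odd_right (hR : SkewOrthogonalFor B R) {n j : ℕ} (hj : j < 2 * n) :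
    B (R j) (R (2 * n + 1)) = 0 := by
  obtain ⟨-, -, h1, u, -, hu⟩ := hR
  obtain ⟨k, rfl | rfl⟩ := j.even_or_odd'
  · rw [hu, if_neg (by omega)]
  · exact h1 k n

/-- Nondegeneracy of the form on the polynomials of degree less than `2 * n`. -/
theorem eq_zero_of_forall (hR : SkewOrthogonalFor B R) (hB : ∀ P, B P P = 0) (n : ℕ) (P : ℝ[X])
    (hP : ∀ k ≥ 2 * n, P.coeff k = 0) (h : ∀ j < 2 * n, B P (R j) = 0) : P = 0 := by
  by_contra hne
  set d := P.natDegree with hd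
  have hlead : P.coeff d ≠ 0 := leadingCoeff_ne_zero.mpr hne
  have hdn : d < 2 * n := by
    by_contra hge
    exact hlead (hP d (not_lt.mp hge))
  have hlow := natDegree_sub_C_mul_lt hR.1 (P := P) hd.ge
  obtain ⟨u, hu0, hu⟩ := hR.2.2.2
  -- Pair `P` with the partner of `R d`, namely `R (2k+1)` or `R (2k)`. Everything of degree below
  -- `d` pairs to zero with it, so only the leading coefficient times `±u k` survives.
  obtain ⟨k, hk | hk⟩ := d.even_or_odd'
  · have h1 := map_eq_zero_of_forall_lt hR.1 (B.flip (R (2 * k + 1))) d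
      (fun j hj => hR.odd_right (by omega)) _ hlow
    rw [LinearMap.flip_apply, ← smul_eq_C_mul, map_sub, map_smul, LinearMap.sub_apply,
      LinearMap.smul_apply, h _ (by omega), hk, hu, if_pos rfl, zero_sub, neg_eq_zero,
      smul_eq_mul, ← hk] at h1
    exact (mul_ne_zero hlead (hu0 k)) h1
  · have h1 := map_eq_zero_of_forall_lt hR.1 (B.flip (R (2 * k))) d
      (fun j hj => hR.even_right hB (by omega)) _ hlow
    rw [LinearMap.flip_apply, ← smul_eq_C_mul, map_sub, map_smul, LinearMap.sub_apply,
      LinearMap.smul_apply, h _ (by omega), hk, map_swap hB, hu, if_pos rfl, zero_sub, neg_eq_zero,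
      smul_eq_mul, ← hk] at h1
    exact (mul_ne_zero hlead (neg_ne_zero.mpr (hu0 k))) h1

theorem coeff_eq_zero (hR : SkewOrthogonalFor B R) {j k : ℕ} (hk : j < k) : (R j).coeff k = 0 :=
  coeff_eq_zero_of_natDegree_lt ((hR.1 j).2.trans_lt hk)

theorem coeff_self (hR : SkewOrthogonalFor B R) (j : ℕ) : (R j).coeff j = 1 := by
  have := (hR.1 j).1; rwa [Monic, leadingCoeff, (hR.1 j).2] at this

theorem coeff_sub_eq_zero (hR : SkewOrthogonalFor B R) (hQ : SkewOrthogonalFor B Q) {j k : ℕ}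
    (hk : j ≤ k) : (Q j - R j).coeff k = 0 := by
  rw [coeff_sub]
  rcases hk.eq_or_lt with rfl | hk
  · rw [hQ.coeff_self, hR.coeff_self, sub_self]
  · rw [hQ.coeff_eq_zero hk, hR.coeff_eq_zero hk, sub_self]

/-- The difference of two candidates has degree below `2n` and pairs to zero with every polynomial
of degree below `2n`, where the form is nondegenerate. -/
theorem even_eq (hR : SkewOrthogonalFor B R) (hQ : SkewOrthogonalFor B Q) (hB : ∀ P, B P P = 0)
    (n : ℕ) : Q (2 * n) = R (2 * n) := by
  rw [← sub_eq_zero]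
  refine hR.eq_zero_of_forall hB n _ (fun k hk => hR.coeff_sub_eq_zero hQ hk) fun j hj => ?_
  have h1 := map_eq_zero_of_forall_lt hQ.1 (B.flip (Q (2 * n))) (2 * n)
    (fun i hi => hQ.even_right hB hi.le) (R j) fun k hk => hR.coeff_eq_zero (by omega)
  rw [LinearMap.flip_apply] at h1
  rw [map_swap hB, map_sub, h1, hR.even_right hB hj.le, sub_zero, neg_zero]

/-- The difference may have degree `2n`, and that coefficient is the constant `r`. Subtracting `r
Q_{2n}` leaves degree below `2n`, and the argument for even indices applies. -/
theorem odd_eq (hR : SkewOrthogonalFor B R) (hQ : SkewOrthogonalFor B Q) (hB : ∀ P, B P P = 0)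
    (n : ℕ) : ∃ r : ℝ, Q (2 * n + 1) = R (2 * n + 1) + C r * Q (2 * n) := by
  have hdeg : (Q (2 * n + 1) - R (2 * n + 1)).natDegree ≤ 2 * n :=
    natDegree_le_iff_coeff_eq_zero.mpr fun k hk => hR.coeff_sub_eq_zero hQ hk
  refine ⟨(Q (2 * n + 1) - R (2 * n + 1)).coeff (2 * n), ?_⟩
  rw [hR.even_eq hQ hB, ← sub_eq_zero, ← sub_sub]
  refine hR.eq_zero_of_forall hB n _ (natDegree_sub_C_mul_lt hR.1 hdeg) fun j hj => ?_
  have h1 := map_eq_zero_of_forall_lt hQ.1 (B.flip (Q (2 * n + 1))) (2 * n)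
    (fun i hi => hQ.odd_right hi) (R j) fun k hk => hR.coeff_eq_zero (by omega)
  rw [LinearMap.flip_apply] at h1
  rw [map_swap hB, ← smul_eq_C_mul, map_sub, map_sub, map_smul, h1, hR.even_right hB hj.le,
    hR.odd_right hj]
  simp

/-- In an odd-odd pairing the added multiples contribute cross terms only when the indices agree,
where they cancel by skew-symmetry. -/
theorem of_add (hR : SkewOrthogonalFor B R) (hB : ∀ P, B P P = 0) (r : ℕ → ℝ)
    (h0 : ∀ n, Q (2 * n) = R (2 * n)) (h1 : ∀ n, Q (2 * n + 1) = R (2 * n + 1) + C (r n) * Q (2 * n)) :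
    SkewOrthogonalFor B Q := by
  obtain ⟨u, hu0, hu⟩ := hR.2.2.2
  have hswap := map_swap hB
  have hmon : ∀ n, (Q n).natDegree ≤ n ∧ (Q n).coeff n = 1 := fun n => by
    obtain ⟨k, rfl | rfl⟩ := n.even_or_odd'
    · rw [h0]; exact ⟨(hR.1 _).2.le, hR.coeff_self _⟩
    · rw [h1, h0]
      refine ⟨natDegree_add_le_of_degree_le (hR.1 _).2.le
        ((natDegree_C_mul_le _ _).trans ((hR.1 _).2.le.trans (by omega))), ?_⟩
      rw [coeff_add, hR.coeff_self, coeff_C_mul, hR.coeff_eq_zero (by omega)]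
      simp
  refine ⟨fun n => ?_, fun m n => by rw [h0, h0, hR.2.1], fun m n => ?_, u, hu0, fun m n => ?_⟩
  · have hd : (Q n).natDegree = n :=
      natDegree_eq_of_le_of_coeff_ne_zero (hmon n).1 (by rw [(hmon n).2]; exact one_ne_zero)
    exact ⟨by rw [Monic, leadingCoeff, hd, (hmon n).2], hd⟩
  · rw [h1, h1, h0, h0, ← smul_eq_C_mul, ← smul_eq_C_mul]
    simp only [map_add, map_smul, LinearMap.add_apply, LinearMap.smul_apply, hR.2.1, hR.2.2.1,
      hswap (R (2 * m + 1)) (R (2 * n)), hu, smul_eq_mul]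
    by_cases h : m = n
    · subst h; simp
    · rw [if_neg h, if_neg (Ne.symm h)]; simp
  · rw [h1, h0, h0, ← smul_eq_C_mul, map_add, map_smul, hR.2.1, hu]
    simp

theorem iff_exists (hR : SkewOrthogonalFor B R) (hB : ∀ P, B P P = 0) :
    SkewOrthogonalFor B Q ↔ ∃ r : ℕ → ℝ, ∀ n, Q (2 * n) = R (2 * n) ∧
      Q (2 * n + 1) = R (2 * n + 1) + C (r n) * Q (2 * n) := by
  constructor
  · intro hQ
    choose r hr using hR.odd_eq hQ hB
    exact ⟨r, fun n => ⟨hR.even_eq hQ hB n, hr n⟩⟩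
  · rintro ⟨r, hr⟩
    exact hR.of_add hB r (fun n => (hr n).1) fun n => (hr n).2

end SkewOrthogonalFor

/-! ### Action of `skewOp` on the `J_n` and the resulting skew orthogonality. -/

namespace BigQJacobiParams

variable {a b c p : ℝ} {L : ℝ[X] →ₗ[ℝ] ℝ}

theorem map_bigQJacobi_mul_of_lt (h : BigQJacobiParams a b c p) (hL : IsPearson a b c p L)
    {n : ℕ} {g : ℝ[X]} (hg : g.natDegree < n) : L (bigQJacobi a b c p n * g) = 0 := by
  rw [h.map_bigQJacobi_mul hL n g hg.le, coeff_eq_zero_of_natDegree_lt hg]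
  simp

theorem map_bigQJacobi_mul_of_ne (h : BigQJacobiParams a b c p) (hL : IsPearson a b c p L)
    {m n : ℕ} (hmn : m ≠ n) : L (bigQJacobi a b c p m * bigQJacobi a b c p n) = 0 := by
  rcases hmn.lt_or_gt with hlt | hlt
  · rw [mul_comm]
    exact h.map_bigQJacobi_mul_of_lt hL (by rwa [h.natDegree_bigQJacobi])
  · exact h.map_bigQJacobi_mul_of_lt hL (by rwa [h.natDegree_bigQJacobi])

theorem map_bigQJacobi_mul_self (h : BigQJacobiParams a b c p) (hL : IsPearson a b c p L) (n : ℕ) :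
    L (bigQJacobi a b c p n * bigQJacobi a b c p n) = bigQJacobiNorm a b c p n * L 1 := by
  rw [h.map_bigQJacobi_mul hL n _ (h.natDegree_bigQJacobi n).le, (h.bigQJacobi_coeff n).2, mul_one]

theorem eq_zero_of_map_bigQJacobi_mul (h : BigQJacobiParams a b c p) (hL : IsPearson a b c p L)
    (hL1 : L 1 ≠ 0) {n : ℕ} {P : ℝ[X]} (hP : P.natDegree ≤ n)
    (hm : ∀ m ≤ n, L (bigQJacobi a b c p m * P) = 0) : P = 0 := by
  have h1 := hm _ hP
  rw [h.map_bigQJacobi_mul hL _ P le_rfl] at h1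
  simpa [hL1, h.bigQJacobiNorm_ne] using h1

theorem skewOp_bigQJacobi_zero (h : BigQJacobiParams a b c p) (hL : IsPearson a b c p L)
    (hL1 : L 1 ≠ 0) :
    skewOp a b c p (bigQJacobi a b c p 0) = C (skewLead a b c p 0) * bigQJacobi a b c p 1 := by
  have hJ0 := h.bigQJacobi_coeff 0
  rw [← sub_eq_zero]
  refine h.eq_zero_of_map_bigQJacobi_mul hL hL1 (n := 0) ?_ fun m hm => ?_
  · rw [natDegree_le_iff_coeff_eq_zero]
    intro k hk
    rcases (Nat.succ_le_of_lt hk).eq_or_lt with rfl | hk'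
    · rw [coeff_sub, Nat.succ_eq_add_one, h.coeff_skewOp hJ0.1, coeff_C_mul, hJ0.2,
        (h.bigQJacobi_coeff 1).2, sub_self]
    · rw [coeff_sub, coeff_C_mul,
        coeff_eq_zero_of_natDegree_lt ((natDegree_skewOp_le a b c p hJ0.1).trans_lt hk'),
        coeff_eq_zero_of_natDegree_lt ((h.bigQJacobi_coeff 1).1.trans_lt hk')]
      simp
  · obtain rfl := Nat.le_zero.mp hm
    have h1 := hL.map_mul_skewOp h.p_pos.ne' (bigQJacobi a b c p 0) (bigQJacobi a b c p 0)
    rw [mul_sub, mul_left_comm, map_sub, IsPearson.map_C_mul,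
      h.map_bigQJacobi_mul_of_ne hL zero_ne_one]
    linarith

/-- Skew-adjointness gives `L(J_m D J_{n+1}) = -L(J_{n+1} D J_m)`. This vanishes for `m < n` by
degree and for `m = n+1` because it equals its own negative. At `m = n` the leading coefficient of
`D J_n` produces the ratio of norms. -/
theorem skewOp_bigQJacobi_succ (h : BigQJacobiParams a b c p) (hL : IsPearson a b c p L)
    (hL1 : L 1 ≠ 0) (n : ℕ) :
    skewOp a b c p (bigQJacobi a b c p (n + 1)) =
      C (skewLead a b c p (n + 1)) * bigQJacobi a b c p (n + 2) -
        C (skewLead a b c p n * (bigQJacobiNorm a b c p (n + 1) / bigQJacobiNorm a b c p n)) *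
          bigQJacobi a b c p n := by
  have hJ1 := h.bigQJacobi_coeff (n + 1)
  rw [← sub_eq_zero]
  refine h.eq_zero_of_map_bigQJacobi_mul hL hL1 (n := n + 1) ?_ fun m hm => ?_
  · rw [natDegree_le_iff_coeff_eq_zero]
    intro k hk
    rw [coeff_sub, coeff_sub, coeff_C_mul, coeff_C_mul,
      coeff_eq_zero_of_natDegree_lt ((h.bigQJacobi_coeff n).1.trans_lt (by omega))]
    rcases (Nat.succ_le_of_lt hk).eq_or_lt with rfl | hk'
    · rw [Nat.succ_eq_add_one, h.coeff_skewOp hJ1.1, hJ1.2, (h.bigQJacobi_coeff (n + 2)).2]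
      ring
    · rw [coeff_eq_zero_of_natDegree_lt ((natDegree_skewOp_le a b c p hJ1.1).trans_lt hk'),
        coeff_eq_zero_of_natDegree_lt ((h.bigQJacobi_coeff (n + 2)).1.trans_lt hk')]
      simp
  · have h1 := hL.map_mul_skewOp h.p_pos.ne' (bigQJacobi a b c p m) (bigQJacobi a b c p (n + 1))
    have hdm := natDegree_skewOp_le a b c p (h.bigQJacobi_coeff m).1
    rw [mul_sub, mul_sub, mul_left_comm, mul_left_comm _ (C _), map_sub, map_sub,
      IsPearson.map_C_mul, IsPearson.map_C_mul, h.map_bigQJacobi_mul_of_ne hL (by omega),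
      mul_zero, zero_sub, h1]
    rcases lt_trichotomy m n with hlt | rfl | hgt
    · rw [h.map_bigQJacobi_mul_of_lt hL (by omega), h.map_bigQJacobi_mul_of_ne hL hlt.ne]
      simp
    · rw [h.map_bigQJacobi_mul hL _ _ hdm, h.coeff_skewOp (h.bigQJacobi_coeff m).1,
        (h.bigQJacobi_coeff m).2, h.map_bigQJacobi_mul_self hL]
      have := h.bigQJacobiNorm_ne m
      field_simp
      ring
    · obtain rfl : m = n + 1 := by omega
      rw [h.map_bigQJacobi_mul_of_ne hL (by omega)]
      have h2 := hL.map_mul_skewOp h.p_pos.ne' (bigQJacobi a b c p (n + 1))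
        (bigQJacobi a b c p (n + 1))
      linarith

end BigQJacobiParams

/-- The coefficient of `J_{2n-1}` in the odd skew orthogonal polynomials. -/
noncomputable def skewCoeff (a b c p : ℝ) : ℕ → ℝ
  | 0 => 0
  | n + 1 => -(skewLead a b c p (2 * n + 1) *
      (bigQJacobiNorm a b c p (2 * n + 2) / bigQJacobiNorm a b c p (2 * n + 1)) /
        skewLead a b c p (2 * n + 2))

namespace BigQJacobiParams

variable {a b c p : ℝ} {L : ℝ[X] →ₗ[ℝ] ℝ} {B : ℝ[X] →ₗ[ℝ] ℝ[X] →ₗ[ℝ] ℝ} {κ : ℝ}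

theorem skewOp_bigQJacobi_even (h : BigQJacobiParams a b c p) (hL : IsPearson a b c p L)
    (hL1 : L 1 ≠ 0) (n : ℕ) :
    bigQJacobi a b c p (2 * n + 1) + C (skewCoeff a b c p n) * bigQJacobi a b c p (2 * n - 1) =
      C (skewLead a b c p (2 * n))⁻¹ * skewOp a b c p (bigQJacobi a b c p (2 * n)) := by
  have hne := h.skewLead_ne (2 * n)
  -- For `n = 0` the index `2 * n - 1` truncates to `0`; the spurious term is removed by `skewCoeff`
  -- being `0` there.
  rcases n with _ | n
  · rw [mul_zero] at hne ⊢
    rw [h.skewOp_bigQJacobi_zero hL hL1, ← mul_assoc, ← C_mul, inv_mul_cancel₀ hne]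
    simp [skewCoeff]
  · rw [show 2 * (n + 1) = 2 * n + 1 + 1 by ring] at hne ⊢
    rw [h.skewOp_bigQJacobi_succ hL hL1, mul_sub, ← mul_assoc, ← mul_assoc, ← C_mul, ← C_mul,
      inv_mul_cancel₀ hne, skewCoeff, C_neg, C_1, one_mul, neg_mul, ← sub_eq_add_neg,
      div_eq_inv_mul]
    rfl

/-- Pairing `D J_{2n+1}` with `P` relates `B(J_{2n+2}, P)` to `B(J_{2n}, P)` with no inhomogeneous
term, so vanishing propagates upwards from `J_0`. -/
theorem form_even_eq_zero (h : BigQJacobiParams a b c p) (hL : IsPearson a b c p L)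
    (hL1 : L 1 ≠ 0) (hκ : ∀ f g, B (skewOp a b c p f) g = κ * L (f * g)) {P : ℝ[X]}
    (hP : B (bigQJacobi a b c p 0) P = 0) (hP' : ∀ n, L (bigQJacobi a b c p (2 * n + 1) * P) = 0)
    (n : ℕ) : B (bigQJacobi a b c p (2 * n)) P = 0 := by
  induction n with
  | zero => exact hP
  | succ n ih =>
    have h1 := hκ (bigQJacobi a b c p (2 * n + 1)) P
    rw [h.skewOp_bigQJacobi_succ hL hL1, hP', mul_zero, map_sub, ← smul_eq_C_mul, ← smul_eq_C_mul,
      map_smul, map_smul, LinearMap.sub_apply, LinearMap.smul_apply, LinearMap.smul_apply, ih,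
      smul_zero, sub_zero, smul_eq_mul] at h1
    exact (mul_eq_zero.mp h1).resolve_left (h.skewLead_ne _)

/-- The skew orthogonal polynomials of a skew form built from the big `q`-Jacobi functional. -/
theorem skewOrthogonalFor (h : BigQJacobiParams a b c p) (hL : IsPearson a b c p L)
    (hL1 : L 1 ≠ 0) (hB : ∀ P, B P P = 0) (hκ0 : κ ≠ 0)
    (hκ : ∀ f g, B (skewOp a b c p f) g = κ * L (f * g)) {R : ℕ → ℝ[X]}
    (h0 : ∀ n, R (2 * n) = bigQJacobi a b c p (2 * n))
    (h1 : ∀ n, R (2 * n + 1) = bigQJacobi a b c p (2 * n + 1) +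
      C (skewCoeff a b c p n) * bigQJacobi a b c p (2 * n - 1)) :
    SkewOrthogonalFor B R ∧ ∀ n, B (R (2 * n)) (R (2 * n + 1)) =
      -(κ * (bigQJacobiNorm a b c p (2 * n) * L 1) / skewLead a b c p (2 * n)) := by
  have hmon : ∀ n, (R n).natDegree ≤ n ∧ (R n).coeff n = 1 := fun n => by
    obtain ⟨k, rfl | rfl⟩ := n.even_or_odd'
    · rw [h0]; exact h.bigQJacobi_coeff _
    · rw [h1]
      have hd : (bigQJacobi a b c p (2 * k - 1)).natDegree < 2 * k + 1 := by
        rw [h.natDegree_bigQJacobi]; omega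
      refine ⟨natDegree_add_le_of_degree_le (h.bigQJacobi_coeff _).1
        ((natDegree_C_mul_le _ _).trans hd.le), ?_⟩
      rw [coeff_add, (h.bigQJacobi_coeff _).2, coeff_C_mul, coeff_eq_zero_of_natDegree_lt hd]
      simp
  have hodd : ∀ n P, B (R (2 * n + 1)) P =
      (skewLead a b c p (2 * n))⁻¹ * (κ * L (bigQJacobi a b c p (2 * n) * P)) := fun n P => by
    rw [h1, h.skewOp_bigQJacobi_even hL hL1, ← smul_eq_C_mul, map_smul, LinearMap.smul_apply, hκ,
      smul_eq_mul]
  have heo : ∀ m n, B (R (2 * m)) (R (2 * n + 1)) = if m = n then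
      -(κ * (bigQJacobiNorm a b c p (2 * m) * L 1) / skewLead a b c p (2 * m)) else 0 := fun m n => by
    rw [SkewOrthogonalFor.map_swap hB, hodd, h0]
    split_ifs with hmn
    · subst hmn
      rw [h.map_bigQJacobi_mul_self hL]
      ring
    · rw [h.map_bigQJacobi_mul_of_ne hL (by omega)]
      simp
  refine ⟨⟨fun n => ?_, fun m n => ?_, fun m n => ?_, _, fun m => ?_, heo⟩, fun n => by
    rw [heo, if_pos rfl]⟩
  · have hd : (R n).natDegree = n :=
      natDegree_eq_of_le_of_coeff_ne_zero (hmon n).1 (by rw [(hmon n).2]; exact one_ne_zero)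
    exact ⟨by rw [Monic, leadingCoeff, hd, (hmon n).2], hd⟩
  -- The recursion reduces the first index to `0`; after a swap it reduces the other one too, ending
  -- at `B(J_0, J_0) = 0`.
  · rw [h0, h0]
    refine h.form_even_eq_zero hL hL1 hκ ?_
      (fun k => h.map_bigQJacobi_mul_of_ne hL (by omega)) m
    rw [SkewOrthogonalFor.map_swap hB, neg_eq_zero]
    exact h.form_even_eq_zero hL hL1 hκ (hB _)
      (fun k => h.map_bigQJacobi_mul_of_ne hL (by omega)) n
  · rw [hodd, h1, mul_add, map_add, mul_left_comm _ (C _), IsPearson.map_C_mul,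
      h.map_bigQJacobi_mul_of_ne hL (by omega)]
    rcases n with _ | n
    · simp [skewCoeff]
    · rw [h.map_bigQJacobi_mul_of_ne hL (by omega)]
      simp
  · exact neg_ne_zero.mpr (div_ne_zero (mul_ne_zero hκ0 (mul_ne_zero (h.bigQJacobiNorm_ne _) hL1))
      (h.skewLead_ne _))

end BigQJacobiParams

/-! ### Jackson integrals: convergence, linearity and telescoping. -/

/-- Convergence of `f` along the geometric sequence `β q^k`. -/
def ConvergesAlong (q β : ℝ) (f : ℝ → ℝ) : Prop :=
  ∃ l, Tendsto (fun k : ℕ => f (β * q ^ k)) atTop (𝓝 l)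

namespace ConvergesAlong

variable {q β : ℝ} {f g : ℝ → ℝ}

theorem mul (hf : ConvergesAlong q β f) (hg : ConvergesAlong q β g) :
    ConvergesAlong q β fun x => f x * g x :=
  ⟨_, hf.choose_spec.mul hg.choose_spec⟩

theorem sub (hf : ConvergesAlong q β f) (hg : ConvergesAlong q β g) :
    ConvergesAlong q β fun x => f x - g x :=
  ⟨_, hf.choose_spec.sub hg.choose_spec⟩

theorem const_mul (r : ℝ) (hf : ConvergesAlong q β f) : ConvergesAlong q β fun x => r * f x :=
  ⟨_, hf.choose_spec.const_mul r⟩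

theorem of_tendsto (hq0 : 0 ≤ q) (hq1 : q < 1) {l : ℝ} (hf : Tendsto f (𝓝 0) (𝓝 l)) :
    ConvergesAlong q β f :=
  ⟨l, hf.comp (tendsto_mul_pow_atTop hq0 hq1 β)⟩

theorem summable (hq0 : 0 ≤ q) (hq1 : q < 1) (hf : ConvergesAlong q β f) :
    Summable fun k : ℕ => β * q ^ k * f (β * q ^ k) := by
  obtain ⟨l, hl⟩ := hf
  obtain ⟨M, hM⟩ := hl.norm.bddAbove_range
  refine Summable.of_norm_bounded (g := fun k => |β| * M * q ^ k)
    (summable_mul_pow hq0 hq1 _) fun k => ?_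
  have := hM (Set.mem_range_self k)
  rw [norm_mul, norm_mul, norm_pow, Real.norm_eq_abs β, Real.norm_of_nonneg hq0, mul_right_comm]
  gcongr

theorem jacksonIntegrable {α : ℝ} (hq0 : 0 ≤ q) (hq1 : q < 1) (hα : ConvergesAlong q α f)
    (hβ : ConvergesAlong q β f) : JacksonIntegrable q α β f :=
  ⟨hβ.summable hq0 hq1, hα.summable hq0 hq1⟩

end ConvergesAlong

theorem JacksonIntegrable.congr {q α β : ℝ} {f g : ℝ → ℝ} (h : JacksonIntegrable q α β f)
    (hβ : ∀ k : ℕ, g (β * q ^ k) = f (β * q ^ k)) (hα : ∀ k : ℕ, g (α * q ^ k) = f (α * q ^ k)) :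
    JacksonIntegrable q α β g :=
  ⟨h.1.congr fun k => by rw [hβ], h.2.congr fun k => by rw [hα]⟩

theorem jacksonZero_congr {q β : ℝ} {f g : ℝ → ℝ} (h : ∀ k : ℕ, f (β * q ^ k) = g (β * q ^ k)) :
    jacksonZero q β f = jacksonZero q β g := by
  simp only [jacksonZero, h]

theorem jackson_congr {q α β : ℝ} {f g : ℝ → ℝ} (hβ : ∀ k : ℕ, f (β * q ^ k) = g (β * q ^ k))
    (hα : ∀ k : ℕ, f (α * q ^ k) = g (α * q ^ k)) : jackson q α β f = jackson q α β g := by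
  rw [jackson, jackson, jacksonZero_congr hβ, jacksonZero_congr hα]

theorem jackson_self (q α : ℝ) (f : ℝ → ℝ) : jackson q α α f = 0 := sub_self _

theorem JacksonIntegrable.jackson_add {q α β : ℝ} {f g : ℝ → ℝ} (hf : JacksonIntegrable q α β f)
    (hg : JacksonIntegrable q α β g) :
    jackson q α β (fun x => f x + g x) = jackson q α β f + jackson q α β g := by
  simp only [jackson, jacksonZero, mul_add, hf.1.tsum_add hg.1, hf.2.tsum_add hg.2]
  ring

theorem jackson_const_mul (q α β r : ℝ) (f : ℝ → ℝ) :
    jackson q α β (fun x => r * f x) = r * jackson q α β f := by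
  simp only [jackson, jacksonZero, mul_left_comm _ r, tsum_mul_left]
  ring

theorem JacksonIntegrable.jackson_sub {q α β : ℝ} {f g : ℝ → ℝ} (hf : JacksonIntegrable q α β f)
    (hg : JacksonIntegrable q α β g) :
    jackson q α β (fun x => f x - g x) = jackson q α β f - jackson q α β g := by
  simp only [jackson, jacksonZero, mul_sub, hf.1.tsum_sub hg.1, hf.2.tsum_sub hg.2]
  ring

theorem jacksonZero_of_telescope {q β l : ℝ} {f : ℝ → ℝ} {G : ℕ → ℝ} (hq0 : 0 ≤ q) (hq1 : q < 1)
    (hf : ConvergesAlong q β f)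
    (hG : ∀ k : ℕ, (1 - q) * (β * q ^ k * f (β * q ^ k)) = G k - G (k + 1))
    (hl : Tendsto G atTop (𝓝 l)) : jacksonZero q β f = G 0 - l := by
  rw [jacksonZero, ← tsum_mul_left]
  refine HasSum.tsum_eq (((hf.summable hq0 hq1).mul_left _).hasSum_iff_tendsto_nat.mpr ?_)
  simp only [hG, Finset.sum_range_sub']
  exact hl.const_sub _

theorem jacksonZero_sub_mul {q β : ℝ} {f : ℝ → ℝ} (hq0 : 0 ≤ q) (hq1 : q < 1)
    (hf : ConvergesAlong q β f) :
    jacksonZero q β f - jacksonZero q (β * q) f = (1 - q) * β * f β := by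
  rw [jacksonZero, (hf.summable hq0 hq1).tsum_eq_zero_add, jacksonZero]
  simp only [pow_succ', pow_zero, mul_one, mul_assoc]
  ring

theorem jackson_sub_mul {q α β : ℝ} {f : ℝ → ℝ} (hq0 : 0 ≤ q) (hq1 : q < 1)
    (hf : ConvergesAlong q β f) :
    jackson q α β f - jackson q α (β * q) f = (1 - q) * β * f β := by
  rw [jackson, jackson, sub_sub_sub_cancel_right, jacksonZero_sub_mul hq0 hq1 hf]

/-- The limit does not depend on `β`. Hence primitives have one common limit at `0` along all the
lattices, positive or negative. -/
theorem tendsto_jackson (q α β : ℝ) (f : ℝ → ℝ) :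
    Tendsto (fun k : ℕ => jackson q α (β * q ^ k) f) atTop (𝓝 (-jacksonZero q α f)) := by
  have h : ∀ k : ℕ, jacksonZero q (β * q ^ k) f =
      (1 - q) * ∑' i : ℕ, β * q ^ (i + k) * f (β * q ^ (i + k)) := fun k => by
    simp only [jacksonZero, mul_assoc, ← pow_add, add_comm k]
  simp only [jackson, h]
  have h2 := (tendsto_sum_nat_add fun k : ℕ => β * q ^ k * f (β * q ^ k)).const_mul (1 - q)
  simpa using h2.sub_const (jacksonZero q α f)

/-! ### Iterated primitives in an algebra with a square-zero subspace. -/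

section DeBruijn

variable {A : Type*} [Ring A] [Algebra ℝ A]

theorem mul_eq_neg_mul_of_sq_eq_zero {V : Submodule ℝ A} (hV : ∀ v ∈ V, v * v = 0) {v w : A}
    (hv : v ∈ V) (hw : w ∈ V) : v * w = -(w * v) := by
  have h := hV _ (V.add_mem hv hw)
  rw [add_mul, mul_add, mul_add, hV v hv, hV w hw, zero_add, add_zero] at h
  exact eq_neg_of_add_eq_zero_left h

theorem add_pow_succ_of_sq_eq_zero {X Y : A} (h : Commute X Y) (hY : Y * Y = 0) (k : ℕ) :
    (X + Y) ^ (k + 1) = X ^ (k + 1) + ((k : ℝ) + 1) • (X ^ k * Y) := by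
  induction k with
  | zero => simp
  | succ k ih =>
    rw [pow_succ, ih, add_mul, mul_add, smul_mul_assoc, mul_add, mul_assoc (X ^ k), mul_assoc (X ^ k),
      hY, mul_zero, add_zero, ← h.eq, ← mul_assoc, ← pow_succ, ← pow_succ, add_assoc]
    congr 1
    push_cast
    module

/-- Iterated `q`-integrals of a vector-valued function `m` with values in a square-zero subspace:
a one-fold primitive `I₁` and a two-fold primitive `I₂` of `m`, based at `lo`. -/
structure SkewPrimitives [TopologicalSpace A] (p lo : ℝ) (S : Set ℝ) (V : Submodule ℝ A)
    (m I₁ I₂ : ℝ → A) : Prop where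
  mem_lo : lo ∈ S
  mul_mem : ∀ x ∈ S, p * x ∈ S
  sq_zero : ∀ v ∈ V, v * v = 0
  m_mem : ∀ x, m x ∈ V
  I₁_mem : ∀ x, I₁ x ∈ V
  I₂_comm : ∀ x, ∀ v ∈ V, Commute (I₂ x) v
  I₁_lo : I₁ lo = 0
  I₂_lo : I₂ lo = 0
  I₁_sub : ∀ x ∈ S, I₁ x - I₁ (x * p ^ 2) = ((1 - p ^ 2) * x) • m x
  I₂_sub : ∀ x ∈ S, I₂ x - I₂ (x * p ^ 2) = ((1 - p ^ 2) * x) • (m x * I₁ (p * x))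
  tendsto_m : ∀ x ∈ S, ∃ l, Tendsto (fun k : ℕ => m (x * (p ^ 2) ^ k)) atTop (𝓝 l)
  tendsto_I₁ : ∃ l, ∀ x ∈ S, Tendsto (fun k : ℕ => I₁ (x * (p ^ 2) ^ k)) atTop (𝓝 l)
  tendsto_I₂ : ∃ l, ∀ x ∈ S, Tendsto (fun k : ℕ => I₂ (x * (p ^ 2) ^ k)) atTop (𝓝 l)

/-- The `n`-fold primitive: `I₂^k / k!` for `n = 2k` and `I₁ I₂^k / k!` for `n = 2k+1`. -/
noncomputable def skewPower (I₁ I₂ : ℝ → A) (n : ℕ) (x : ℝ) : A :=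
  I₁ x ^ (n % 2) * (((n / 2).factorial : ℝ)⁻¹ • I₂ x ^ (n / 2))

theorem skewPower_even (I₁ I₂ : ℝ → A) (k : ℕ) (x : ℝ) :
    skewPower I₁ I₂ (2 * k) x = ((k.factorial : ℝ)⁻¹ • I₂ x ^ k) := by
  simp [skewPower]

theorem skewPower_odd (I₁ I₂ : ℝ → A) (k : ℕ) (x : ℝ) :
    skewPower I₁ I₂ (2 * k + 1) x = I₁ x * ((k.factorial : ℝ)⁻¹ • I₂ x ^ k) := by
  rw [skewPower, show (2 * k + 1) % 2 = 1 by omega, show (2 * k + 1) / 2 = k by omega, pow_one]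

namespace SkewPrimitives

variable [TopologicalSpace A] {p lo : ℝ} {S : Set ℝ} {V : Submodule ℝ A} {m I₁ I₂ : ℝ → A}

theorem mul_pow_mem (h : SkewPrimitives p lo S V m I₁ I₂) {x : ℝ} (hx : x ∈ S) (k : ℕ) :
    x * (p ^ 2) ^ k ∈ S := by
  induction k with
  | zero => simpa
  | succ k ih =>
    have := h.mul_mem _ (h.mul_mem _ ih)
    rwa [show p * (p * (x * (p ^ 2) ^ k)) = x * (p ^ 2) ^ (k + 1) by ring] at this

theorem skewPower_lo (h : SkewPrimitives p lo S V m I₁ I₂) (n : ℕ) :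
    skewPower I₁ I₂ (n + 1) lo = 0 := by
  obtain ⟨k, rfl | rfl⟩ := n.even_or_odd'
  · rw [skewPower_odd, h.I₁_lo, zero_mul]
  · rw [show 2 * k + 1 + 1 = 2 * (k + 1) by ring, skewPower_even, h.I₂_lo, zero_pow (by omega),
      smul_zero]

variable [IsTopologicalRing A]

theorem tendsto_skewPower (h : SkewPrimitives p lo S V m I₁ I₂) (n : ℕ) :
    ∃ l, ∀ x ∈ S, Tendsto (fun k : ℕ => skewPower I₁ I₂ n (x * (p ^ 2) ^ k)) atTop (𝓝 l) := by
  obtain ⟨l₁, hl₁⟩ := h.tendsto_I₁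
  obtain ⟨l₂, hl₂⟩ := h.tendsto_I₂
  exact ⟨_, fun x hx => ((hl₁ x hx).pow _).mul (((hl₂ x hx).pow _).const_smul _)⟩

variable [T2Space A]

/-- The defining equations concern steps by `p²`, but the nested limits `p z` need a step by `p`.
The defect `D` is invariant under `y ↦ p² y`: the changes of the three terms cancel because elements
of `V` anticommute. Its limit at `0` is `l₂ - l₂ - l₁ l₁`, which is zero since `I₁` squares to zero.
-/
theorem I₂_sub_mul (h : SkewPrimitives p lo S V m I₁ I₂) {x : ℝ} (hx : x ∈ S) :
    I₂ x - I₂ (p * x) = I₁ x * I₁ (p * x) := by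
  set D : ℝ → A := fun y => I₂ y - I₂ (p * y) - I₁ y * I₁ (p * y) with hD
  have hstep : ∀ y ∈ S, D (y * p ^ 2) = D y := fun y hy => by
    have e1 := h.I₁_sub y hy
    have e2 := h.I₁_sub _ (h.mul_mem y hy)
    have e3 := h.I₂_sub y hy
    have e4 := h.I₂_sub _ (h.mul_mem y hy)
    rw [show p * y * p ^ 2 = p * (y * p ^ 2) by ring] at e2 e4
    have e5 := mul_eq_neg_mul_of_sq_eq_zero h.sq_zero (h.m_mem (p * y)) (h.I₁_mem (y * p ^ 2))
    rw [show p * (p * y) = y * p ^ 2 by ring, e5, smul_neg, ← mul_smul_comm, ← e2] at e4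
    rw [← smul_mul_assoc, ← e1] at e3
    rw [← sub_eq_zero]
    calc D (y * p ^ 2) - D y
        = -(I₂ y - I₂ (y * p ^ 2)) + (I₂ (p * y) - I₂ (p * (y * p ^ 2)))
          + (I₁ y * I₁ (p * y) - I₁ (y * p ^ 2) * I₁ (p * (y * p ^ 2))) := by
          simp only [hD]; abel
      _ = 0 := by rw [e3, e4]; noncomm_ring
  have hall : ∀ k : ℕ, D (x * (p ^ 2) ^ k) = D x := fun k => by
    induction k with
    | zero => simp
    | succ k ih => rw [pow_succ, ← mul_assoc, hstep _ (h.mul_pow_mem hx k), ih]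
  obtain ⟨l₁, hl₁⟩ := h.tendsto_I₁
  obtain ⟨l₂, hl₂⟩ := h.tendsto_I₂
  have hl : l₁ * l₁ = 0 := by
    refine tendsto_nhds_unique ((hl₁ x hx).mul (hl₁ x hx)) ?_
    simp only [h.sq_zero _ (h.I₁_mem _)]
    exact tendsto_const_nhds
  have hlim := ((hl₂ x hx).sub (hl₂ _ (h.mul_mem x hx))).sub
    ((hl₁ x hx).mul (hl₁ _ (h.mul_mem x hx)))
  rw [hl, sub_self, sub_zero] at hlim
  have hconst : Tendsto (fun k : ℕ => D (x * (p ^ 2) ^ k)) atTop (𝓝 0) := by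
    refine hlim.congr fun k => ?_
    simp only [hD, mul_assoc]
  simp only [hall] at hconst
  exact sub_eq_zero.mp (tendsto_nhds_unique tendsto_const_nhds hconst)

/-- With `e = (1-p²) x m(x)`, `J = I₁(px)`, `K = I₁(p²x)` and `X = I₂(p²x)`, one has `I₁(x) = K +
e`, `I₂(x) = X + eJ` and `I₂(px) = X + JK`. As `X` commutes with the rest and `eJ`, `JK` square to
zero, each power is linear in these products, and the factorials absorb the binomial factor. -/
theorem skewPower_sub (h : SkewPrimitives p lo S V m I₁ I₂) (n : ℕ) {x : ℝ} (hx : x ∈ S) :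
    skewPower I₁ I₂ (n + 1) x - skewPower I₁ I₂ (n + 1) (x * p ^ 2) =
      ((1 - p ^ 2) * x) • (m x * skewPower I₁ I₂ n (p * x)) := by
  set e : A := ((1 - p ^ 2) * x) • m x with he
  have heV : e ∈ V := V.smul_mem _ (h.m_mem x)
  set J := I₁ (p * x) with hJ
  set K := I₁ (x * p ^ 2) with hK
  have hJV : J ∈ V := h.I₁_mem _
  have hKV : K ∈ V := h.I₁_mem _
  set X := I₂ (x * p ^ 2) with hX
  have hI₁ : I₁ x = K + e := by rw [he, ← h.I₁_sub x hx]; abel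
  have hI₂ : I₂ x = X + e * J := by rw [he, smul_mul_assoc, ← h.I₂_sub x hx]; abel
  have hI₂' : I₂ (p * x) = X + J * K := by
    have := h.I₂_sub_mul (h.mul_mem x hx)
    rw [show p * (p * x) = x * p ^ 2 by ring] at this
    rw [← this]; abel
  have hXe : Commute X e := h.I₂_comm _ _ heV
  have hXJ : Commute X J := h.I₂_comm _ _ hJV
  have hXK : Commute X K := h.I₂_comm _ _ hKV
  have hJe := mul_eq_neg_mul_of_sq_eq_zero h.sq_zero hJV heV
  have hKe := mul_eq_neg_mul_of_sq_eq_zero h.sq_zero hKV heV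
  have hKJ := mul_eq_neg_mul_of_sq_eq_zero h.sq_zero hKV hJV
  have hee := h.sq_zero e heV
  have hJJ := h.sq_zero J hJV
  have hKK := h.sq_zero K hKV
  have hsq1 : e * J * (e * J) = 0 := by
    rw [mul_assoc, ← mul_assoc J, hJe, neg_mul, mul_neg, mul_assoc e J, hJJ]; simp
  have hsq2 : J * K * (J * K) = 0 := by
    rw [mul_assoc, ← mul_assoc K, hKJ, neg_mul, mul_neg, mul_assoc J K, hKK]; simp
  have hfac : ∀ k : ℕ, (((k + 1).factorial : ℝ))⁻¹ * ((k : ℝ) + 1) = ((k.factorial : ℝ))⁻¹ :=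
    fun k => by
      have : (k.factorial : ℝ) ≠ 0 := by positivity
      rw [Nat.factorial_succ]; push_cast; field_simp
  rw [← smul_mul_assoc, ← he]
  obtain ⟨k, rfl | rfl⟩ := n.even_or_odd'
  · rw [skewPower_odd, skewPower_odd, skewPower_even, hI₁, hI₂, hI₂', ← hK, ← hX]
    rcases k with _ | k
    · simp
    · rw [add_pow_succ_of_sq_eq_zero (hXe.mul_right hXJ) hsq1,
        add_pow_succ_of_sq_eq_zero (hXJ.mul_right hXK) hsq2]
      have h1 : e * (X ^ k * (e * J)) = 0 := by
        rw [← mul_assoc, ← (hXe.pow_left k).eq, mul_assoc, ← mul_assoc e, hee]; simp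
      -- Moving `K` past `e` and then past `J` costs two signs.
      have h2 : K * (X ^ k * (e * J)) = e * (X ^ k * (J * K)) := by
        rw [← mul_assoc, ← (hXK.pow_left k).eq, mul_assoc, ← mul_assoc K, hKe, neg_mul, mul_assoc,
          hKJ, mul_neg, mul_neg, mul_neg, neg_neg, ← mul_assoc, (hXe.pow_left k).eq, mul_assoc]
      simp only [mul_smul_comm, smul_add, mul_add, add_mul, h1, h2, add_zero]
      abel
  · rw [show 2 * k + 1 + 1 = 2 * (k + 1) by ring, skewPower_even, skewPower_even, skewPower_odd,
      hI₂, hI₂', ← hX, ← hJ, add_pow_succ_of_sq_eq_zero (hXe.mul_right hXJ) hsq1, smul_add, smul_smul, hfac,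
      add_sub_cancel_left]
    rcases k with _ | k
    · simp
    · have h1 : J * (X ^ k * (J * K)) = 0 := by
        rw [← mul_assoc, ← (hXJ.pow_left k).eq, mul_assoc, ← mul_assoc J, hJJ]; simp
      rw [add_pow_succ_of_sq_eq_zero (hXJ.mul_right hXK) hsq2, smul_add, mul_add]
      simp only [mul_smul_comm, h1, smul_zero, add_zero]
      rw [((hXe.mul_right hXJ).pow_left (k + 1)).eq, mul_assoc]

/-- Evaluation of ordered `q`-integrals of products in an exterior algebra, after de Bruijn. -/
theorem orderedJackson_eq (h : SkewPrimitives p lo S V m I₁ I₂)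
    (hcont : ∀ l : A →ₗ[ℝ] ℝ, Continuous l) (hp0 : 0 ≤ p) (hp1 : p < 1) (n : ℕ) (l : A →ₗ[ℝ] ℝ)
    {x : ℝ} (hx : x ∈ S) :
    OrderedJacksonConverges (p ^ 2) lo n x (fun z => l (List.ofFn fun i => m (z i)).prod) ∧
      orderedJackson (p ^ 2) lo n x (fun z => l (List.ofFn fun i => m (z i)).prod) =
        l (skewPower I₁ I₂ n x) := by
  have hq0 : 0 ≤ p ^ 2 := sq_nonneg p
  have hq1 : p ^ 2 < 1 := by nlinarith
  induction n generalizing x l with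
  | zero => simp [OrderedJacksonConverges, orderedJackson, skewPower]
  | succ n ih =>
    simp only [OrderedJacksonConverges, orderedJackson, Real.sqrt_sq hp0]
    -- The outermost factor `m z` is absorbed into the functional, which is why the induction runs
    -- over all functionals `l`.
    have hcons : ∀ z : ℝ, (fun t : Fin n → ℝ =>
        l (List.ofFn fun i => m ((Fin.cons z t : Fin (n + 1) → ℝ) i)).prod) =
        fun t => (l ∘ₗ LinearMap.mulLeft ℝ (m z)) (List.ofFn fun i => m (t i)).prod := fun z => by
      funext t
      simp [List.ofFn_succ]
    simp only [hcons]
    have hval : ∀ z ∈ S, orderedJackson (p ^ 2) lo n (p * z) (fun t =>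
        (l ∘ₗ LinearMap.mulLeft ℝ (m z)) (List.ofFn fun i => m (t i)).prod) =
        l (m z * skewPower I₁ I₂ n (p * z)) := fun z hz =>
      (ih (l ∘ₗ LinearMap.mulLeft ℝ (m z)) (h.mul_mem z hz)).2
    obtain ⟨lim, hlim⟩ := h.tendsto_skewPower n
    obtain ⟨lim', hlim'⟩ := h.tendsto_skewPower (n + 1)
    have hconv : ∀ z ∈ S, ConvergesAlong (p ^ 2) z fun z => l (m z * skewPower I₁ I₂ n (p * z)) :=
      fun z hz => by
        obtain ⟨lm, hlm⟩ := h.tendsto_m z hz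
        refine ⟨l (lm * lim), ((hcont l).tendsto _).comp (hlm.mul ?_)⟩
        simpa only [mul_assoc] using hlim _ (h.mul_mem z hz)
    have htel : ∀ z ∈ S, jacksonZero (p ^ 2) z (fun z => l (m z * skewPower I₁ I₂ n (p * z))) =
        l (skewPower I₁ I₂ (n + 1) z) - l lim' := fun z hz => by
      have := jacksonZero_of_telescope hq0 hq1 (hconv z hz)
        (G := fun k => l (skewPower I₁ I₂ (n + 1) (z * (p ^ 2) ^ k))) (fun k => by
          rw [← map_sub, pow_succ (p ^ 2), ← mul_assoc z, h.skewPower_sub n (h.mul_pow_mem hz k), map_smul,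
            smul_eq_mul]
          ring) (((hcont l).tendsto _).comp (hlim' z hz))
      simpa using this
    refine ⟨⟨JacksonIntegrable.congr ((hconv lo h.mem_lo).jacksonIntegrable hq0 hq1 (hconv x hx))
      (fun k => hval _ (h.mul_pow_mem hx k)) (fun k => hval _ (h.mul_pow_mem h.mem_lo k)),
      fun z hz => ?_⟩, ?_⟩
    · refine (ih _ (h.mul_mem z ?_)).1
      obtain ⟨k, rfl | rfl⟩ := hz
      · exact h.mul_pow_mem hx k
      · exact h.mul_pow_mem h.mem_lo k
    · rw [jackson_congr (g := fun z => l (m z * skewPower I₁ I₂ n (p * z)))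
        (fun k => hval _ (h.mul_pow_mem hx k))
        (fun k => hval _ (h.mul_pow_mem h.mem_lo k)), jackson, htel x hx, htel lo h.mem_lo,
        h.skewPower_lo, map_zero]
      ring

end SkewPrimitives

end DeBruijn

/-! ### Powers of sums of commuting square-zero elements. -/

section OrderedProduct

variable {A : Type*} [Ring A]

theorem prod_ofFn_succ (f : ℕ → A) (n : ℕ) :
    (List.ofFn fun i : Fin (n + 1) => f i).prod = (List.ofFn fun i : Fin n => f i).prod * f n := by
  rw [List.ofFn_succ', List.concat_eq_append, List.prod_append]
  simp

variable [Algebra ℝ A]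

/-- Only squarefree monomials survive. The vanishing of the next power is carried along because that
power appears when one more summand is added. -/
theorem sum_pow_eq_factorial_smul {x : ℕ → A} (hcomm : ∀ i j, Commute (x i) (x j))
    (hsq : ∀ i, x i * x i = 0) (n : ℕ) :
    (∑ i ∈ Finset.range n, x i) ^ n =
        (n.factorial : ℝ) • (List.ofFn fun i : Fin n => x i).prod ∧
      (∑ i ∈ Finset.range n, x i) ^ (n + 1) = 0 := by
  induction n with
  | zero => simp
  | succ n ih =>
    have hc : Commute (∑ i ∈ Finset.range n, x i) (x n) :=
      Commute.sum_left _ _ _ fun i _ => hcomm i n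
    rw [Finset.sum_range_succ, add_pow_succ_of_sq_eq_zero hc (hsq n),
      add_pow_succ_of_sq_eq_zero hc (hsq n), pow_succ _ (n + 1), ih.2, ih.1, prod_ofFn_succ,
      smul_mul_assoc, smul_smul, Nat.factorial_succ]
    refine ⟨?_, by simp⟩
    push_cast
    rw [zero_add]

theorem prod_ofFn_smul_mul (r : ℕ → ℝ) (e : ℕ → A) (n : ℕ) :
    (List.ofFn fun i : Fin n => r i • (e (2 * i) * e (2 * i + 1))).prod =
      (∏ i ∈ Finset.range n, r i) • (List.ofFn fun i : Fin (2 * n) => e i).prod := by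
  induction n with
  | zero => simp
  | succ n ih =>
    rw [prod_ofFn_succ fun i => r i • (e (2 * i) * e (2 * i + 1)), ih,
      show 2 * (n + 1) = 2 * n + 1 + 1 by ring, prod_ofFn_succ, prod_ofFn_succ,
      Finset.prod_range_succ, smul_mul_smul_comm, mul_assoc]

end OrderedProduct

theorem sum_range_two_mul {M : Type*} [AddCommMonoid M] (f : ℕ → M) (n : ℕ) :
    ∑ i ∈ Finset.range (2 * n), f i = ∑ i ∈ Finset.range n, (f (2 * i) + f (2 * i + 1)) := by
  induction n with
  | zero => simp
  | succ n ih =>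
    rw [show 2 * (n + 1) = 2 * n + 1 + 1 by ring, Finset.sum_range_succ, Finset.sum_range_succ, ih,
      Finset.sum_range_succ, add_assoc]

/-! ### Two-fold Jackson integrals and the skew inner product. -/

/-- The two-fold `q`-integral `∫_{y=lo}^{hi} ∫_{x=lo}^{p y} f(y) g(x)`. -/
noncomputable def jacksonPair (p lo hi : ℝ) (f g : ℝ → ℝ) : ℝ :=
  jackson (p ^ 2) lo hi fun y => f y * jackson (p ^ 2) lo (p * y) g

/-- A set of points stable under multiplication by `p`, containing the lower limit `lo`. -/
structure IsJacksonDomain (p lo : ℝ) (S : Set ℝ) : Prop where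
  p_pos : 0 < p
  p_lt : p < 1
  mem_lo : lo ∈ S
  mul_mem : ∀ x ∈ S, p * x ∈ S

/-- Convergence along all the geometric sequences of ratio `p ^ 2` in `S`. -/
def ConvergesOn (p : ℝ) (S : Set ℝ) (f : ℝ → ℝ) : Prop := ∀ x ∈ S, ConvergesAlong (p ^ 2) x f

namespace IsJacksonDomain

variable {p lo hi : ℝ} {S : Set ℝ} {f g : ℝ → ℝ}

theorem sq_nonneg (_ : IsJacksonDomain p lo S) : 0 ≤ p ^ 2 := _root_.sq_nonneg p

theorem sq_lt (h : IsJacksonDomain p lo S) : p ^ 2 < 1 := by nlinarith [h.p_pos, h.p_lt]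

theorem mul_pow_mem (h : IsJacksonDomain p lo S) {x : ℝ} (hx : x ∈ S) (k : ℕ) :
    x * (p ^ 2) ^ k ∈ S := by
  induction k with
  | zero => simpa
  | succ k ih =>
    have := h.mul_mem _ (h.mul_mem _ ih)
    rwa [show p * (p * (x * (p ^ 2) ^ k)) = x * (p ^ 2) ^ (k + 1) by ring] at this

theorem convergesAlong_jackson (x : ℝ) (g : ℝ → ℝ) :
    ConvergesAlong (p ^ 2) x fun y => jackson (p ^ 2) lo (p * y) g :=
  ⟨_, by simpa only [mul_assoc] using tendsto_jackson (p ^ 2) lo (p * x) g⟩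

theorem convergesOn_mul_jackson (hf : ConvergesOn p S f) :
    ConvergesOn p S fun y => f y * jackson (p ^ 2) lo (p * y) g :=
  fun x hx => (hf x hx).mul (convergesAlong_jackson x g)

theorem integrable (h : IsJacksonDomain p lo S) (hf : ConvergesOn p S f) {x : ℝ} (hx : x ∈ S) :
    JacksonIntegrable (p ^ 2) lo x f :=
  (hf lo h.mem_lo).jacksonIntegrable h.sq_nonneg h.sq_lt (hf x hx)

theorem jackson_skewIntegrand (h : IsJacksonDomain p lo S) {w φ ψ : ℝ → ℝ}
    (hφ : ConvergesOn p S fun x => φ x * w x) (hψ : ConvergesOn p S fun x => ψ x * w x) {y : ℝ}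
    (hy : y ∈ S) :
    JacksonIntegrable (p ^ 2) lo (p * y) (fun x => skewIntegrand w φ ψ x y) ∧
    jackson (p ^ 2) lo (p * y) (fun x => skewIntegrand w φ ψ x y) =
      ψ y * w y * jackson (p ^ 2) lo (p * y) (fun x => φ x * w x) -
        φ y * w y * jackson (p ^ 2) lo (p * y) (fun x => ψ x * w x) := by
  have e : (fun x => skewIntegrand w φ ψ x y) =
      fun x => ψ y * w y * (φ x * w x) - φ y * w y * (ψ x * w x) := by
    funext x; simp only [skewIntegrand]; ring
  have hy' := h.mul_mem y hy
  have h1 : ConvergesOn p S fun x => ψ y * w y * (φ x * w x) := fun x hx => (hφ x hx).const_mul _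
  have h2 : ConvergesOn p S fun x => φ y * w y * (ψ x * w x) := fun x hx => (hψ x hx).const_mul _
  rw [e]
  refine ⟨h.integrable (fun x hx => (h1 x hx).sub (h2 x hx)) hy', ?_⟩
  rw [(h.integrable h1 hy').jackson_sub (h.integrable h2 hy'), jackson_const_mul, jackson_const_mul]

theorem skewInner_eq (h : IsJacksonDomain p lo S) {w φ ψ : ℝ → ℝ}
    (hφ : ConvergesOn p S fun x => φ x * w x) (hψ : ConvergesOn p S fun x => ψ x * w x)
    (hhi : hi ∈ S) :
    SkewInnerConverges (p ^ 2) lo hi w φ ψ ∧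
    skewInner (p ^ 2) lo hi w φ ψ =
      jacksonPair p lo hi (fun x => ψ x * w x) (fun x => φ x * w x) -
        jacksonPair p lo hi (fun x => φ x * w x) (fun x => ψ x * w x) := by
  have hval := fun y hy => (h.jackson_skewIntegrand hφ hψ (y := y) hy).2
  have i1 := h.integrable (convergesOn_mul_jackson (lo := lo) (g := fun x => φ x * w x) hψ) hhi
  have i2 := h.integrable (convergesOn_mul_jackson (lo := lo) (g := fun x => ψ x * w x) hφ) hhi
  have i3 := h.integrable (fun x hx =>
    ((convergesOn_mul_jackson (lo := lo) (g := fun x => φ x * w x) hψ) x hx).sub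
    ((convergesOn_mul_jackson (lo := lo) (g := fun x => ψ x * w x) hφ) x hx)) hhi
  simp only [SkewInnerConverges, skewInner, Real.sqrt_sq h.p_pos.le]
  refine ⟨⟨i3.congr (fun k => hval _ (h.mul_pow_mem hhi k))
    (fun k => hval _ (h.mul_pow_mem h.mem_lo k)), fun y hy => ?_⟩, ?_⟩
  · refine (h.jackson_skewIntegrand hφ hψ ?_).1
    obtain ⟨k, rfl | rfl⟩ := hy
    · exact h.mul_pow_mem hhi k
    · exact h.mul_pow_mem h.mem_lo k
  · rw [jacksonPair, jacksonPair, ← i1.jackson_sub i2]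
    exact jackson_congr (fun k => hval _ (h.mul_pow_mem hhi k))
      (fun k => hval _ (h.mul_pow_mem h.mem_lo k))

end IsJacksonDomain

/-! ### De Bruijn's formula in the exterior algebra. -/

section Pfaffian

/-- The generators of the exterior algebra of `ℝ^N`, extended by zero. -/
noncomputable def extGen (N : ℕ) (k : ℕ) : ExteriorAlgebra ℝ (Fin N → ℝ) :=
  if hk : k < N then ExteriorAlgebra.ι ℝ (Pi.single ⟨k, hk⟩ 1) else 0

theorem extGen_mem (N k : ℕ) :
    extGen N k ∈ LinearMap.range (ExteriorAlgebra.ι ℝ (M := Fin N → ℝ)) := by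
  rw [extGen]
  split_ifs
  · exact LinearMap.mem_range_self _ _
  · exact Submodule.zero_mem _

theorem ι_eq_sum (N : ℕ) (v : ℕ → ℝ) :
    ExteriorAlgebra.ι ℝ (fun i : Fin N => v i) = ∑ i ∈ Finset.range N, v i • extGen N i := by
  rw [← Fin.sum_univ_eq_sum_range (fun i => v i • extGen N i) N, pi_eq_sum_univ' fun i : Fin N => v i,
    map_sum]
  refine Finset.sum_congr rfl fun i _ => ?_
  rw [map_smul, extGen, dif_pos i.2]

theorem sq_eq_zero_of_mem_range {N : ℕ} {v : ExteriorAlgebra ℝ (Fin N → ℝ)}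
    (hv : v ∈ LinearMap.range (ExteriorAlgebra.ι ℝ (M := Fin N → ℝ))) : v * v = 0 := by
  obtain ⟨v, rfl⟩ := hv
  exact ExteriorAlgebra.ι_sq_zero v

theorem extGen_mul_swap (N i j : ℕ) : extGen N i * extGen N j = -(extGen N j * extGen N i) :=
  mul_eq_neg_mul_of_sq_eq_zero (fun _ => sq_eq_zero_of_mem_range) (extGen_mem N i) (extGen_mem N j)

theorem commute_extGen_mul (N i j : ℕ) {v : ExteriorAlgebra ℝ (Fin N → ℝ)}
    (hv : v ∈ LinearMap.range (ExteriorAlgebra.ι ℝ (M := Fin N → ℝ))) :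
    Commute (extGen N i * extGen N j) v := by
  have h1 := mul_eq_neg_mul_of_sq_eq_zero (fun _ => sq_eq_zero_of_mem_range) (extGen_mem N i) hv
  have h2 := mul_eq_neg_mul_of_sq_eq_zero (fun _ => sq_eq_zero_of_mem_range) (extGen_mem N j) hv
  rw [commute_iff_eq, mul_assoc, h2, mul_neg, ← mul_assoc, h1, neg_mul, neg_neg, mul_assoc]

/-- The quadratic element `∑ d i j e_i e_j` of the exterior algebra. -/
noncomputable def extQuad (N : ℕ) (d : ℕ → ℕ → ℝ) : ExteriorAlgebra ℝ (Fin N → ℝ) :=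
  ∑ i ∈ Finset.range N, ∑ j ∈ Finset.range N, d i j • (extGen N i * extGen N j)

theorem commute_extQuad {N : ℕ} (d : ℕ → ℕ → ℝ) {x : ExteriorAlgebra ℝ (Fin N → ℝ)}
    (h : ∀ i j, Commute (extGen N i * extGen N j) x) : Commute (extQuad N d) x :=
  Commute.sum_left _ _ _ fun i _ => Commute.sum_left _ _ _ fun j _ => (h i j).smul_left _

theorem commute_extGen_mul_extGen_mul (N i j k l : ℕ) :
    Commute (extGen N i * extGen N j) (extGen N k * extGen N l) :=
  (commute_extGen_mul N i j (extGen_mem N k)).mul_right (commute_extGen_mul N i j (extGen_mem N l))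

/-- Only the antisymmetric part of `d` matters because generators anticommute. Skew orthogonality
makes that part block diagonal, with the generators paired as `(2i, 2i+1)`. -/
theorem extQuad_eq_of_skew (n : ℕ) (d : ℕ → ℕ → ℝ) (u : ℕ → ℝ)
    (h0 : ∀ i j, d (2 * i) (2 * j) = d (2 * j) (2 * i))
    (h1 : ∀ i j, d (2 * i + 1) (2 * j + 1) = d (2 * j + 1) (2 * i + 1))
    (hu : ∀ i j, d (2 * j + 1) (2 * i) - d (2 * i) (2 * j + 1) = if i = j then u i else 0) :
    extQuad (2 * n) d =
      ∑ i ∈ Finset.range n, (-u i) • (extGen (2 * n) (2 * i) * extGen (2 * n) (2 * i + 1)) := by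
  set E := extGen (2 * n)
  have hE : ∀ i j, E i * E j = -(E j * E i) := extGen_mul_swap (2 * n)
  have hsymm : ∀ s : ℕ → ℕ → ℝ, ∀ f : ℕ → ℕ, (∀ i j, s i j = s j i) →
      ∑ i ∈ Finset.range n, ∑ j ∈ Finset.range n, s i j • (E (f i) * E (f j)) = 0 := fun s f hs => by
    have h2 : ∑ i ∈ Finset.range n, ∑ j ∈ Finset.range n, s i j • (E (f i) * E (f j)) =
        -∑ i ∈ Finset.range n, ∑ j ∈ Finset.range n, s i j • (E (f i) * E (f j)) := by
      conv_lhs => rw [Finset.sum_comm]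
      simp only [← Finset.sum_neg_distrib, ← smul_neg]
      refine Finset.sum_congr rfl fun i _ => Finset.sum_congr rfl fun j _ => ?_
      rw [← hE, hs]
    rw [eq_neg_iff_add_eq_zero, ← two_smul ℝ] at h2
    exact (smul_eq_zero.mp h2).resolve_left two_ne_zero
  have hsplit : extQuad (2 * n) d =
      ∑ i ∈ Finset.range n, ∑ j ∈ Finset.range n, d (2 * i) (2 * j) • (E (2 * i) * E (2 * j)) +
      ∑ i ∈ Finset.range n, ∑ j ∈ Finset.range n,
        d (2 * i) (2 * j + 1) • (E (2 * i) * E (2 * j + 1)) +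
      (∑ i ∈ Finset.range n, ∑ j ∈ Finset.range n,
        d (2 * i + 1) (2 * j) • (E (2 * i + 1) * E (2 * j)) +
      ∑ i ∈ Finset.range n, ∑ j ∈ Finset.range n,
        d (2 * i + 1) (2 * j + 1) • (E (2 * i + 1) * E (2 * j + 1))) := by
    rw [extQuad, sum_range_two_mul]
    simp only [sum_range_two_mul, Finset.sum_add_distrib]
    rfl
  rw [hsplit, hsymm (fun i j => d (2 * i) (2 * j)) (fun i => 2 * i) h0,
    hsymm (fun i j => d (2 * i + 1) (2 * j + 1)) (fun i => 2 * i + 1) h1, zero_add, add_zero,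
    Finset.sum_comm (f := fun i j => d (2 * i + 1) (2 * j) • (E (2 * i + 1) * E (2 * j))),
    ← Finset.sum_add_distrib]
  refine Finset.sum_congr rfl fun i hi => ?_
  rw [← Finset.sum_add_distrib]
  have hterm : ∀ j, d (2 * i) (2 * j + 1) • (E (2 * i) * E (2 * j + 1)) +
      d (2 * j + 1) (2 * i) • (E (2 * j + 1) * E (2 * i)) =
      (-if i = j then u i else 0) • (E (2 * i) * E (2 * j + 1)) := fun j => by
    rw [← hu, hE (2 * j + 1)]
    module
  simp only [hterm]
  rw [Finset.sum_eq_single i (fun j _ hj => by rw [if_neg hj.symm]; simp)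
    (fun h => absurd hi h), if_pos rfl]

theorem extGen_mul_mul_self (N i j : ℕ) :
    extGen N i * extGen N j * (extGen N i * extGen N j) = 0 := by
  rw [mul_assoc, ← mul_assoc (extGen N j), extGen_mul_swap N j i, neg_mul, mul_neg,
    mul_assoc _ (extGen N j), sq_eq_zero_of_mem_range (extGen_mem N j), mul_zero, mul_zero, neg_zero]

/-- The Pfaffian of a block diagonal skew matrix, up to sign: the pairs of generators commute and
square to zero. -/
theorem extQuad_pow (n : ℕ) (u : ℕ → ℝ) :
    (∑ i ∈ Finset.range n, (-u i) • (extGen (2 * n) (2 * i) * extGen (2 * n) (2 * i + 1))) ^ n =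
      ((n.factorial : ℝ) * ((-1) ^ n * ∏ i ∈ Finset.range n, u i)) •
        (List.ofFn fun i : Fin (2 * n) => extGen (2 * n) i).prod := by
  rw [(sum_pow_eq_factorial_smul (fun i j =>
    ((commute_extGen_mul_extGen_mul (2 * n) _ _ _ _).smul_left _).smul_right _) (fun i => ?_) n).1,
    prod_ofFn_smul_mul (fun i => -u i), smul_smul]
  · rw [Finset.prod_neg, Finset.card_range]
  · rw [smul_mul_smul_comm, extGen_mul_mul_self, smul_zero]

instance (N : ℕ) : Module.Finite ℝ (ExteriorAlgebra ℝ (Fin N → ℝ)) :=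
  Module.Finite.of_basis (Pi.basisFun ℝ (Fin N)).ExteriorAlgebra

/-- The determinant as a linear functional on the exterior algebra. -/
noncomputable def extDet (N : ℕ) : ExteriorAlgebra ℝ (Fin N → ℝ) →ₗ[ℝ] ℝ :=
  ExteriorAlgebra.liftAlternating (Pi.single N Matrix.detRowAlternating)

theorem extDet_prod (N : ℕ) (v : Fin N → Fin N → ℝ) :
    extDet N (List.ofFn fun i => ExteriorAlgebra.ι ℝ (v i)).prod = Matrix.det (Matrix.of v) := by
  rw [← ExteriorAlgebra.ιMulti_apply, extDet, ExteriorAlgebra.liftAlternating_apply_ιMulti,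
    Pi.single_eq_same]
  rfl

theorem extDet_prod_extGen (N : ℕ) :
    extDet N (List.ofFn fun i : Fin N => extGen N i).prod = 1 := by
  have h : (fun i : Fin N => extGen N i) =
      fun i : Fin N => ExteriorAlgebra.ι ℝ ((Pi.single i 1 : Fin N → ℝ)) := by
    funext i; rw [extGen, dif_pos i.2]
  rw [h, extDet_prod N fun i => Pi.single i 1, ← Matrix.det_one (n := Fin N) (R := ℝ)]
  congr 1
  ext i j
  simp [Matrix.one_apply, Pi.single_apply, eq_comm]

/-- De Bruijn's formula for ordered `q`-integrals of determinants, for functions in skew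
orthogonal position. -/
theorem orderedJackson_det {p lo hi : ℝ} {S : Set ℝ} (h : IsJacksonDomain p lo S) (hhi : hi ∈ S)
    {w : ℝ → ℝ} {φ : ℕ → ℝ → ℝ} (hφ : ∀ k, ConvergesOn p S fun x => φ k x * w x) (n : ℕ)
    (h0 : ∀ i j, skewInner (p ^ 2) lo hi w (φ (2 * i)) (φ (2 * j)) = 0)
    (h1 : ∀ i j, skewInner (p ^ 2) lo hi w (φ (2 * i + 1)) (φ (2 * j + 1)) = 0) {u : ℕ → ℝ}
    (hu : ∀ i j, skewInner (p ^ 2) lo hi w (φ (2 * i)) (φ (2 * j + 1)) = if i = j then u i else 0) :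
    OrderedJacksonConverges (p ^ 2) lo (2 * n) hi
        (fun z => Matrix.det (Matrix.of fun i j : Fin (2 * n) => φ j (z i) * w (z i))) ∧
      orderedJackson (p ^ 2) lo (2 * n) hi
        (fun z => Matrix.det (Matrix.of fun i j : Fin (2 * n) => φ j (z i) * w (z i))) =
        (-1) ^ n * ∏ i ∈ Finset.range n, u i := by
  set f : ℕ → ℝ → ℝ := fun k x => φ k x * w x with hf
  -- In the module topology of this finite-dimensional algebra, linear maps and the multiplication
  -- are continuous; coordinates in a basis show that it is Hausdorff.
  let _ : TopologicalSpace (ExteriorAlgebra ℝ (Fin (2 * n) → ℝ)) := moduleTopology ℝ _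
  have : IsModuleTopology ℝ (ExteriorAlgebra ℝ (Fin (2 * n) → ℝ)) := ⟨rfl⟩
  have : IsTopologicalRing (ExteriorAlgebra ℝ (Fin (2 * n) → ℝ)) :=
    IsModuleTopology.isTopologicalRing ℝ _
  have hcont : ∀ l : ExteriorAlgebra ℝ (Fin (2 * n) → ℝ) →ₗ[ℝ] ℝ, Continuous l := fun l =>
    IsModuleTopology.continuous_of_linearMap l
  have : T2Space (ExteriorAlgebra ℝ (Fin (2 * n) → ℝ)) := by
    let b := (Pi.basisFun ℝ (Fin (2 * n))).ExteriorAlgebra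
    exact T2Space.of_injective_continuous (f := b.equivFun) b.equivFun.injective
      (IsModuleTopology.continuous_of_linearMap b.equivFun.toLinearMap)
  set m : ℝ → ExteriorAlgebra ℝ (Fin (2 * n) → ℝ) := fun x =>
    ExteriorAlgebra.ι ℝ fun i : Fin (2 * n) => f i x with hm
  set I₁ : ℝ → ExteriorAlgebra ℝ (Fin (2 * n) → ℝ) := fun x =>
    ExteriorAlgebra.ι ℝ fun i : Fin (2 * n) => jackson (p ^ 2) lo x (f i) with hI₁
  set I₂ : ℝ → ExteriorAlgebra ℝ (Fin (2 * n) → ℝ) := fun x =>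
    extQuad (2 * n) fun i j => jacksonPair p lo x (f i) (f j) with hI₂
  have hιc : Continuous (ExteriorAlgebra.ι ℝ (M := Fin (2 * n) → ℝ)) :=
    IsModuleTopology.continuous_of_linearMap _
  have hprim : SkewPrimitives p lo S (LinearMap.range (ExteriorAlgebra.ι ℝ)) m I₁ I₂ :=
    { mem_lo := h.mem_lo
      mul_mem := h.mul_mem
      sq_zero := fun v hv => sq_eq_zero_of_mem_range hv
      m_mem := fun x => LinearMap.mem_range_self _ _
      I₁_mem := fun x => LinearMap.mem_range_self _ _
      I₂_comm := fun x v hv => commute_extQuad _ fun i j => commute_extGen_mul _ i j hv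
      I₁_lo := by
        simp only [hI₁, jackson_self]
        exact map_zero _
      I₂_lo := by simp [hI₂, extQuad, jacksonPair, jackson_self]
      I₁_sub := fun x hx => by
        rw [hI₁, hm, ← map_sub, ← map_smul]
        congr 1
        funext i
        exact jackson_sub_mul h.sq_nonneg h.sq_lt (hφ i x hx)
      I₂_sub := fun x hx => by
        have e : ∀ i j, jacksonPair p lo x (f i) (f j) = jacksonPair p lo (x * p ^ 2) (f i) (f j) +
            (1 - p ^ 2) * x * (f i x * jackson (p ^ 2) lo (p * x) (f j)) := fun i j => by
          rw [jacksonPair, jacksonPair, ← jackson_sub_mul (α := lo) h.sq_nonneg h.sq_lt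
            (IsJacksonDomain.convergesOn_mul_jackson (hφ i) x hx)]
          ring
        simp only [hI₁, hI₂, hm, extQuad, e, add_smul, Finset.sum_add_distrib, add_sub_cancel_left]
        rw [ι_eq_sum _ fun i => f i x, ι_eq_sum _ fun i => jackson (p ^ 2) lo (p * x) (f i),
          Finset.sum_mul_sum, Finset.smul_sum]
        simp only [Finset.smul_sum, smul_mul_smul_comm, smul_smul]
      tendsto_m := fun x hx => by
        choose l hl using fun k => hφ k x hx
        refine ⟨ExteriorAlgebra.ι ℝ fun i : Fin (2 * n) => l i, (hιc.tendsto _).comp ?_⟩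
        exact tendsto_pi_nhds.mpr fun i => hl i
      tendsto_I₁ := ⟨ExteriorAlgebra.ι ℝ fun i : Fin (2 * n) => -jacksonZero (p ^ 2) lo (f i),
        fun x _ => (hιc.tendsto _).comp (tendsto_pi_nhds.mpr fun i => tendsto_jackson _ _ _ _)⟩
      tendsto_I₂ := ⟨_, fun x _ => tendsto_finsetSum _ fun i _ => tendsto_finsetSum _ fun j _ =>
        (tendsto_jackson _ _ _ _).smul_const _⟩ }
  have key := hprim.orderedJackson_eq hcont h.p_pos.le h.p_lt (2 * n) (extDet (2 * n)) hhi
  have hdet : (fun z : Fin (2 * n) → ℝ => extDet (2 * n) (List.ofFn fun i => m (z i)).prod) =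
      fun z => Matrix.det (Matrix.of fun i j : Fin (2 * n) => φ j (z i) * w (z i)) := by
    funext z
    exact extDet_prod (2 * n) fun i j => φ j (z i) * w (z i)
  rw [hdet] at key
  refine ⟨key.1, key.2.trans ?_⟩
  have hsk := fun i j => (h.skewInner_eq (hφ i) (hφ j) hhi).2
  have hq : I₂ hi = ∑ i ∈ Finset.range n,
      (-u i) • (extGen (2 * n) (2 * i) * extGen (2 * n) (2 * i + 1)) := by
    refine extQuad_eq_of_skew n _ u (fun i j => ?_) (fun i j => ?_) fun i j => ?_
    · have := h0 j i; rw [hsk] at this; exact sub_eq_zero.mp this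
    · have := h1 j i; rw [hsk] at this; exact sub_eq_zero.mp this
    · rw [← hu, hsk]
  rw [skewPower_even, hq, extQuad_pow, smul_smul, map_smul, extDet_prod_extGen, smul_eq_mul, mul_one,
    ← mul_assoc, inv_mul_cancel₀ (by positivity), one_mul]

end Pfaffian

/-! ### Weights as quotients of infinite products. -/

/-- The weight `(A x, C x; r)_∞ / (D x, E x; r)_∞`. -/
noncomputable def pochWeight (r A C D E x : ℝ) : ℝ :=
  qPochInf (A * x) r * qPochInf (C * x) r / (qPochInf (D * x) r * qPochInf (E * x) r)

section PochWeight

variable {r : ℝ}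

theorem tendsto_qPochInf_mul (hr0 : 0 ≤ r) (hr1 : r < 1) (A : ℝ) :
    Tendsto (fun x => qPochInf (A * x) r) (𝓝 0) (𝓝 1) := by
  have h : Tendsto (fun x : ℝ => A * x) (𝓝 0) (𝓝 0) := by
    simpa using (continuous_const_mul A).tendsto 0
  exact (tendsto_qPochInf_nhds_zero hr0 hr1).comp h

theorem tendsto_pochWeight (hr0 : 0 ≤ r) (hr1 : r < 1) (A C D E : ℝ) :
    Tendsto (pochWeight r A C D E) (𝓝 0) (𝓝 1) := by
  have h := fun A => tendsto_qPochInf_mul hr0 hr1 A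
  have h2 := ((h A).mul (h C)).div ((h D).mul (h E)) (by simp)
  simp only [mul_one, div_one] at h2
  exact h2

theorem pochWeight_eq_mul (hr0 : 0 ≤ r) (hr1 : r < 1) (A C D E x : ℝ) :
    pochWeight r A C D E x =
      (1 - A * x) * (1 - C * x) * pochWeight r (A * r) (C * r) D E x := by
  rw [pochWeight, pochWeight, qPochInf_eq_one_sub_mul hr0 hr1 (A * x),
    qPochInf_eq_one_sub_mul hr0 hr1 (C * x), mul_right_comm A, mul_right_comm C]
  ring

/-- Together with `pochWeight_eq_mul` this is the Pearson equation: the values at `x` and `r x` are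
polynomial multiples of one and the same weight. -/
theorem pochWeight_mul (hr0 : 0 ≤ r) (hr1 : r < 1) (A C : ℝ) {D E x : ℝ} (hD : D * x ≠ 1)
    (hE : E * x ≠ 1) :
    pochWeight r A C D E (r * x) =
      (1 - D * x) * (1 - E * x) * pochWeight r (A * r) (C * r) D E x := by
  have hD' : 1 - D * x ≠ 0 := sub_ne_zero.mpr hD.symm
  have hE' : 1 - E * x ≠ 0 := sub_ne_zero.mpr hE.symm
  rw [pochWeight, pochWeight, qPochInf_eq_one_sub_mul hr0 hr1 (D * x),
    qPochInf_eq_one_sub_mul hr0 hr1 (E * x), mul_right_comm D, mul_right_comm E]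
  rw [show (1 - D * x) * qPochInf (D * r * x) r * ((1 - E * x) * qPochInf (E * r * x) r) =
    (1 - D * x) * (1 - E * x) * (qPochInf (D * r * x) r * qPochInf (E * r * x) r) by ring,
    ← mul_div_assoc, mul_div_mul_left _ _ (mul_ne_zero hD' hE')]
  simp only [mul_assoc]

theorem pochWeight_eq_zero (hr0 : 0 ≤ r) (hr1 : r < 1) {A C D E x : ℝ}
    (h : A * x = 1 ∨ C * x = 1) : pochWeight r A C D E x = 0 := by
  have hz : ∀ y : ℝ, y = 1 → qPochInf y r = 0 := fun y hy =>
    qPochInf_eq_zero hr0 hr1 (i := 0) (by simpa using hy)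
  rcases h with h | h <;> simp [pochWeight, hz _ h]

/-- The even factors of each base `p` product come from the point `x` or `px` and the odd ones from
the other. This is why two base `p²` weights merge into the big `q`-Jacobi weight in base `p`. -/
theorem pochWeight_sq_mul {p : ℝ} (hp0 : 0 ≤ p) (hp1 : p < 1) (A C D E x : ℝ) :
    pochWeight (p ^ 2) (A * p ^ 2) (C * p ^ 2) D E x * pochWeight (p ^ 2) A C D E (p * x) =
      pochWeight p (A * p) (C * p) D E x := by
  simp only [pochWeight]
  rw [qPochInf_sq hp0 hp1 (A * p * x), qPochInf_sq hp0 hp1 (C * p * x), qPochInf_sq hp0 hp1 (D * x),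
      qPochInf_sq hp0 hp1 (E * x), div_mul_div_comm,
      show A * p ^ 2 * x = A * p * x * p by ring, show C * p ^ 2 * x = C * p * x * p by ring,
      show A * (p * x) = A * p * x by ring, show C * (p * x) = C * p * x by ring,
      show D * (p * x) = D * x * p by ring, show E * (p * x) = E * x * p by ring]
  congr 1 <;> ring

theorem eval_mul_converges {w : ℝ → ℝ} (hr0 : 0 ≤ r) (hr1 : r < 1) (hw : Tendsto w (𝓝 0) (𝓝 1))
    (f : ℝ[X]) (β : ℝ) : ConvergesAlong r β fun x => f.eval x * w x :=
  .of_tendsto hr0 hr1 ((f.continuous.tendsto 0).mul hw)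

end PochWeight

theorem eval_pearsonNum (a c p x : ℝ) :
    (pearsonNum a c p).eval x = (1 - (a * p)⁻¹ * x) * (1 - (c * p)⁻¹ * x) := by
  simp [pearsonNum]

theorem eval_pearsonDen (b c x : ℝ) :
    (pearsonDen b c).eval x = (1 - 1 * x) * (1 - b * c⁻¹ * x) := by
  simp [pearsonDen]

/-! ### The lattice and the big `q`-Jacobi functional. -/

/-- The points `a p^k` and `c p^k` with `k ≥ 1`. -/
def bigLattice (a c p : ℝ) : Set ℝ := {x | ∃ m : ℕ, x = a * p * p ^ m ∨ x = c * p * p ^ m}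

namespace BigQJacobiParams

variable {a b c p : ℝ}

theorem left_mem (_ : BigQJacobiParams a b c p) : c * p ∈ bigLattice a c p := ⟨0, by simp⟩

theorem right_mem (_ : BigQJacobiParams a b c p) : a * p ∈ bigLattice a c p := ⟨0, by simp⟩

theorem isJacksonDomain (h : BigQJacobiParams a b c p) :
    IsJacksonDomain p (c * p) (bigLattice a c p) where
  p_pos := h.p_pos
  p_lt := h.p_lt
  mem_lo := h.left_mem
  mul_mem := by
    rintro x ⟨m, rfl | rfl⟩
    · exact ⟨m + 1, Or.inl (by ring)⟩
    · exact ⟨m + 1, Or.inr (by ring)⟩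

theorem mul_pow_mem (h : BigQJacobiParams a b c p) {x : ℝ} (hx : x ∈ bigLattice a c p) (k : ℕ) :
    x * p ^ k ∈ bigLattice a c p := by
  induction k with
  | zero => simpa
  | succ k ih => rw [pow_succ, ← mul_assoc, mul_comm]; exact h.isJacksonDomain.mul_mem _ ih

/-- On the lattice no denominator factor vanishes: on the positive branch `b/c ≤ 0`, and on the
negative branch `(b/c)(c p^k) = b p^k < 1`. -/
theorem lt_one_of_mem (h : BigQJacobiParams a b c p) {x : ℝ} (hx : x ∈ bigLattice a c p) :
    1 * x < 1 ∧ b * c⁻¹ * x < 1 := by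
  have hc : c⁻¹ < 0 := inv_neg''.mpr h.c_neg
  have hb := mul_nonneg h.b_nonneg (neg_nonneg.mpr hc.le)
  obtain ⟨m, rfl | rfl⟩ := hx
  · have hm := pow_pos h.p_pos m
    have h1 : a * p * p ^ m < 1 := h.mul_pow_lt (m := 0) (by simpa using h.a_lt) (Nat.zero_le m)
    have h2 := mul_nonneg hb (mul_pos (mul_pos h.a_pos h.p_pos) hm).le
    constructor <;> nlinarith
  · have h1 : c * p * p ^ m < 1 := h.mul_pow_lt (m := 0) (by simpa using h.c_lt) (Nat.zero_le m)
    have h2 : b * p * p ^ m < 1 := h.mul_pow_lt (m := 0) (by simpa using h.b_lt) (Nat.zero_le m)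
    refine ⟨by rwa [one_mul], ?_⟩
    rwa [show b * c⁻¹ * (c * p * p ^ m) = b * p * p ^ m by field_simp [h.c_neg.ne]]

/-- The big `q`-Jacobi weight with base `p`. -/
noncomputable def weight (_ : BigQJacobiParams a b c p) : ℝ → ℝ :=
  pochWeight p ((a * p)⁻¹ * p) ((c * p)⁻¹ * p) 1 (b * c⁻¹)

theorem tendsto_weight (h : BigQJacobiParams a b c p) : Tendsto h.weight (𝓝 0) (𝓝 1) :=
  tendsto_pochWeight h.p_pos.le h.p_lt _ _ _ _

theorem integrable_weight (h : BigQJacobiParams a b c p) (f : ℝ[X]) :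
    JacksonIntegrable p (c * p) (a * p) fun x => f.eval x * h.weight x :=
  (eval_mul_converges h.p_pos.le h.p_lt h.tendsto_weight f _).jacksonIntegrable h.p_pos.le h.p_lt
    (eval_mul_converges h.p_pos.le h.p_lt h.tendsto_weight f _)

/-- The big `q`-Jacobi functional. -/
noncomputable def functional (h : BigQJacobiParams a b c p) : ℝ[X] →ₗ[ℝ] ℝ where
  toFun f := jackson p (c * p) (a * p) fun x => f.eval x * h.weight x
  map_add' f g := by
    simp only [eval_add, add_mul]
    exact (h.integrable_weight f).jackson_add (h.integrable_weight g)
  map_smul' r f := by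
    simp only [eval_smul, smul_eq_mul, mul_assoc]
    exact jackson_const_mul _ _ _ _ _

theorem functional_apply (h : BigQJacobiParams a b c p) (f : ℝ[X]) :
    h.functional f = jackson p (c * p) (a * p) fun x => f.eval x * h.weight x := rfl

end BigQJacobiParams

/-- The Pearson equation integrates to zero. -/
theorem jackson_pearson_eq_zero {p lo hi l : ℝ} (hp0 : 0 ≤ p) (hp1 : p < 1) {g F : ℝ → ℝ}
    (hg : ∀ x, ConvergesAlong p x g) (hF : Tendsto F (𝓝 0) (𝓝 l))
    (hlo : ∀ k : ℕ, lo * p ^ k * g (lo * p ^ k) = F (lo * p ^ k) - F (p * (lo * p ^ k)))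
    (hhi : ∀ k : ℕ, hi * p ^ k * g (hi * p ^ k) = F (hi * p ^ k) - F (p * (hi * p ^ k)))
    (hFlo : F lo = 0) (hFhi : F hi = 0) : jackson p lo hi g = 0 := by
  have key : ∀ β, (∀ k : ℕ, β * p ^ k * g (β * p ^ k) = F (β * p ^ k) - F (p * (β * p ^ k))) →
      F β = 0 → jacksonZero p β g = -((1 - p) * l) := fun β hβ hFβ => by
    have := jacksonZero_of_telescope hp0 hp1 (hg β) (G := fun k => (1 - p) * F (β * p ^ k))
      (fun k => by rw [hβ, pow_succ, show β * (p ^ k * p) = p * (β * p ^ k) by ring]; ring)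
      ((hF.comp (tendsto_mul_pow_atTop hp0 hp1 β)).const_mul (1 - p))
    simpa [hFβ] using this
  rw [jackson, key hi hhi hFhi, key lo hlo hFlo, sub_self]

namespace BigQJacobiParams

variable {a b c p : ℝ}

theorem inv_mul_self_right (h : BigQJacobiParams a b c p) : (a * p)⁻¹ * (a * p) = 1 :=
  inv_mul_cancel₀ (mul_ne_zero h.a_pos.ne' h.p_pos.ne')

theorem inv_mul_self_left (h : BigQJacobiParams a b c p) : (c * p)⁻¹ * (c * p) = 1 :=
  inv_mul_cancel₀ (mul_ne_zero h.c_neg.ne h.p_pos.ne')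

theorem isPearson_functional (h : BigQJacobiParams a b c p) : IsPearson a b c p h.functional := by
  intro f
  have hp0 := h.p_pos.le
  have hstep : ∀ x ∈ bigLattice a c p, x * ((pearsonOp a b c p f).eval x * h.weight x) =
      f.eval x * pochWeight p (a * p)⁻¹ (c * p)⁻¹ 1 (b * c⁻¹) x -
        f.eval (p * x) * pochWeight p (a * p)⁻¹ (c * p)⁻¹ 1 (b * c⁻¹) (p * x) := fun x hx => by
    have h1 := congrArg (eval x) (X_mul_pearsonOp a b c p f)
    simp only [eval_mul, eval_X, eval_sub, eval_comp, eval_C, eval_pearsonNum,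
      eval_pearsonDen] at h1
    rw [pochWeight_eq_mul hp0 h.p_lt, pochWeight_mul hp0 h.p_lt _ _ (h.lt_one_of_mem hx).1.ne
      (h.lt_one_of_mem hx).2.ne, weight]
    linear_combination pochWeight p ((a * p)⁻¹ * p) ((c * p)⁻¹ * p) 1 (b * c⁻¹) x * h1
  refine jackson_pearson_eq_zero hp0 h.p_lt
    (fun x => eval_mul_converges hp0 h.p_lt h.tendsto_weight _ x)
    ((f.continuous.tendsto 0).mul (tendsto_pochWeight hp0 h.p_lt _ _ _ _))
    (fun k => hstep _ (h.mul_pow_mem h.left_mem k))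
    (fun k => hstep _ (h.mul_pow_mem h.right_mem k)) ?_ ?_
  · rw [pochWeight_eq_zero hp0 h.p_lt (Or.inr h.inv_mul_self_left), mul_zero]
  · rw [pochWeight_eq_zero hp0 h.p_lt (Or.inl h.inv_mul_self_right), mul_zero]

end BigQJacobiParams

/-- The points `β p^k` split into even and odd `k`; the factor `1 + p` is the ratio of the
normalizations `1 - p²` and `1 - p`. -/
theorem jackson_sq {p lo hi : ℝ} {g : ℝ → ℝ} (hp0 : 0 ≤ p) (hp1 : p < 1)
    (hg : ∀ β, ConvergesAlong (p ^ 2) β g) :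
    jackson (p ^ 2) lo hi g + jackson (p ^ 2) lo hi (fun y => p * g (p * y)) =
      (1 + p) * jackson p lo hi g := by
  have hq0 : 0 ≤ p ^ 2 := sq_nonneg p
  have hq1 : p ^ 2 < 1 := by nlinarith
  have key : ∀ β, jacksonZero (p ^ 2) β g + jacksonZero (p ^ 2) β (fun y => p * g (p * y)) =
      (1 + p) * jacksonZero p β g := fun β => by
    have e1 : ∀ k : ℕ, β * p ^ (2 * k) * g (β * p ^ (2 * k)) =
        β * (p ^ 2) ^ k * g (β * (p ^ 2) ^ k) := fun k => by rw [pow_mul]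
    have e2 : ∀ k : ℕ, β * p ^ (2 * k + 1) * g (β * p ^ (2 * k + 1)) =
        β * (p ^ 2) ^ k * (p * g (p * (β * (p ^ 2) ^ k))) := fun k => by
      rw [pow_succ, pow_mul, show β * ((p ^ 2) ^ k * p) = p * (β * (p ^ 2) ^ k) by ring]; ring
    have e3 : Summable fun k : ℕ => β * (p ^ 2) ^ k * (p * g (p * (β * (p ^ 2) ^ k))) := by
      refine (((hg (p * β)).summable hq0 hq1)).congr fun k => ?_
      rw [show p * β * (p ^ 2) ^ k = p * (β * (p ^ 2) ^ k) by ring]; ring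
    have h := tsum_even_add_odd (f := fun k : ℕ => β * p ^ k * g (β * p ^ k))
      (((hg β).summable hq0 hq1).congr fun k => (e1 k).symm) (e3.congr fun k => (e2 k).symm)
    simp only [e1, e2] at h
    simp only [jacksonZero]
    rw [← h]
    ring
  rw [jackson, jackson, jackson, mul_sub, ← key, ← key]
  ring

/-! ### The skew weight and the identity linking the skew form to the functional. -/

namespace BigQJacobiParams

variable {a b c p : ℝ}

/-- The skew weight, with base `p ^ 2`. -/
noncomputable def skewWeight (_ : BigQJacobiParams a b c p) : ℝ → ℝ :=
  pochWeight (p ^ 2) ((a * p)⁻¹ * p ^ 2) ((c * p)⁻¹ * p ^ 2) 1 (b * c⁻¹)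

/-- The skew weight multiplied by the numerator of the Pearson equation. -/
noncomputable def skewWeightNum (_ : BigQJacobiParams a b c p) : ℝ → ℝ :=
  pochWeight (p ^ 2) (a * p)⁻¹ (c * p)⁻¹ 1 (b * c⁻¹)

theorem skewWeight_mul (h : BigQJacobiParams a b c p) (x : ℝ) :
    h.skewWeight x * h.skewWeightNum (p * x) = h.weight x :=
  pochWeight_sq_mul h.p_pos.le h.p_lt _ _ _ _ _

theorem convergesOn_skewWeight (h : BigQJacobiParams a b c p) (f : ℝ[X]) :
    ConvergesOn p (bigLattice a c p) fun x => f.eval x * h.skewWeight x := fun x _ =>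
  eval_mul_converges h.isJacksonDomain.sq_nonneg h.isJacksonDomain.sq_lt
    (tendsto_pochWeight h.isJacksonDomain.sq_nonneg h.isJacksonDomain.sq_lt _ _ _ _) f x

theorem tendsto_skewWeightNum (h : BigQJacobiParams a b c p) (f : ℝ[X]) (β : ℝ) :
    Tendsto (fun k : ℕ => (f.comp (C p⁻¹ * X)).eval (β * (p ^ 2) ^ k) *
      h.skewWeightNum (β * (p ^ 2) ^ k)) atTop (𝓝 ((f.comp (C p⁻¹ * X)).eval 0 * 1)) := by
  have hD := h.isJacksonDomain
  exact (((f.comp (C p⁻¹ * X)).continuous.tendsto 0).mul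
    (tendsto_pochWeight hD.sq_nonneg hD.sq_lt _ _ _ _)).comp
    (tendsto_mul_pow_atTop hD.sq_nonneg hD.sq_lt β)

/-- `skewOp` is built for this: with `F(x) = f(x/p)` times `skewWeightNum`, the values `F(x)` and
`F(p²x)` carry `num(x) f(x/p)` and `den(x) f(px)` respectively, times the same weight. -/
theorem skewOp_mul_skewWeight (h : BigQJacobiParams a b c p) (f : ℝ[X]) {x : ℝ}
    (hx : x ∈ bigLattice a c p) :
    x * ((skewOp a b c p f).eval x * h.skewWeight x) =
      (f.comp (C p⁻¹ * X)).eval x * h.skewWeightNum x -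
        (f.comp (C p⁻¹ * X)).eval (x * p ^ 2) * h.skewWeightNum (x * p ^ 2) := by
  have hD := h.isJacksonDomain
  have h1 := congrArg (eval x) (X_mul_skewOp a b c p f)
  have hp := h.p_pos.ne'
  rw [mul_comm x (p ^ 2), skewWeightNum, pochWeight_eq_mul hD.sq_nonneg hD.sq_lt,
    pochWeight_mul hD.sq_nonneg hD.sq_lt _ _ (h.lt_one_of_mem hx).1.ne (h.lt_one_of_mem hx).2.ne,
    skewWeight]
  simp only [eval_mul, eval_X, eval_sub, eval_comp, eval_C, eval_pearsonNum,
    eval_pearsonDen] at h1 ⊢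
  rw [show p⁻¹ * (p ^ 2 * x) = p * x by field_simp]
  linear_combination pochWeight (p ^ 2) ((a * p)⁻¹ * p ^ 2) ((c * p)⁻¹ * p ^ 2) 1 (b * c⁻¹) x * h1

theorem skewWeightNum_left (h : BigQJacobiParams a b c p) : h.skewWeightNum (c * p) = 0 :=
  pochWeight_eq_zero h.isJacksonDomain.sq_nonneg h.isJacksonDomain.sq_lt
    (Or.inr h.inv_mul_self_left)

theorem skewWeightNum_right (h : BigQJacobiParams a b c p) : h.skewWeightNum (a * p) = 0 :=
  pochWeight_eq_zero h.isJacksonDomain.sq_nonneg h.isJacksonDomain.sq_lt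
    (Or.inl h.inv_mul_self_right)

theorem jackson_skewOp (h : BigQJacobiParams a b c p) (f : ℝ[X]) {y : ℝ}
    (hy : y ∈ bigLattice a c p) :
    jackson (p ^ 2) (c * p) y (fun x => (skewOp a b c p f).eval x * h.skewWeight x) =
      (1 - p ^ 2) * ((f.comp (C p⁻¹ * X)).eval y * h.skewWeightNum y) := by
  have hD := h.isJacksonDomain
  have key : ∀ β ∈ bigLattice a c p,
      jacksonZero (p ^ 2) β (fun x => (skewOp a b c p f).eval x * h.skewWeight x) =
      (1 - p ^ 2) * ((f.comp (C p⁻¹ * X)).eval β * h.skewWeightNum β) -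
        (1 - p ^ 2) * ((f.comp (C p⁻¹ * X)).eval 0 * 1) := fun β hβ => by
    have := jacksonZero_of_telescope hD.sq_nonneg hD.sq_lt (h.convergesOn_skewWeight _ β hβ)
      (G := fun k => (1 - p ^ 2) * ((f.comp (C p⁻¹ * X)).eval (β * (p ^ 2) ^ k) *
        h.skewWeightNum (β * (p ^ 2) ^ k))) (fun k => by
          rw [h.skewOp_mul_skewWeight f (hD.mul_pow_mem hβ k), pow_succ (p ^ 2), ← mul_assoc β]
          ring) ((h.tendsto_skewWeightNum f β).const_mul _)
    simpa only [pow_zero, mul_one] using this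
  rw [jackson, key y hy, key _ h.left_mem, h.skewWeightNum_left]
  ring

/-- The inner integral telescopes to a value at `p y`, where `f(x/p)` becomes `f(y)`. The outer
weight at `y` completes it to the base `p` weight, giving the even lattice points. -/
theorem jacksonPair_skewOp_right (h : BigQJacobiParams a b c p) (f g : ℝ[X]) :
    jacksonPair p (c * p) (a * p) (fun x => g.eval x * h.skewWeight x)
        (fun x => (skewOp a b c p f).eval x * h.skewWeight x) =
      (1 - p ^ 2) * jackson (p ^ 2) (c * p) (a * p) fun x => (f * g).eval x * h.weight x := by
  have hD := h.isJacksonDomain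
  have key : ∀ y ∈ bigLattice a c p, g.eval y * h.skewWeight y * jackson (p ^ 2) (c * p) (p * y)
      (fun x => (skewOp a b c p f).eval x * h.skewWeight x) =
      (1 - p ^ 2) * ((f * g).eval y * h.weight y) := fun y hy => by
    rw [h.jackson_skewOp f (hD.mul_mem y hy), ← h.skewWeight_mul, eval_comp, eval_mul, eval_mul,
      eval_C, eval_X, ← mul_assoc p⁻¹, inv_mul_cancel₀ h.p_pos.ne', one_mul]
    ring
  rw [← jackson_const_mul, jacksonPair]
  exact jackson_congr (fun k => key _ (hD.mul_pow_mem h.right_mem k))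
    (fun k => key _ (hD.mul_pow_mem h.left_mem k))

theorem eval_mul_weight_converges (h : BigQJacobiParams a b c p) (f : ℝ[X]) (β : ℝ) :
    ConvergesAlong (p ^ 2) β fun x => f.eval x * h.weight x :=
  eval_mul_converges h.isJacksonDomain.sq_nonneg h.isJacksonDomain.sq_lt h.tendsto_weight f β

theorem eval_mul_weight_converges_mul (h : BigQJacobiParams a b c p) (f : ℝ[X]) (β : ℝ) :
    ConvergesAlong (p ^ 2) β fun x => p * (f.eval (p * x) * h.weight (p * x)) := by
  obtain ⟨l, hl⟩ := h.eval_mul_weight_converges f (p * β)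
  exact ConvergesAlong.const_mul p ⟨l, by simpa only [mul_assoc] using hl⟩

/-- Here the exact difference sits in the outer variable, so summation by parts transfers it to the
inner integral `Ψ`. The boundary terms vanish at `ap` and `cp`, and the remaining sum runs over the
points `p y`, the odd part of the lattice. -/
theorem jacksonPair_skewOp_left (h : BigQJacobiParams a b c p) (f g : ℝ[X]) :
    jacksonPair p (c * p) (a * p) (fun x => (skewOp a b c p f).eval x * h.skewWeight x)
        (fun x => g.eval x * h.skewWeight x) =
      -((1 - p ^ 2) * jackson (p ^ 2) (c * p) (a * p)
        fun x => p * ((f * g).eval (p * x) * h.weight (p * x))) := by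
  have hD := h.isJacksonDomain
  set Ψ : ℝ → ℝ := fun y => jackson (p ^ 2) (c * p) (p * y) fun x => g.eval x * h.skewWeight x
    with hΨ
  set F : ℝ → ℝ := fun y => (f.comp (C p⁻¹ * X)).eval y * h.skewWeightNum y with hF
  set G : ℝ → ℝ := fun x => p * ((f * g).eval (p * x) * h.weight (p * x)) with hG
  -- `T` is the outer integrand plus the claimed correction, arranged so that `y T(y)` is the
  -- `p²`-difference of `F Ψ`.
  set T : ℝ → ℝ := fun y => (skewOp a b c p f).eval y * h.skewWeight y * Ψ y + (1 - p ^ 2) * G y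
    with hT
  have c1 : ConvergesOn p (bigLattice a c p) fun y =>
      (skewOp a b c p f).eval y * h.skewWeight y * Ψ y :=
    IsJacksonDomain.convergesOn_mul_jackson (h.convergesOn_skewWeight _)
  have c2 : ∀ β, ConvergesAlong (p ^ 2) β fun y => (1 - p ^ 2) * G y := fun β =>
    (h.eval_mul_weight_converges_mul (f * g) β).const_mul _
  have hstep : ∀ y ∈ bigLattice a c p, (1 - p ^ 2) * (y * T y) =
      (1 - p ^ 2) * (F y * Ψ y) - (1 - p ^ 2) * (F (y * p ^ 2) * Ψ (y * p ^ 2)) := fun y hy => by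
    have e1 : y * ((skewOp a b c p f).eval y * h.skewWeight y) = F y - F (y * p ^ 2) :=
      h.skewOp_mul_skewWeight f hy
    have e2 : Ψ y - Ψ (y * p ^ 2) =
        (1 - p ^ 2) * (p * y) * (g.eval (p * y) * h.skewWeight (p * y)) := by
      simp only [hΨ, ← mul_assoc p y]
      exact jackson_sub_mul hD.sq_nonneg hD.sq_lt (h.convergesOn_skewWeight g _ (hD.mul_mem y hy))
    have e3 : F (y * p ^ 2) * h.skewWeight (p * y) = f.eval (p * y) * h.weight (p * y) := by
      rw [← h.skewWeight_mul]
      simp only [hF, eval_comp, eval_mul, eval_C, eval_X]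
      rw [show p⁻¹ * (y * p ^ 2) = p * y by field_simp [h.p_pos.ne'],
        show y * p ^ 2 = p * (p * y) by ring]
      ring
    simp only [hT, hG, eval_mul]
    linear_combination (1 - p ^ 2) * Ψ y * e1 - (1 - p ^ 2) * F (y * p ^ 2) * e2 -
      (1 - p ^ 2) * (1 - p ^ 2) * p * y * g.eval (p * y) * e3
  -- The limit at `0` does not involve `β`, so the contributions of the two end points cancel.
  have key : ∀ β ∈ bigLattice a c p, F β = 0 → jacksonZero (p ^ 2) β T =
      -((1 - p ^ 2) * ((f.comp (C p⁻¹ * X)).eval 0 * 1 *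
        -jacksonZero (p ^ 2) (c * p) fun x => g.eval x * h.skewWeight x)) := fun β hβ hFβ => by
    have := jacksonZero_of_telescope (f := T) hD.sq_nonneg hD.sq_lt
      ⟨_, (c1 β hβ).choose_spec.add (c2 β).choose_spec⟩
      (G := fun k => (1 - p ^ 2) * (F (β * (p ^ 2) ^ k) * Ψ (β * (p ^ 2) ^ k))) (fun k => by
        rw [hstep _ (hD.mul_pow_mem hβ k), pow_succ (p ^ 2), ← mul_assoc β])
      (((h.tendsto_skewWeightNum f β).mul (by
        simpa only [hΨ, mul_assoc] using tendsto_jackson (p ^ 2) (c * p) (p * β) fun x =>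
          g.eval x * h.skewWeight x)).const_mul _)
    simpa [hFβ] using this
  have hsum : jackson (p ^ 2) (c * p) (a * p) T = 0 := by
    rw [jackson, key _ h.right_mem (by simp only [hF, h.skewWeightNum_right, mul_zero]),
      key _ h.left_mem (by simp only [hF, h.skewWeightNum_left, mul_zero]), sub_self]
  have hadd := (hD.integrable c1 h.right_mem).jackson_add
    (hD.integrable (fun β _ => c2 β) h.right_mem)
  rw [jackson_const_mul] at hadd
  rw [jacksonPair, eq_neg_iff_add_eq_zero, ← hadd]
  exact hsum

/-- The two-fold `q`-integral as a bilinear form on polynomials. -/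
noncomputable def pairForm (h : BigQJacobiParams a b c p) : ℝ[X] →ₗ[ℝ] ℝ[X] →ₗ[ℝ] ℝ :=
  LinearMap.mk₂ ℝ (fun f g => jacksonPair p (c * p) (a * p) (fun x => f.eval x * h.skewWeight x)
      fun x => g.eval x * h.skewWeight x)
    (fun f₁ f₂ g => by
      have hi := fun f => h.isJacksonDomain.integrable (IsJacksonDomain.convergesOn_mul_jackson
        (lo := c * p) (g := fun x => g.eval x * h.skewWeight x) (h.convergesOn_skewWeight f))
        h.right_mem
      simp only [jacksonPair, eval_add, add_mul]
      exact (hi f₁).jackson_add (hi f₂))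
    (fun r f g => by
      simp only [jacksonPair, eval_smul, smul_eq_mul, mul_assoc]
      exact jackson_const_mul _ _ _ _ _)
    (fun f g₁ g₂ => by
      have hi := fun g : ℝ[X] => h.isJacksonDomain.integrable
        (IsJacksonDomain.convergesOn_mul_jackson (lo := c * p)
          (g := fun x => g.eval x * h.skewWeight x) (h.convergesOn_skewWeight f)) h.right_mem
      rw [jacksonPair, jacksonPair, jacksonPair, ← (hi g₁).jackson_add (hi g₂)]
      have key : ∀ y ∈ bigLattice a c p, jackson (p ^ 2) (c * p) (p * y)
          (fun x => (g₁ + g₂).eval x * h.skewWeight x) =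
          jackson (p ^ 2) (c * p) (p * y) (fun x => g₁.eval x * h.skewWeight x) +
          jackson (p ^ 2) (c * p) (p * y) (fun x => g₂.eval x * h.skewWeight x) := fun y hy => by
        simp only [eval_add, add_mul]
        have hy' := h.isJacksonDomain.mul_mem y hy
        exact (h.isJacksonDomain.integrable (h.convergesOn_skewWeight g₁) hy').jackson_add
          (h.isJacksonDomain.integrable (h.convergesOn_skewWeight g₂) hy')
      refine jackson_congr (fun k => ?_) (fun k => ?_)
      · rw [key _ (h.isJacksonDomain.mul_pow_mem h.right_mem k), mul_add]
      · rw [key _ (h.isJacksonDomain.mul_pow_mem h.left_mem k), mul_add])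
    (fun r f g => by
      simp only [jacksonPair, eval_smul, smul_eq_mul, mul_assoc, jackson_const_mul]
      rw [← jackson_const_mul]
      congr 1
      funext x
      ring)

/-- The skew inner product as a bilinear form on polynomials. -/
noncomputable def skewForm (h : BigQJacobiParams a b c p) : ℝ[X] →ₗ[ℝ] ℝ[X] →ₗ[ℝ] ℝ :=
  h.pairForm.flip - h.pairForm

theorem skewInner_eq_skewForm (h : BigQJacobiParams a b c p) (f g : ℝ[X]) :
    SkewInnerConverges (p ^ 2) (c * p) (a * p) h.skewWeight (fun x => f.eval x)
        (fun x => g.eval x) ∧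
      skewInner (p ^ 2) (c * p) (a * p) h.skewWeight (fun x => f.eval x) (fun x => g.eval x) =
        h.skewForm f g :=
  h.isJacksonDomain.skewInner_eq (h.convergesOn_skewWeight f) (h.convergesOn_skewWeight g)
    h.right_mem

theorem skewForm_self (h : BigQJacobiParams a b c p) (f : ℝ[X]) : h.skewForm f f = 0 :=
  sub_self (h.pairForm f f)

/-- The two halves of the skew form give the even and the odd points, which `jackson_sq` joins into
one integral in base `p`. -/
theorem skewForm_skewOp (h : BigQJacobiParams a b c p) (f g : ℝ[X]) :
    h.skewForm (skewOp a b c p f) g = (1 - p ^ 2) * (1 + p) * h.functional (f * g) := by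
  have h1 : h.skewForm (skewOp a b c p f) g =
      jacksonPair p (c * p) (a * p) (fun x => g.eval x * h.skewWeight x)
        (fun x => (skewOp a b c p f).eval x * h.skewWeight x) -
      jacksonPair p (c * p) (a * p) (fun x => (skewOp a b c p f).eval x * h.skewWeight x)
        (fun x => g.eval x * h.skewWeight x) := rfl
  rw [h1, h.jacksonPair_skewOp_right, h.jacksonPair_skewOp_left, sub_neg_eq_add, ← mul_add,
    h.functional_apply, mul_assoc, ← jackson_sq h.p_pos.le h.p_lt
      (h.eval_mul_weight_converges (f * g))]

end BigQJacobiParams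

/-! ### Evaluation of the total mass. -/

theorem one_le_qPoch {x q : ℝ} (hq0 : 0 ≤ q) (hx : x ≤ 0) (n : ℕ) : 1 ≤ qPoch x q n :=
  Finset.one_le_prod fun i _ => by
    have := mul_nonpos_of_nonpos_of_nonneg hx (pow_nonneg hq0 i)
    linarith

theorem one_le_qPochInf {x q : ℝ} (hq0 : 0 ≤ q) (hq1 : q < 1) (hx : x ≤ 0) : 1 ≤ qPochInf x q :=
  ge_of_tendsto (tendsto_qPoch hq0 hq1 x) (Eventually.of_forall (one_le_qPoch hq0 hx))

theorem one_sub_le_qPoch_succ {x q : ℝ} (hq0 : 0 ≤ q) (hx : x ≤ 0) (n : ℕ) :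
    1 - x ≤ qPoch x q (n + 1) := by
  rw [qPoch_succ']
  exact le_mul_of_one_le_right (by linarith)
    (one_le_qPoch hq0 (mul_nonpos_of_nonpos_of_nonneg hx hq0) n)

theorem abs_qPochInf_le {q : ℝ} (hq0 : 0 ≤ q) (hq1 : q < 1) (x : ℝ) :
    |qPochInf x q| ≤ Real.exp (|x| * (1 - q)⁻¹) :=
  le_of_tendsto (tendsto_qPoch hq0 hq1 x).abs (Eventually.of_forall (abs_qPoch_le hq0 hq1 x))

theorem abs_qPochInf_pow_le {q : ℝ} (hq0 : 0 ≤ q) (hq1 : q < 1) (n : ℕ) :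
    |qPochInf (q ^ n) q| ≤ Real.exp ((1 - q)⁻¹) := by
  refine (abs_qPochInf_le hq0 hq1 _).trans (Real.exp_le_exp.mpr ?_)
  rw [abs_of_nonneg (pow_nonneg hq0 n)]
  exact mul_le_of_le_one_left (inv_nonneg.mpr (by linarith)) (pow_le_one₀ hq0 hq1.le)

section ThetaIntegral

variable {a c p : ℝ}

/-- The `q`-integral of `(x/a, x/c; p)_∞`. -/
noncomputable def thetaIntegral (a c p : ℝ) : ℝ :=
  jackson p (c * p) (a * p) (pochWeight p a⁻¹ c⁻¹ 0 0)

theorem pochWeight_zero_zero (r A C x : ℝ) :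
    pochWeight r A C 0 0 x = qPochInf (A * x) r * qPochInf (C * x) r := by
  simp [pochWeight, qPochInf_zero]

/-- The combination `V + (a/c) W`, with `V` the integrand for `cp` and `W` that for `c`, is the
Pearson term of the constant `-(a p)`, so its integral vanishes. -/
theorem thetaIntegral_mul (hp0 : 0 < p) (hp1 : p < 1) (ha : a ≠ 0) (hc : c ≠ 0) :
    thetaIntegral a (c * p) p = -(a * c⁻¹) * thetaIntegral a c p := by
  have hp := hp0.ne'
  set W := pochWeight p a⁻¹ c⁻¹ 0 0 with hW
  set V := pochWeight p a⁻¹ (c * p)⁻¹ 0 0 with hV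
  have conv : ∀ A C β, ConvergesAlong p β (pochWeight p A C 0 0) := fun A C β =>
    .of_tendsto hp0.le hp1 (tendsto_pochWeight hp0.le hp1 A C 0 0)
  have hVW : ∀ x, V x = (1 - (c * p)⁻¹ * x) * W x := fun x => by
    rw [hV, hW, pochWeight_zero_zero, pochWeight_zero_zero,
      qPochInf_eq_one_sub_mul hp0.le hp1 ((c * p)⁻¹ * x),
      show (c * p)⁻¹ * x * p = c⁻¹ * x by field_simp]
    ring
  have hV0 : V (c * p) = 0 := by
    rw [hVW, inv_mul_cancel₀ (mul_ne_zero hc hp)]; ring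
  have h1 : thetaIntegral a (c * p) p = jackson p (c * p) (a * p) V := by
    -- The lower limits `c p` and `c p²` differ by the single term at `c p`, where `V` is zero.
    have h2 := jacksonZero_sub_mul hp0.le hp1 (conv a⁻¹ (c * p)⁻¹ (c * p))
    rw [← hV, hV0, mul_zero, sub_eq_zero] at h2
    rw [thetaIntegral, jackson, jackson, h2]
  have hcW : ∀ r β, ConvergesAlong p β fun x => r * W x := fun r β => (conv _ _ β).const_mul r
  have hzero : jackson p (c * p) (a * p) (fun x => V x - -(a * c⁻¹) * W x) = 0 := by
    have hstep : ∀ x : ℝ, x * (V x - -(a * c⁻¹) * W x) =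
        -(a * p) * pochWeight p (a * p)⁻¹ (c * p)⁻¹ 0 0 x -
        -(a * p) * pochWeight p (a * p)⁻¹ (c * p)⁻¹ 0 0 (p * x) := fun x => by
      rw [pochWeight_eq_mul hp0.le hp1, pochWeight_mul hp0.le hp1 _ _ (by simp) (by simp), hVW,
        show (a * p)⁻¹ * p = a⁻¹ by field_simp, show (c * p)⁻¹ * p = c⁻¹ by field_simp, ← hW]
      field_simp
      ring
    refine jackson_pearson_eq_zero hp0.le hp1 (fun β => (conv _ _ β).sub (hcW _ β))
      ((tendsto_pochWeight hp0.le hp1 (a * p)⁻¹ (c * p)⁻¹ 0 0).const_mul (-(a * p)))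
      (fun k => hstep _) (fun k => hstep _) ?_ ?_
    · rw [pochWeight_eq_zero hp0.le hp1 (Or.inr (inv_mul_cancel₀ (mul_ne_zero hc hp))), mul_zero]
    · rw [pochWeight_eq_zero hp0.le hp1 (Or.inl (inv_mul_cancel₀ (mul_ne_zero ha hp))), mul_zero]
  rw [JacksonIntegrable.jackson_sub
    ((conv _ _ _).jacksonIntegrable hp0.le hp1 (conv _ _ _))
    ((hcW _ _).jacksonIntegrable hp0.le hp1 (hcW _ _)), jackson_const_mul, sub_eq_zero] at hzero
  rw [h1, hzero, thetaIntegral]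

theorem thetaProd_mul (hp0 : 0 ≤ p) (hp1 : p < 1) (hp : p ≠ 0) (ha : 0 < a) (hc : c < 0) :
    qPochInf (a⁻¹ * (c * p)) p * qPochInf (a * (c * p)⁻¹ * p) p =
      -(a * c⁻¹) * (qPochInf (a⁻¹ * c) p * qPochInf (a * c⁻¹ * p) p) := by
  have hc' := hc.ne
  rw [qPochInf_eq_one_sub_mul hp0 hp1 (a⁻¹ * c), show a * (c * p)⁻¹ * p = a * c⁻¹ by field_simp,
    qPochInf_eq_one_sub_mul hp0 hp1 (a * c⁻¹), ← mul_assoc a⁻¹]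
  field_simp
  ring

/-- After division by the theta product, the `j`-th term carries `1 / (a p / y; p)_j`. As `y → 0`
from below its argument tends to `-∞`, so only `j = 0` survives; the terms are dominated by a
geometric series. -/
theorem tendsto_thetaIntegral_right (hp0 : 0 < p) (hp1 : p < 1) (ha : 0 < a) {y : ℕ → ℝ}
    (hy : ∀ k, y k < 0) (hy0 : Tendsto y atTop (𝓝 0)) :
    Tendsto (fun k => jacksonZero p (a * p) (pochWeight p a⁻¹ (y k)⁻¹ 0 0) /
      (qPochInf (a⁻¹ * y k) p * qPochInf (a * (y k)⁻¹ * p) p)) atTop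
      (𝓝 ((1 - p) * (a * p * qPochInf p p))) := by
  have hyn : ∀ k, a * (y k)⁻¹ * p < 0 := fun k =>
    mul_neg_of_neg_of_pos (mul_neg_of_pos_of_neg ha (inv_lt_zero.mpr (hy k))) hp0
  have hfac : ∀ k, jacksonZero p (a * p) (pochWeight p a⁻¹ (y k)⁻¹ 0 0) /
      (qPochInf (a⁻¹ * y k) p * qPochInf (a * (y k)⁻¹ * p) p) = (1 - p) *
      (∑' j : ℕ, a * p * p ^ j * qPochInf (p ^ (j + 1)) p * (qPoch (a * (y k)⁻¹ * p) p j)⁻¹) /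
      qPochInf (a⁻¹ * y k) p := fun k => by
    have h1 : qPochInf (a * (y k)⁻¹ * p) p ≠ 0 :=
      (zero_lt_one.trans_le (one_le_qPochInf hp0.le hp1 (hyn k).le)).ne'
    rw [mul_comm (qPochInf _ _), ← div_div, jacksonZero, mul_div_assoc, ← tsum_div_const]
    congr 2
    refine tsum_congr fun j => ?_
    have h2 := (zero_lt_one.trans_le (one_le_qPoch hp0.le (hyn k).le j)).ne'
    rw [pochWeight_zero_zero, show a⁻¹ * (a * p * p ^ j) = p ^ (j + 1) by field_simp; ring,
      show (y k)⁻¹ * (a * p * p ^ j) = a * (y k)⁻¹ * p * p ^ j by ring, div_eq_iff h1,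
      qPochInf_eq_mul hp0.le hp1 (a * (y k)⁻¹ * p) j]
    generalize qPoch (a * (y k)⁻¹ * p) p j = u at h2
    field_simp
  simp only [hfac]
  have hden : Tendsto (fun k => qPochInf (a⁻¹ * y k) p) atTop (𝓝 1) :=
    (tendsto_qPochInf_mul hp0.le hp1 a⁻¹).comp hy0
  have hlim : Tendsto (fun k => ∑' j : ℕ,
      a * p * p ^ j * qPochInf (p ^ (j + 1)) p * (qPoch (a * (y k)⁻¹ * p) p j)⁻¹) atTop
      (𝓝 (∑' j : ℕ, if j = 0 then a * p * qPochInf p p else 0)) := by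
    refine tendsto_tsum_of_dominated_convergence
      (bound := fun j => a * p * Real.exp ((1 - p)⁻¹) * p ^ j)
      (summable_mul_pow hp0.le hp1 _) (fun j => ?_) (Eventually.of_forall fun k j => ?_)
    · rcases j with _ | j
      · simp [qPoch_zero]
      · simp only [Nat.add_eq_zero_iff, one_ne_zero, and_false, if_false]
        have hinv : Tendsto (fun k => (1 - a * (y k)⁻¹ * p)⁻¹) atTop (𝓝 0) := by
          have h3 : Tendsto (fun k => y k / (y k - a * p)) atTop (𝓝 (0 / (0 - a * p))) :=
            hy0.div (hy0.sub_const _) (by simp [ha.ne', hp0.ne'])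
          rw [zero_div] at h3
          refine h3.congr fun k => ?_
          have := (hy k).ne
          field_simp
        have hz : Tendsto (fun k => (qPoch (a * (y k)⁻¹ * p) p (j + 1))⁻¹) atTop (𝓝 0) :=
          squeeze_zero (fun k => inv_nonneg.mpr
            (zero_le_one.trans (one_le_qPoch hp0.le (hyn k).le _)))
            (fun k => inv_anti₀ (by linarith [hyn k])
              (one_sub_le_qPoch_succ hp0.le (hyn k).le j)) hinv
        simpa only [mul_zero] using
          hz.const_mul (a * p * p ^ (j + 1) * qPochInf (p ^ (j + 1 + 1)) p)
    · have h4 := one_le_qPoch hp0.le (hyn k).le j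
      rw [Real.norm_eq_abs, abs_mul, abs_mul, abs_inv, abs_of_pos (zero_lt_one.trans_le h4),
        abs_of_pos (by positivity : 0 < a * p * p ^ j)]
      calc a * p * p ^ j * |qPochInf (p ^ (j + 1)) p| * (qPoch (a * (y k)⁻¹ * p) p j)⁻¹
          ≤ a * p * p ^ j * Real.exp ((1 - p)⁻¹) * 1 := by
            gcongr
            · exact abs_qPochInf_pow_le hp0.le hp1 _
            · exact inv_le_one_of_one_le₀ h4
        _ = _ := by ring
  rw [tsum_ite_eq] at hlim
  have h := (hlim.const_mul (1 - p)).div hden one_ne_zero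
  rw [div_one] at h
  exact h

/-- Every term carries a factor `y`, and what remains is bounded by a fixed geometric series because
products at nonpositive arguments are at least `1`. -/
theorem tendsto_thetaIntegral_left (hp0 : 0 < p) (hp1 : p < 1) (ha : 0 < a) {y : ℕ → ℝ}
    (hy : ∀ k, y k < 0) (hy0 : Tendsto y atTop (𝓝 0)) :
    Tendsto (fun k => jacksonZero p (y k * p) (pochWeight p a⁻¹ (y k)⁻¹ 0 0) /
      (qPochInf (a⁻¹ * y k) p * qPochInf (a * (y k)⁻¹ * p) p)) atTop (𝓝 0) := by
  have hyn : ∀ k, a * (y k)⁻¹ * p ≤ 0 := fun k =>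
    (mul_neg_of_neg_of_pos (mul_neg_of_pos_of_neg ha (inv_lt_zero.mpr (hy k))) hp0).le
  have hyn' : ∀ k, a⁻¹ * y k ≤ 0 := fun k =>
    (mul_neg_of_pos_of_neg (inv_pos.mpr ha) (hy k)).le
  have hK := hy0.abs.mul_const ((1 - p) * ∑' j : ℕ, p * Real.exp ((1 - p)⁻¹) * p ^ j)
  rw [abs_zero, zero_mul] at hK
  refine squeeze_zero_norm (fun k => ?_) hK
  have h1 := one_le_qPochInf hp0.le hp1 (hyn k)
  have h2 := one_le_qPochInf hp0.le hp1 (hyn' k)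
  have hp1' : 0 < 1 - p := by linarith
  rw [jacksonZero, mul_div_assoc, ← tsum_div_const, norm_mul, Real.norm_of_nonneg hp1'.le,
    mul_left_comm, ← tsum_mul_left]
  refine mul_le_mul_of_nonneg_left (tsum_of_norm_bounded
    ((summable_mul_pow hp0.le hp1 _).mul_left _).hasSum fun j => ?_) hp1'.le
  have h3 := one_le_qPoch hp0.le (hyn' k) (j + 1)
  have h4 : y k * p * p ^ j * pochWeight p a⁻¹ (y k)⁻¹ 0 0 (y k * p * p ^ j) /
      (qPochInf (a⁻¹ * y k) p * qPochInf (a * (y k)⁻¹ * p) p) =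
      y k * (p * p ^ j * qPochInf (p ^ (j + 1)) p * ((qPoch (a⁻¹ * y k) p (j + 1))⁻¹ *
        (qPochInf (a * (y k)⁻¹ * p) p)⁻¹)) := by
    have h5 := qPochInf_eq_mul hp0.le hp1 (a⁻¹ * y k) (j + 1)
    have h6 : qPochInf (a⁻¹ * y k * p ^ (j + 1)) p ≠ 0 := fun h0 => by
      rw [h5, h0] at h2; norm_num at h2
    have h7 := (hy k).ne
    have h8 := (zero_lt_one.trans_le h3).ne'
    have h9 := (zero_lt_one.trans_le h1).ne'
    rw [pochWeight_zero_zero, show (y k)⁻¹ * (y k * p * p ^ j) = p ^ (j + 1) by field_simp; ring,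
      show a⁻¹ * (y k * p * p ^ j) = a⁻¹ * y k * p ^ (j + 1) by ring, h5]
    generalize qPochInf (a⁻¹ * y k * p ^ (j + 1)) p = u at h6
    field_simp
  rw [h4, norm_mul, Real.norm_eq_abs (y k), norm_mul, norm_mul, norm_mul, norm_mul, norm_inv,
    norm_inv,
    Real.norm_of_nonneg (zero_le_one.trans h3), Real.norm_of_nonneg (zero_le_one.trans h1),
    Real.norm_of_nonneg hp0.le, Real.norm_of_nonneg (pow_nonneg hp0.le j)]
  refine mul_le_mul_of_nonneg_left ?_ (abs_nonneg _)
  calc p * p ^ j * ‖qPochInf (p ^ (j + 1)) p‖ * ((qPoch (a⁻¹ * y k) p (j + 1))⁻¹ *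
        (qPochInf (a * (y k)⁻¹ * p) p)⁻¹) ≤ p * p ^ j * Real.exp ((1 - p)⁻¹) * (1 * 1) := by
        gcongr
        · exact abs_qPochInf_pow_le hp0.le hp1 _
        · exact inv_le_one_of_one_le₀ h3
        · exact inv_le_one_of_one_le₀ h1
    _ = _ := by ring

/-- The integral and the theta product acquire the same factor under `c ↦ c p`, so their quotient is
constant along `c p^k` and equals its limit. -/
theorem thetaIntegral_eq (hp0 : 0 < p) (hp1 : p < 1) (ha : 0 < a) (hc : c < 0) :
    thetaIntegral a c p = (1 - p) * (a * p * qPochInf p p) *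
      (qPochInf (a⁻¹ * c) p * qPochInf (a * c⁻¹ * p) p) := by
  have hck : ∀ k : ℕ, c * p ^ k < 0 := fun k => mul_neg_of_neg_of_pos hc (pow_pos hp0 k)
  have hne : ∀ y < 0, qPochInf (a⁻¹ * y) p * qPochInf (a * y⁻¹ * p) p ≠ 0 := fun y hy => by
    have h1 := one_le_qPochInf hp0.le hp1 (mul_neg_of_pos_of_neg (inv_pos.mpr ha) hy).le
    have h2 := one_le_qPochInf hp0.le hp1 (mul_neg_of_neg_of_pos
      (mul_neg_of_pos_of_neg ha (inv_lt_zero.mpr hy)) hp0).le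
    positivity
  have hconst : ∀ k : ℕ, thetaIntegral a (c * p ^ k) p /
      (qPochInf (a⁻¹ * (c * p ^ k)) p * qPochInf (a * (c * p ^ k)⁻¹ * p) p) =
      thetaIntegral a c p / (qPochInf (a⁻¹ * c) p * qPochInf (a * c⁻¹ * p) p) := fun k => by
    induction k with
    | zero => simp
    | succ k ih =>
      rw [← ih, pow_succ, ← mul_assoc, thetaIntegral_mul hp0 hp1 ha.ne' (hck k).ne,
        thetaProd_mul hp0.le hp1 hp0.ne' ha (hck k), mul_div_mul_left]
      exact neg_ne_zero.mpr (mul_ne_zero ha.ne' (inv_ne_zero (hck k).ne))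
  have hlim := (tendsto_thetaIntegral_right hp0 hp1 ha hck (tendsto_mul_pow_atTop hp0.le hp1 c)).sub
    (tendsto_thetaIntegral_left hp0 hp1 ha hck (tendsto_mul_pow_atTop hp0.le hp1 c))
  rw [sub_zero] at hlim
  simp only [← sub_div] at hlim
  rw [← div_eq_iff (hne c hc)]
  refine tendsto_nhds_unique ?_ hlim
  exact (tendsto_const_nhds (x := thetaIntegral a c p /
    (qPochInf (a⁻¹ * c) p * qPochInf (a * c⁻¹ * p) p))).congr fun k => (hconst k).symm

end ThetaIntegral

namespace BigQJacobiParams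

variable {a b c p : ℝ}

/-- As `k → ∞` the polynomial factors fill up to the denominator of the weight and cancel it,
leaving `(x/a, x/c; p)_∞`. Uniform bounds on `(x;p)_k` justify the limit under the sum. -/
theorem tendsto_jacksonZero_qPochPoly (h : BigQJacobiParams a b c p) {β : ℝ}
    (hβ : β ∈ bigLattice a c p) :
    Tendsto (fun k => jacksonZero p β fun x =>
      (qPochPoly 1 p k * qPochPoly (b * c⁻¹) p k).eval x * h.weight x) atTop
      (𝓝 (jacksonZero p β (pochWeight p a⁻¹ c⁻¹ 0 0))) := by
  have hp := h.p_pos.ne'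
  refine Tendsto.const_mul _ ?_
  have hs := ((ConvergesAlong.of_tendsto h.p_pos.le h.p_lt h.tendsto_weight (β := β)).summable
    h.p_pos.le h.p_lt).norm.mul_left
      (Real.exp (|1 * β| * (1 - p)⁻¹) * Real.exp (|b * c⁻¹ * β| * (1 - p)⁻¹))
  refine tendsto_tsum_of_dominated_convergence hs (fun j => ?_) (Eventually.of_forall fun k j => ?_)
  · have hm := h.lt_one_of_mem (h.mul_pow_mem hβ j)
    set x := β * p ^ j
    have h1 := h.qPochInf_ne hm.1
    have h2 := h.qPochInf_ne hm.2
    have e : pochWeight p a⁻¹ c⁻¹ 0 0 x =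
        qPochInf (1 * x) p * qPochInf (b * c⁻¹ * x) p * h.weight x := by
      rw [pochWeight_zero_zero, weight, pochWeight,
        show (a * p)⁻¹ * p = a⁻¹ by field_simp, show (c * p)⁻¹ * p = c⁻¹ by field_simp, ← mul_div_assoc,
        mul_div_cancel_left₀ _ (mul_ne_zero h1 h2)]
    rw [e]
    simp only [eval_mul, eval_qPochPoly]
    exact (((tendsto_qPoch h.p_pos.le h.p_lt _).mul
      (tendsto_qPoch h.p_pos.le h.p_lt _)).mul_const _).const_mul _
  · have hle : ∀ d : ℝ, |qPoch (d * (β * p ^ j)) p k| ≤ Real.exp (|d * β| * (1 - p)⁻¹) :=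
      fun d => (abs_qPoch_le h.p_pos.le h.p_lt _ k).trans (Real.exp_le_exp.mpr (by
        refine mul_le_mul_of_nonneg_right ?_ (inv_nonneg.mpr (by linarith [h.p_lt]))
        rw [← mul_assoc, abs_mul, abs_of_pos (pow_pos h.p_pos j)]
        exact mul_le_of_le_one_right (abs_nonneg _) (pow_le_one₀ h.p_pos.le h.p_lt.le)))
    beta_reduce
    rw [eval_mul, eval_qPochPoly, eval_qPochPoly, mul_left_comm, norm_mul, norm_mul]
    gcongr
    · exact hle 1
    · exact hle _

theorem qPochInf_mul_thetaIntegral (h : BigQJacobiParams a b c p) :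
    qPochInf (a * b * p ^ 2) p * thetaIntegral a c p =
      qPochInf (a * p) p * qPochInf (c * p) p *
        (qPochInf (a * b * c⁻¹ * p) p * qPochInf (b * p) p) * h.functional 1 := by
  have hP := fun x => tendsto_qPoch h.p_pos.le h.p_lt x
  have hL : Tendsto (fun k => h.functional (qPochPoly 1 p k * qPochPoly (b * c⁻¹) p k)) atTop
      (𝓝 (thetaIntegral a c p)) :=
    (h.tendsto_jacksonZero_qPochPoly h.right_mem).sub (h.tendsto_jacksonZero_qPochPoly h.left_mem)
  have h2 : Tendsto (fun k : ℕ => k + k) atTop atTop :=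
    tendsto_atTop_mono (fun k => Nat.le_add_left k k) tendsto_id
  refine tendsto_nhds_unique (((hP (a * b * p ^ 2)).comp h2).mul hL) ?_
  refine ((((hP (a * p)).mul (hP (c * p))).mul ((hP (a * b * c⁻¹ * p)).mul
    (hP (b * p)))).mul_const (h.functional 1)).congr fun k => ?_
  exact (h.isPearson_functional.map_qPochPoly_mul h.a_pos.ne' h.c_neg.ne h.p_pos.ne' k k).symm

theorem functional_one (h : BigQJacobiParams a b c p) :
    h.functional 1 = (1 - p) * (a * p) * qPochInf (a * b * p ^ 2) p *
      (qPochsInf [p, a⁻¹ * c, a * c⁻¹ * p] p /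
        qPochsInf [a * p, b * p, c * p, a * b * c⁻¹ * p] p) := by
  have h1 := h.qPochInf_mul_thetaIntegral
  have ha := h.qPochInf_ne h.a_lt
  have hb := h.qPochInf_ne h.b_lt
  have hc := h.qPochInf_ne h.c_lt
  have hd := h.qPochInf_ne h.abc_lt
  rw [thetaIntegral_eq h.p_pos h.p_lt h.a_pos h.c_neg] at h1
  simp only [qPochsInf, List.map_cons, List.map_nil, List.prod_cons, List.prod_nil, mul_one]
  rw [← mul_div_assoc, eq_div_iff (by simp [ha, hb, hc, hd])]
  linear_combination -h1

theorem functional_one_ne (h : BigQJacobiParams a b c p) : h.functional 1 ≠ 0 := by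
  have h1 := h.qPochInf_mul_thetaIntegral
  intro h0
  rw [h0, mul_zero, thetaIntegral_eq h.p_pos h.p_lt h.a_pos h.c_neg] at h1
  have e1 := one_le_qPochInf h.p_pos.le h.p_lt
    (mul_neg_of_pos_of_neg (inv_pos.mpr h.a_pos) h.c_neg).le
  have e2 := one_le_qPochInf h.p_pos.le h.p_lt (mul_neg_of_neg_of_pos
      (mul_neg_of_pos_of_neg h.a_pos (inv_lt_zero.mpr h.c_neg)) h.p_pos).le
  have := h.p_lt
  refine mul_ne_zero (h.qPochInf_ne h.ab_lt) (mul_ne_zero (mul_ne_zero (by linarith) (mul_ne_zero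
    (mul_ne_zero h.a_pos.ne' h.p_pos.ne') (h.qPochInf_ne h.p_lt))) (by positivity)) h1

end BigQJacobiParams

/-! ### The Vandermonde determinant, closed forms and assembly. -/

theorem orderedJackson_const_mul (q lo r : ℝ) (n : ℕ) (hi : ℝ) (f : (Fin n → ℝ) → ℝ) :
    orderedJackson q lo n hi (fun z => r * f z) = r * orderedJackson q lo n hi f := by
  induction n generalizing hi with
  | zero => rfl
  | succ n ih => simp only [orderedJackson, ih, jackson_const_mul]

theorem JacksonIntegrable.const_mul {q α β : ℝ} {f : ℝ → ℝ} (h : JacksonIntegrable q α β f)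
    (r : ℝ) : JacksonIntegrable q α β fun x => r * f x :=
  ⟨(h.1.mul_left r).congr fun _ => mul_left_comm _ _ _,
    (h.2.mul_left r).congr fun _ => mul_left_comm _ _ _⟩

theorem OrderedJacksonConverges.const_mul {q lo : ℝ} (r : ℝ) {n : ℕ} {hi : ℝ}
    {f : (Fin n → ℝ) → ℝ} (h : OrderedJacksonConverges q lo n hi f) :
    OrderedJacksonConverges q lo n hi fun z => r * f z := by
  induction n generalizing hi with
  | zero => trivial
  | succ n ih =>
    refine ⟨?_, fun z hz => ih (h.2 z hz)⟩
    simp only [orderedJackson_const_mul]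
    exact h.1.const_mul r

theorem prod_neg_one_pow_reflect (n : ℕ) :
    ∏ i : Fin (2 * n), (-1 : ℝ) ^ (2 * n - 1 - (i : ℕ)) = (-1) ^ n := by
  rw [Fin.prod_univ_eq_prod_range (fun i => (-1 : ℝ) ^ (2 * n - 1 - i)),
    Finset.prod_range_reflect (fun i => (-1 : ℝ) ^ i)]
  induction n with
  | zero => simp
  | succ n ih =>
    rw [show 2 * (n + 1) = 2 * n + 1 + 1 by ring, Finset.prod_range_succ, Finset.prod_range_succ,
      ih, pow_succ _ (2 * n), pow_mul]
    simp [pow_succ]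

/-- A polynomial form of the Vandermonde determinant, with its columns in decreasing order. -/
theorem prod_sub_mul_prod_eq_det (n : ℕ) {R : ℕ → ℝ[X]}
    (hR : ∀ k, (R k).Monic ∧ (R k).natDegree = k) (w : ℝ → ℝ) (z : Fin (2 * n) → ℝ) :
    (∏ j, ∏ k ∈ Finset.Ioi j, (z j - z k)) * ∏ i, w (z i) =
      (-1) ^ n * Matrix.det (Matrix.of fun i j : Fin (2 * n) => (R j).eval (z i) * w (z i)) := by
  have h1 : Matrix.det (Matrix.of fun i j : Fin (2 * n) => (R j).eval (z i) * w (z i)) =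
      (∏ i, w (z i)) * ∏ j, ∏ k ∈ Finset.Ioi j, (z k - z j) := by
    rw [← Matrix.det_vandermonde, Matrix.det_eval_matrixOfPolynomials_eq_det_vandermonde z
      (fun j => R j) (fun j => (hR j).2) (fun j => (hR j).1), ← Matrix.det_mul_column]
    simp only [mul_comm, Matrix.of_apply]
  have h2 : ∏ j, ∏ k ∈ Finset.Ioi j, (z j - z k) =
      (-1) ^ n * ∏ j, ∏ k ∈ Finset.Ioi j, (z k - z j) := by
    rw [← prod_neg_one_pow_reflect, ← Finset.prod_mul_distrib]
    refine Finset.prod_congr rfl fun j _ => ?_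
    rw [← Fin.card_Ioi, ← Finset.prod_const, ← Finset.prod_mul_distrib]
    exact Finset.prod_congr rfl fun k _ => by ring
  rw [h1, h2]
  ring

theorem sq_rpow_half {p : ℝ} (hp : 0 ≤ p) (k : ℕ) : (p ^ 2) ^ ((k : ℝ) / 2) = p ^ k := by
  rw [← Real.rpow_natCast p 2, ← Real.rpow_mul hp, ← Real.rpow_natCast p k]
  congr 1
  push_cast
  ring

namespace BigQJacobiParams

variable {a b c p : ℝ}

theorem bigQJacobiNorm_succ_mul (h : BigQJacobiParams a b c p) {n : ℕ} (hn : 1 ≤ n) :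
    bigQJacobiNorm a b c p (n + 1) * ((1 - a * b * p ^ (2 * n + 1)) *
        (1 - a * b * p ^ (2 * n + 2)) ^ 2 * (1 - a * b * p ^ (2 * n + 3))) =
      bigQJacobiNorm a b c p n * (-(a * c * p ^ (n + 2)) *
        ((1 - p ^ (n + 1)) * (1 - a * p ^ (n + 1)) * (1 - b * p ^ (n + 1)) * (1 - c * p ^ (n + 1)) *
          (1 - a * b * c⁻¹ * p ^ (n + 1))) * (1 - a * b * p ^ (n + 1))) := by
  -- Two ways of splitting `(a b p^(n+1); p)_(n+2)`: off the front and off the back.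
  have e1 := qPoch_succ' (a * b * p ^ (n + 1)) p (n + 1)
  rw [qPoch_succ, qPoch_succ] at e1
  have h1 := h.qPoch_ne h.ab_lt (2 * n)
  have h2 : qPoch (a * b * p ^ (n + 1)) p n ≠ 0 := h.qPoch_ne (h.ab_pow_lt (by omega)) n
  have h3 : qPoch (a * b * p ^ (n + 1) * p) p (n + 1) ≠ 0 := by
    rw [mul_assoc, ← pow_succ]; exact h.qPoch_ne (h.ab_pow_lt (by omega)) _
  have h4 := h.one_sub_ab_ne (n := 2 * n + 1) (by omega)
  have h5 := h.one_sub_ab_ne (n := 2 * n + 2) (by omega)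
  have h6 := h.one_sub_ab_ne (n := 2 * n + 3) (by omega)
  rw [mul_assoc (a * b), mul_assoc (a * b), ← pow_add, ← pow_add,
    show n + 1 + n = 2 * n + 1 by ring, show n + 1 + (n + 1) = 2 * n + 2 by ring] at e1
  simp only [bigQJacobiNorm, qPochs, List.map_cons, List.map_nil, List.prod_cons, List.prod_nil,
    mul_one, Nat.choose_succ_succ' n 1, Nat.choose_one_right]
  rw [show 2 * (n + 1) = 2 * n + 1 + 1 by ring, qPoch_succ _ _ (2 * n + 1), qPoch_succ _ _ (2 * n),
    show a * b * p ^ 2 * p ^ (2 * n) = a * b * p ^ (2 * n + 2) by ring,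
    show a * b * p ^ 2 * p ^ (2 * n + 1) = a * b * p ^ (2 * n + 3) by ring,
    show a * b * p ^ (n + 1 + 1) = a * b * p ^ (n + 1) * p by ring, qPoch_succ p, qPoch_succ (a * p),
    qPoch_succ (b * p), qPoch_succ (c * p), qPoch_succ (a * b * c⁻¹ * p)]
  rw [div_mul_eq_mul_div, div_mul_eq_mul_div, div_eq_div_iff
    (mul_ne_zero (mul_ne_zero (mul_ne_zero h1 h5) h6) h3) (mul_ne_zero h1 h2)]
  have hs : ∀ x : ℝ, x * p * p ^ n = x * p ^ (n + 1) := fun x => by ring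
  simp only [hs, show p * p ^ n = p ^ (n + 1) by ring, pow_add p n (n.choose 2),
    pow_succ (-(a * c * p ^ 2)) n, show a * c * p ^ (n + 2) = a * c * p ^ 2 * p ^ n by ring]
  generalize (1 - p ^ (n + 1)) = x1
  generalize (1 - a * p ^ (n + 1)) = x2
  generalize (1 - b * p ^ (n + 1)) = x3
  generalize (1 - c * p ^ (n + 1)) = x4
  generalize (1 - a * b * c⁻¹ * p ^ (n + 1)) = x5
  generalize (1 - a * b * p ^ (n + 1)) = x6 at e1 ⊢
  generalize (1 - a * b * p ^ (2 * n + 1)) = x7 at e1 ⊢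
  generalize (1 - a * b * p ^ (2 * n + 2)) = x8 at e1 ⊢
  generalize (1 - a * b * p ^ (2 * n + 3)) = x9 at e1 ⊢
  generalize qPoch (a * b * p ^ (n + 1) * p) p (n + 1) = y1 at e1 ⊢
  generalize qPoch (a * b * p ^ (n + 1)) p n = y2 at e1 ⊢
  generalize qPoch (a * b * p ^ 2) p (2 * n) = y3
  generalize qPoch p p n = y4
  generalize qPoch (a * p) p n = y5
  generalize qPoch (b * p) p n = y6
  generalize qPoch (c * p) p n = y7
  generalize qPoch (a * b * c⁻¹ * p) p n = y8
  generalize (-(a * c * p ^ 2)) ^ n = y9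
  generalize p ^ (n.choose 2) = y10
  linear_combination (y4 * y5 * y6 * y7 * y8 * x1 * x2 * x3 * x4 * x5 * y9 * -(a * c * p ^ 2) *
    p ^ n * y10 * y3 * x8 * x9) * e1

/-- The quotient of the two values of `skewLead` cancels one of the two factors `1 - a b p^(4n+4)`
in the norm ratio and supplies `1 - a b p^(4n+6)`, completing the four-term product. -/
theorem skewBigQJacobiCoeff_sq (h : BigQJacobiParams a b c p) (n : ℕ) :
    skewBigQJacobiCoeff a b c (p ^ 2) n = skewCoeff a b c p n := by
  rcases n with _ | n
  · simp [skewBigQJacobiCoeff, skewCoeff]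
  · have h1 := h.bigQJacobiNorm_succ_mul (n := 2 * n + 1) (by omega)
    have h2 := h.bigQJacobiNorm_ne (2 * n + 1)
    have h4 := h.one_sub_ab_ne (n := 4 * n + 3) (by omega)
    have h5 := h.one_sub_ab_ne (n := 4 * n + 4) (by omega)
    have h6 := h.one_sub_ab_ne (n := 4 * n + 5) (by omega)
    have h7 := h.one_sub_ab_ne (n := 4 * n + 6) (by omega)
    have ha := h.a_pos.ne'
    have hc := h.c_neg.ne
    have hp := h.p_pos.ne'
    rw [show 2 * (2 * n + 1) + 1 = 4 * n + 3 by ring, show 2 * (2 * n + 1) + 2 = 4 * n + 4 by ring,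
      show 2 * (2 * n + 1) + 3 = 4 * n + 5 by ring, show 2 * n + 1 + 1 = 2 * n + 2 by ring,
      mul_comm (bigQJacobiNorm a b c p (2 * n + 1)),
      ← div_eq_div_iff h2 (mul_ne_zero (mul_ne_zero h4 (pow_ne_zero 2 h5)) h6)] at h1
    have hq : (p ^ 2) ^ (2 * ((n + 1 : ℕ) : ℝ) - 1 / 2) = p ^ (4 * n + 3) := by
      rw [← sq_rpow_half h.p_pos.le (4 * n + 3)]
      congr 1
      push_cast
      ring
    have hd : qPoch (a * b * p ^ (4 * n + 3)) p 4 = (1 - a * b * p ^ (4 * n + 3)) *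
        (1 - a * b * p ^ (4 * n + 4)) * (1 - a * b * p ^ (4 * n + 5)) *
        (1 - a * b * p ^ (4 * n + 6)) := by
      simp only [qPoch_succ, qPoch_zero]
      ring
    have hL1 : skewLead a b c p (2 * n + 1) =
        (1 - a * b * p ^ (4 * n + 4)) / (a * c * p ^ (2 * n + 3)) := by
      rw [skewLead]; ring_nf
    have hL2 : skewLead a b c p (2 * n + 2) =
        (1 - a * b * p ^ (4 * n + 6)) / (a * c * p ^ (2 * n + 4)) := by
      rw [skewLead]; ring_nf
    rw [skewCoeff, h1, hL1, hL2, skewBigQJacobiCoeff, hq, Real.sqrt_sq h.p_pos.le, hd]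
    simp only [← pow_mul, show 2 * (n + 1) = 2 * n + 2 by ring,
      show 2 * (n + 1 + 1) = 2 * n + 4 by ring]
    generalize 1 - a * b * p ^ (4 * n + 3) = y3 at h4 ⊢
    generalize 1 - a * b * p ^ (4 * n + 4) = y4 at h5 ⊢
    generalize 1 - a * b * p ^ (4 * n + 5) = y5 at h6 ⊢
    generalize 1 - a * b * p ^ (4 * n + 6) = y6 at h7 ⊢
    generalize (1 - p ^ (2 * n + 2)) = x1
    generalize (1 - a * p ^ (2 * n + 2)) = x2
    generalize (1 - b * p ^ (2 * n + 2)) = x3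
    generalize (1 - c * p ^ (2 * n + 2)) = x4
    generalize (1 - a * b * c⁻¹ * p ^ (2 * n + 2)) = x5
    generalize (1 - a * b * p ^ (2 * n + 2)) = x6
    field_simp

/-- The total mass contains `(a b p²;p)_∞`. Splitting off `4i + 1` factors cancels the first
denominator of the norm and the factor `1 - a b p^(4i+2)` of `skewLead`. The right side is grouped
as a constant, pure powers and the rest, to match the closed product. -/
theorem skewForm_value (h : BigQJacobiParams a b c p) (i : ℕ) :
    -((1 - p ^ 2) * (1 + p) * (bigQJacobiNorm a b c p (2 * i) * h.functional 1) /
        skewLead a b c p (2 * i)) =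
      (-(1 - p ^ 2) ^ 2 * (qPochsInf [p, a⁻¹ * c, a * c⁻¹ * p] p /
          qPochsInf [a * p, b * p, c * p, a * b * c⁻¹ * p] p)) *
        (a ^ (2 * i + 2) * c ^ (2 * i + 1) * p ^ (2 * i ^ 2 + 5 * i + 3)) *
        (qPochInf (a * b * p ^ (4 * i + 3)) p *
          qPochs [p, a * p, b * p, c * p, a * b * c⁻¹ * p] p (2 * i) /
            qPoch (a * b * p ^ (2 * i + 1)) p (2 * i)) := by
  have h1 := h.qPoch_ne h.ab_lt (4 * i)
  have h2 : qPoch (a * b * p ^ (2 * i + 1)) p (2 * i) ≠ 0 := by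
    rcases i with _ | i
    · simp [qPoch_zero]
    · exact h.qPoch_ne (h.ab_pow_lt (by omega)) _
  have h3 := h.one_sub_ab_ne (n := 4 * i + 2) (by omega)
  have ha := h.a_pos.ne'
  have hc := h.c_neg.ne
  have hp := h.p_pos.ne'
  have h4 := qPochInf_eq_mul h.p_pos.le h.p_lt (a * b * p ^ 2) (4 * i + 1)
  rw [qPoch_succ, show a * b * p ^ 2 * p ^ (4 * i) = a * b * p ^ (4 * i + 2) by ring,
    show a * b * p ^ 2 * p ^ (4 * i + 1) = a * b * p ^ (4 * i + 3) by ring] at h4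
  have h5 : (2 * i).choose 2 + i = 2 * i ^ 2 := by
    rw [Nat.choose_two_right, mul_assoc, Nat.mul_div_cancel_left _ two_pos]
    rcases i with _ | i
    · rfl
    · rw [show 2 * (i + 1) - 1 = 2 * i + 1 by omega]; ring
  have h6 : p ^ (2 * i ^ 2 + 5 * i + 3) = p ^ ((2 * i).choose 2) * p ^ (6 * i + 3) := by
    rw [← h5]; ring
  rw [h.functional_one, skewLead, bigQJacobiNorm, h4, h6, Even.neg_pow (even_two_mul i),
    show 2 * (2 * i) = 4 * i by ring]
  generalize qPochsInf [p, a⁻¹ * c, a * c⁻¹ * p] p /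
          qPochsInf [a * p, b * p, c * p, a * b * c⁻¹ * p] p = T
  generalize qPochs [p, a * p, b * p, c * p, a * b * c⁻¹ * p] p (2 * i) = P
  generalize p ^ ((2 * i).choose 2) = z
  generalize qPoch (a * b * p ^ 2) p (4 * i) = y1 at h1 ⊢
  generalize qPoch (a * b * p ^ (2 * i + 1)) p (2 * i) = y2 at h2 ⊢
  generalize 1 - a * b * p ^ (4 * i + 2) = y3 at h3 ⊢
  generalize qPochInf (a * b * p ^ (4 * i + 3)) p = y4
  field_simp
  ring

theorem prod_pow_eq (hp : 0 ≤ p) (hp' : p ≠ 0) (n : ℕ) :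
    ∏ i ∈ Finset.range n, (a ^ (2 * i + 2) * c ^ (2 * i + 1) * p ^ (2 * i ^ 2 + 5 * i + 3)) =
      a ^ (n ^ 2 + n) * c ^ (n ^ 2) * (p ^ 2) ^ ((n : ℝ) / 12 * (4 * n + 5) * (n + 1)) := by
  induction n with
  | zero => simp
  | succ n ih =>
    rw [Finset.prod_range_succ, ih,
      ← sq_rpow_half hp (2 * n ^ 2 + 5 * n + 3), mul_mul_mul_comm _ _ _ (_ ^ (_ : ℝ)),
      ← Real.rpow_add (by positivity)]
    congr 1
    · ring
    · congr 1
      push_cast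
      ring

theorem weight_eq (h : BigQJacobiParams a b c p) (x : ℝ) :
    qPochsInf [a⁻¹ * p * x, c⁻¹ * p * x] (p ^ 2) / qPochsInf [x, b * c⁻¹ * x] (p ^ 2) =
      h.skewWeight x := by
  have hp := h.p_pos.ne'
  simp only [qPochsInf, List.map_cons, List.map_nil, List.prod_cons, List.prod_nil, mul_one,
    skewWeight, pochWeight, one_mul]
  rw [show (a * p)⁻¹ * p ^ 2 = a⁻¹ * p by field_simp, show (c * p)⁻¹ * p ^ 2 = c⁻¹ * p by field_simp]

theorem bigQJacobiWeight_eq (h : BigQJacobiParams a b c p) :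
    bigQJacobiWeight (a / p) (b / p) (c / p) (p ^ 2) = h.skewWeight := by
  have hp := h.p_pos.ne'
  funext x
  rw [← h.weight_eq, bigQJacobiWeight, inv_div, inv_div, div_eq_inv_mul p a, div_eq_inv_mul p c,
    show b / p * (c⁻¹ * p) = b * c⁻¹ by field_simp]

/-- The monic skew big `q`-Jacobi polynomials. -/
noncomputable def skewPoly (a b c p : ℝ) (n : ℕ) : ℝ[X] :=
  if Even n then bigQJacobi a b c p n
  else bigQJacobi a b c p n + C (skewCoeff a b c p (n / 2)) * bigQJacobi a b c p (n - 2)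

theorem skewPoly_even (a b c p : ℝ) (n : ℕ) :
    skewPoly a b c p (2 * n) = bigQJacobi a b c p (2 * n) := by
  simp [skewPoly]

theorem skewPoly_odd (a b c p : ℝ) (n : ℕ) :
    skewPoly a b c p (2 * n + 1) = bigQJacobi a b c p (2 * n + 1) +
      C (skewCoeff a b c p n) * bigQJacobi a b c p (2 * n - 1) := by
  rw [skewPoly, if_neg (by simp), show (2 * n + 1) / 2 = n by omega,
    show 2 * n + 1 - 2 = 2 * n - 1 by omega]

theorem skewOrthogonalFor_skewPoly (h : BigQJacobiParams a b c p) :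
    SkewOrthogonalFor h.skewForm (skewPoly a b c p) ∧
      ∀ n, h.skewForm (skewPoly a b c p (2 * n)) (skewPoly a b c p (2 * n + 1)) =
        -((1 - p ^ 2) * (1 + p) * (bigQJacobiNorm a b c p (2 * n) * h.functional 1) /
          skewLead a b c p (2 * n)) := by
  have := h.isJacksonDomain.sq_lt
  have := h.p_pos
  exact h.skewOrthogonalFor h.isPearson_functional h.functional_one_ne h.skewForm_self
    (mul_ne_zero (by linarith) (by linarith)) h.skewForm_skewOp (skewPoly_even a b c p)
    (skewPoly_odd a b c p)

theorem isMonicSkewOrthogonal_iff (h : BigQJacobiParams a b c p) (Q : ℕ → ℝ[X]) :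
    IsMonicSkewOrthogonal (skewInner (p ^ 2) (c * p) (a * p) h.skewWeight) Q ↔
      ∃ α : ℕ → ℝ, ∀ n : ℕ, Q (2 * n) = bigQJacobi a b c p (2 * n) ∧
        Q (2 * n + 1) = bigQJacobi a b c p (2 * n + 1) +
          C (skewBigQJacobiCoeff a b c (p ^ 2) n) * bigQJacobi a b c p (2 * n - 1) +
          C (α n) * Q (2 * n) := by
  have h1 := h.skewOrthogonalFor_skewPoly.1.iff_exists (Q := Q) h.skewForm_self
  simp only [skewPoly_even, skewPoly_odd, ← h.skewBigQJacobiCoeff_sq] at h1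
  rw [← h1]
  simp only [IsMonicSkewOrthogonal, SkewOrthogonalFor, (h.skewInner_eq_skewForm _ _).2]

theorem orderedJackson_bigQJacobi (h : BigQJacobiParams a b c p) (n : ℕ) :
    OrderedJacksonConverges (p ^ 2) (c * p) (2 * n) (a * p)
        (bigQJacobiOrderedIntegrand a b c (p ^ 2) n) ∧
      orderedJackson (p ^ 2) (c * p) (2 * n) (a * p)
        (bigQJacobiOrderedIntegrand a b c (p ^ 2) n) =
        ∏ i ∈ Finset.range n, -((1 - p ^ 2) * (1 + p) *
          (bigQJacobiNorm a b c p (2 * i) * h.functional 1) / skewLead a b c p (2 * i)) := by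
  obtain ⟨⟨hR, h0, h1, u, -, hu⟩, hval⟩ := h.skewOrthogonalFor_skewPoly
  have hdet := orderedJackson_det h.isJacksonDomain h.right_mem
    (φ := fun k x => (skewPoly a b c p k).eval x) (w := h.skewWeight) (u := u)
    (fun k => h.convergesOn_skewWeight _) n
    (fun i j => by rw [(h.skewInner_eq_skewForm _ _).2, h0])
    (fun i j => by rw [(h.skewInner_eq_skewForm _ _).2, h1])
    (fun i j => by rw [(h.skewInner_eq_skewForm _ _).2, hu])
  have hint : bigQJacobiOrderedIntegrand a b c (p ^ 2) n = fun z => (-1) ^ n *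
      Matrix.det (Matrix.of fun i j : Fin (2 * n) =>
        (skewPoly a b c p j).eval (z i) * h.skewWeight (z i)) := by
    funext z
    rw [← prod_sub_mul_prod_eq_det n hR]
    simp only [bigQJacobiOrderedIntegrand, Real.sqrt_sq h.p_pos.le, h.weight_eq]
  have hu' : ∀ i, u i = -((1 - p ^ 2) * (1 + p) *
      (bigQJacobiNorm a b c p (2 * i) * h.functional 1) / skewLead a b c p (2 * i)) := fun i => by
    rw [← hval, hu, if_pos rfl]
  -- The sign from ordering the Vandermonde factors decreasingly cancels the sign in de Bruijn's
  -- formula.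
  rw [hint, orderedJackson_const_mul, hdet.2, ← mul_assoc, ← mul_pow]
  simp only [neg_mul_neg, one_mul, one_pow, hu', and_true]
  exact hdet.1.const_mul _

theorem orderedJackson_bigQJacobi_eq (h : BigQJacobiParams a b c p) (n : ℕ) :
    orderedJackson (p ^ 2) (c * p) (2 * n) (a * p) (bigQJacobiOrderedIntegrand a b c (p ^ 2) n) =
      (-1) ^ n * (1 - p ^ 2) ^ (2 * n) * a ^ (n ^ 2 + n) * c ^ (n ^ 2)
        * (p ^ 2) ^ ((n : ℝ) / 12 * (4 * n + 5) * (n + 1))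
        * (qPochsInf [p, a⁻¹ * c, a * c⁻¹ * p] p ^ n /
            qPochsInf [a * p, b * p, c * p, a * b * c⁻¹ * p] p ^ n)
        * ∏ i ∈ Finset.range n,
            qPochInf (a * b * (p ^ 2) ^ (2 * (i : ℝ) + 3 / 2)) p
              * qPochs [p, a * p, b * p, c * p, a * b * c⁻¹ * p] p (2 * i)
              / qPoch (a * b * (p ^ 2) ^ ((i : ℝ) + 1 / 2)) p (2 * i) := by
  have e1 : ∀ i : ℕ, (p ^ 2) ^ (2 * (i : ℝ) + 3 / 2) = p ^ (4 * i + 3) := fun i => by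
    rw [← sq_rpow_half h.p_pos.le (4 * i + 3)]
    congr 1
    push_cast
    ring
  have e2 : ∀ i : ℕ, (p ^ 2) ^ ((i : ℝ) + 1 / 2) = p ^ (2 * i + 1) := fun i => by
    rw [← sq_rpow_half h.p_pos.le (2 * i + 1)]
    congr 1
    push_cast
    ring
  rw [(h.orderedJackson_bigQJacobi n).2]
  simp only [h.skewForm_value, e1, e2]
  rw [Finset.prod_mul_distrib, Finset.prod_mul_distrib, Finset.prod_const, Finset.card_range,
    prod_pow_eq h.p_pos.le h.p_pos.ne', mul_pow, div_pow, neg_pow, ← pow_mul]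
  ring

end BigQJacobiParams

end

theorem mainTheorem11 (q a b c : ℝ) (hq0 : 0 < q) (hq1 : q < 1)
    (ha0 : 0 < a * √q) (ha1 : a * √q < 1) (hb0 : 0 ≤ b * √q) (hb1 : b * √q < 1) (hc : c < 0) :
    -- convergence of the skew inner product on polynomials
    (∀ P R : ℝ[X], SkewInnerConverges q (c * √q) (a * √q)
      (bigQJacobiWeight (a / √q) (b / √q) (c / √q) q) (fun x => P.eval x) (fun x => R.eval x)) ∧
    -- the skew orthogonal polynomials (unique up to adding multiples of `Q (2 * n)` to
    -- `Q (2 * n + 1)`; for `n = 0` the term with `J (2 * n - 1)` has coefficient zero)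
    (∀ Q : ℕ → ℝ[X],
      IsMonicSkewOrthogonal
          (skewInner q (c * √q) (a * √q) (bigQJacobiWeight (a / √q) (b / √q) (c / √q) q)) Q ↔
        ∃ α : ℕ → ℝ, ∀ n : ℕ,
          Q (2 * n) = bigQJacobi a b c (√q) (2 * n) ∧
          Q (2 * n + 1) = bigQJacobi a b c (√q) (2 * n + 1)
            + C (skewBigQJacobiCoeff a b c q n) * bigQJacobi a b c (√q) (2 * n - 1)
            + C (α n) * Q (2 * n)) ∧
    -- the ordered `2n`-fold `q`-integral
    (∀ n : ℕ,
      OrderedJacksonConverges q (c * √q) (2 * n) (a * √q) (bigQJacobiOrderedIntegrand a b c q n) ∧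
      orderedJackson q (c * √q) (2 * n) (a * √q) (bigQJacobiOrderedIntegrand a b c q n) =
        (-1) ^ n * (1 - q) ^ (2 * n) * a ^ (n ^ 2 + n) * c ^ (n ^ 2)
          * q ^ ((n : ℝ) / 12 * (4 * n + 5) * (n + 1))
          * (qPochsInf [√q, a⁻¹ * c, a * c⁻¹ * √q] (√q) ^ n /
              qPochsInf [a * √q, b * √q, c * √q, a * b * c⁻¹ * √q] (√q) ^ n)
          * ∏ i ∈ Finset.range n,
              qPochInf (a * b * q ^ (2 * (i : ℝ) + 3 / 2)) (√q)
                * qPochs [√q, a * √q, b * √q, c * √q, a * b * c⁻¹ * √q] (√q) (2 * i)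
                / qPoch (a * b * q ^ ((i : ℝ) + 1 / 2)) (√q) (2 * i)) := by

  -- Replacing `q` by `p ^ 2` turns every `√q` into `p`, the base in which the polynomials live.
  obtain ⟨p, hp0, rfl⟩ : ∃ p : ℝ, 0 < p ∧ q = p ^ 2 :=
    ⟨√q, Real.sqrt_pos.mpr hq0, (Real.sq_sqrt hq0.le).symm⟩
  rw [Real.sqrt_sq hp0.le] at *
  have h : BigQJacobiParams a b c p :=
    ⟨hp0, by nlinarith, pos_of_mul_pos_left ha0 hp0.le, ha1, nonneg_of_mul_nonneg_left hb0 hp0,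
      hb1, hc⟩
  rw [h.bigQJacobiWeight_eq]
  exact ⟨fun P R => (h.skewInner_eq_skewForm P R).1, h.isMonicSkewOrthogonal_iff,
    fun n => ⟨(h.orderedJackson_bigQJacobi n).1, h.orderedJackson_bigQJacobi_eq n⟩⟩
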